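/- Let $k$ be an algebraically closed field of characteristic $0$ and let $A=k\{x,y\}/(xy-yx-1)$ be the first Weyl algebra, $\mathbb Z$-graded by $\deg x=1$, $\deg y=-1$. For a $\mathbb Z$-graded $k$-algebra $R$, let $\mathrm{gr}\text{-}R$ be the category of $\mathbb Z$-graded right $R$-modules and degree-preserving homomorphisms, and write $M\langle n\rangle_j=M_{j-n}$. Two graded algebras $R,R'$ are *graded equivalent* if there is a $k$-linear equivalence $\mathrm{gr}\text{-}R\simeq\mathrm{gr}\text{-}R'$. Let $\mathcal S_A: M\mapsto M\langle 1\rangle$ be the shift functor on $\mathrm{gr}\text{-}A$. Let $T=A/xA$ and $T'=(A/yA)\langle 1\rangle$. For $j\in\mathbb Z$ let $\iota_j$ be the autoequivalence of $\mathrm{gr}\text{-}A$, unique up to natural isomorphism, that on graded projective modules $P$ of rank one is the reject of $T\langle j\rangle\oplus T'\langle j\rangle$ in $P$ (the intersection of the kernels of all graded homomorphisms from $P$ to $T\langle j\rangle\oplus T'\langle j\rangle$), with homomorphisms acting by restriction. For a finite set $J\subset\mathbb Z$ let $\iota_J$ be the composite of the $\iota_j$, $j\in J$ (with $\iota_\emptyset=\mathrm{id}$).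 For an autoequivalence $\mathcal F$ of $\mathrm{gr}\text{-}A$, choose a sequence $(\mathcal F_i)_{i\in\mathbb Z}$ of $k$-linear endofunctors with $\mathcal F_1\cong\mathcal F$, $\mathcal F_0\cong\mathrm{id}$, and coherent (unital and associative) natural isomorphisms $\mathcal F_{i+j}\cong\mathcal F_i\mathcal F_j$. The *twisted endomorphism ring* is the $\mathbb Z$-graded $k$-algebra $\mathrm{End}^{\mathcal F}_A(A)=\bigoplus_{i\in\mathbb Z}\mathrm{Hom}_{\mathrm{gr}\text{-}A}(\mathcal F_iA,A)$, where the product of $a$ in degree $i$ and $b$ in degree $j$ is the composite $\mathcal F_{i+j}A\cong\mathcal F_i\mathcal F_jA\xrightarrow{\mathcal F_i(b)}\mathcal F_iA\xrightarrow{a}A$. For $n\ge 1$ and $J\subseteq\{0,\dots,n-1\}$ put $f_J=\prod_{i\in J}(z+i)$ and $f=\prod_{0\le i\le n-1,\ i\notin J}(z+i)$, let $W$ be the $k$-algebra generated by $X,Y,z$ with relations $Xz-zX=nX$, $Yz-zY=-nY$, $XY=f(z)$, $YX=f(z-n)$, graded by $\deg X=1$, $\deg Y=-1$, $\deg z=0$,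 and let $S(J,n)=k[z]+f_JW\subseteq W$ with the induced grading. **Proposition.** 1. Let $n\ge1$, let $J\subseteq\{0,\dots,n-1\}$, and let $\mathcal F\cong\mathcal S_A^n\circ\iota_J$. Then a sequence $(\mathcal F_i)$ as above exists, and for every such sequence $\mathrm{End}^{\mathcal F}_A(A)$ is isomorphic to $S(J,n)$ as a $\mathbb Z$-graded $k$-algebra. 2. For every $n\ge1$, the Veronese ring $A^{(n)}=\bigoplus_{i\in\mathbb Z}A_{ni}$ (with $A_{ni}$ in degree $i$) is graded equivalent to $A$. 3. $A$ is graded equivalent to the subring $k+xA[y^{-1}]$ of $A[y^{-1}]$ (graded by $\deg y^{-1}=1$), and this subring is the idealizer $\{\theta\in A[y^{-1}] : \theta\,xA[y^{-1}]\subseteq xA[y^{-1}]\}$ of the right ideal $xA[y^{-1}]$. -/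

import Mathlib

open CategoryTheory TensorProduct

universe u

namespace GrWeyl

noncomputable section

/-! ## Graded right modules over a `ℤ`-graded algebra -/

section GradedModules

variable {k R : Type u} [Field k] [Ring R] [Algebra k R]

/-- A `ℤ`-graded right module `M = ⨁ᵢ Mᵢ` over the `ℤ`-graded `k`-algebra `R = ⨁ 𝒜 d`, given by its
homogeneous pieces `X i = Mᵢ` and the right multiplications `Mᵢ × R_d → M_{i+d}`. -/
structure GrMod (𝒜 : ℤ → Submodule k R) [SetLike.GradedMonoid 𝒜] where
  X : ℤ → Type u
  [addCommGroup : ∀ i, AddCommGroup (X i)]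
  [module : ∀ i, Module k (X i)]
  /-- `act h m r` is the product `m · r`. -/
  act : ∀ {i d n : ℤ}, i + d = n → (X i →ₗ[k] 𝒜 d →ₗ[k] X n)
  act_one : ∀ {i : ℤ} (m : X i), act (add_zero i) m ⟨1, SetLike.GradedOne.one_mem⟩ = m
  act_mul : ∀ {i d n e p : ℤ} (h : i + d = n) (h' : n + e = p) (h'' : i + (d + e) = p)
    (m : X i) (r : 𝒜 d) (s : 𝒜 e),
    act h' (act h m r) s =
      act h'' m ⟨(r : R) * (s : R), SetLike.GradedMul.mul_mem r.2 s.2⟩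

attribute [instance] GrMod.addCommGroup GrMod.module

variable {𝒜 : ℤ → Submodule k R} [SetLike.GradedMonoid 𝒜]

namespace GrMod

/-- The degree-preserving `R`-linear maps `M → N`, as a space of families of `k`-linear maps
`Mᵢ → Nᵢ`. -/
def homSpace (M N : GrMod 𝒜) : Submodule k (∀ i, M.X i →ₗ[k] N.X i) where
  carrier := {f | ∀ (i d n : ℤ) (h : i + d = n) (m : M.X i) (r : 𝒜 d),
    f n (M.act h m r) = N.act h (f i m) r}
  zero_mem' := by intro i d n h m r; simp
  add_mem' := by
    intro f g hf hg i d n h m r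
    simp [hf i d n h m r, hg i d n h m r]
  smul_mem' := by
    intro c f hf i d n h m r
    simp [hf i d n h m r]

/-- The category of graded right modules and degree-preserving homomorphisms. -/
instance : Category.{u} (GrMod 𝒜) where
  Hom M N := homSpace M N
  id M := ⟨fun _ => LinearMap.id, by intro i d n h m r; rfl⟩
  comp f g := ⟨fun i => (g.1 i).comp (f.1 i), by
    intro i d n h m r
    simp only [LinearMap.comp_apply]
    rw [f.2 i d n h m r, g.2 i d n h]⟩

/-- The component `Mᵢ → Nᵢ` of a homomorphism of graded modules. -/
def app {M N : GrMod 𝒜} (f : M ⟶ N) (i : ℤ) : M.X i →ₗ[k] N.X i := f.1 i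

/-- A morphism from its components. -/
def mkHom {M N : GrMod 𝒜} (f : ∀ i, M.X i →ₗ[k] N.X i)
    (hf : ∀ (i d n : ℤ) (h : i + d = n) (m : M.X i) (r : 𝒜 d),
      f n (M.act h m r) = N.act h (f i m) r) : M ⟶ N := ⟨f, hf⟩

@[simp] lemma app_mkHom {M N : GrMod 𝒜} (f : ∀ i, M.X i →ₗ[k] N.X i) (hf) (i : ℤ) :
    app (mkHom f hf : M ⟶ N) i = f i := rfl

lemma app_act {M N : GrMod 𝒜} (f : M ⟶ N) {i d n : ℤ} (h : i + d = n) (m : M.X i) (r : 𝒜 d) :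
    app f n (M.act h m r) = N.act h (app f i m) r := f.2 i d n h m r

@[ext] lemma hom_ext {M N : GrMod 𝒜} {f g : M ⟶ N} (h : ∀ i m, app f i m = app g i m) : f = g :=
  Subtype.ext (funext fun i => LinearMap.ext (h i))

@[simp] lemma app_id (M : GrMod 𝒜) (i : ℤ) : app (𝟙 M) i = LinearMap.id := rfl

@[simp] lemma app_comp {M N P : GrMod 𝒜} (f : M ⟶ N) (g : N ⟶ P) (i : ℤ) :
    app (f ≫ g) i = (app g i).comp (app f i) := rfl

instance (M N : GrMod 𝒜) : AddCommGroup (M ⟶ N) :=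
  inferInstanceAs (AddCommGroup (homSpace M N))

instance homModule (M N : GrMod 𝒜) : Module k (M ⟶ N) :=
  inferInstanceAs (Module k (homSpace M N))

@[simp] lemma app_add {M N : GrMod 𝒜} (f g : M ⟶ N) (i : ℤ) :
    app (f + g) i = app f i + app g i := rfl

@[simp] lemma app_smul {M N : GrMod 𝒜} (c : k) (f : M ⟶ N) (i : ℤ) :
    app (c • f) i = c • app f i := rfl

instance : Preadditive (GrMod 𝒜) where
  add_comp := by intros; ext; simp
  comp_add := by intros; ext; simp

instance : Linear k (GrMod 𝒜) where
  homModule := homModule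
  smul_comp := by intros; ext; simp
  comp_smul := by intros; ext; simp

/-- The shifted module `M⟨b⟩`, with `M⟨b⟩ⱼ = M_{j-b}`. -/
def shiftObj (b : ℤ) (M : GrMod 𝒜) : GrMod 𝒜 where
  X j := M.X (j - b)
  act {i d n} h := M.act (show i - b + d = n - b by omega)
  act_one m := M.act_one m
  act_mul _ _ _ m r s := M.act_mul _ _ _ m r s

/-- The functor `M ↦ M⟨b⟩`, which is the `b`-th power of the shift functor `M ↦ M⟨1⟩`. -/
def shift (b : ℤ) : GrMod 𝒜 ⥤ GrMod 𝒜 where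
  obj := shiftObj b
  map f := mkHom (fun j => app f (j - b)) (fun _ _ _ _ m r => app_act f _ m r)

variable (𝒜) in
/-- `R` as a graded right module over itself. -/
def self : GrMod 𝒜 where
  X i := 𝒜 i
  act h := LinearMap.mk₂ k
    (fun m r => ⟨(m : R) * (r : R), h ▸ SetLike.GradedMul.mul_mem m.2 r.2⟩)
    (fun _ _ _ => Subtype.ext (add_mul _ _ _))
    (fun _ _ _ => Subtype.ext (smul_mul_assoc _ _ _))
    (fun _ _ _ => Subtype.ext (mul_add _ _ _))
    (fun _ _ _ => Subtype.ext (mul_smul_comm _ _ _))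
  act_one _ := Subtype.ext (mul_one _)
  act_mul _ _ _ _ _ _ := Subtype.ext (mul_assoc _ _ _)

variable (𝒜) in
/-- The degree `n` part of the right ideal `v R`. -/
def cyclicIdeal (v : R) (n : ℤ) : Submodule k (𝒜 n) :=
  (LinearMap.range (LinearMap.mulLeft k v)).comap (𝒜 n).subtype

variable (𝒜) in
/-- The graded right module `R / v R`, for a homogeneous element `v`. -/
def cyclic (v : R) : GrMod 𝒜 where
  X n := 𝒜 n ⧸ cyclicIdeal 𝒜 v n
  act {i d n} h := (cyclicIdeal 𝒜 v i).liftQ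
    (((LinearMap.compRight k (cyclicIdeal 𝒜 v n).mkQ)).comp ((self 𝒜).act h)) (by
      rintro m ⟨r, hr⟩
      ext s
      refine (Submodule.Quotient.mk_eq_zero _).2 ⟨r * (s : R), ?_⟩
      change v * (r * (s : R)) = (m : R) * (s : R)
      rw [← mul_assoc]
      exact congrArg (· * (s : R)) hr)
  act_one {i} m := by
    obtain ⟨m, rfl⟩ := Submodule.Quotient.mk_surjective _ m
    exact congrArg (Submodule.Quotient.mk (p := cyclicIdeal 𝒜 v i)) ((self 𝒜).act_one m)
  act_mul {i d n e p} h h' h'' m r s := by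
    obtain ⟨m, rfl⟩ := Submodule.Quotient.mk_surjective _ m
    exact congrArg (Submodule.Quotient.mk (p := cyclicIdeal 𝒜 v p))
      ((self 𝒜).act_mul h h' h'' m r s)

/-- The free module `R⟨i⟩` of rank one on a generator of degree `i`. -/
abbrev free (i : ℤ) : GrMod 𝒜 := shiftObj i (self 𝒜)

/-- Left multiplication by `r ∈ R_d`, as a homomorphism `R⟨i + d⟩ → R⟨i⟩`. -/
def lmul {i d p : ℤ} (h : i + d = p) (r : 𝒜 d) : (free p : GrMod 𝒜) ⟶ free i :=
  mkHom (fun n =>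
    { toFun := fun a => ((self 𝒜).act (show d + (n - p) = n - i by omega) r a : 𝒜 (n - i))
      map_add' := fun a b => map_add _ a b
      map_smul' := fun c a => map_smul _ c a })
    (fun n e q _ m s => ((self 𝒜).act_mul (show d + (n - p) = n - i by omega)
      (show n - i + e = q - i by omega) (show d + (n - p + e) = q - i by omega) r m s).symm)

/-- The degree `n` part of the reject of `U ⊕ V` in `M`: the intersection of the kernels of all
graded homomorphisms from `M` to `U` and to `V`. -/
def rejectSpace (U V M : GrMod 𝒜) (n : ℤ) : Submodule k (M.X n) :=
  (⨅ f : M ⟶ U, LinearMap.ker (app f n)) ⊓ (⨅ g : M ⟶ V, LinearMap.ker (app g n))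

lemma mem_rejectSpace {U V M : GrMod 𝒜} {n : ℤ} {m : M.X n} :
    m ∈ rejectSpace U V M n ↔
      (∀ f : M ⟶ U, app f n m = 0) ∧ (∀ g : M ⟶ V, app g n m = 0) := by
  simp [rejectSpace, Submodule.mem_iInf]

/-- The reject of `U ⊕ V` in `M`, as a graded submodule of `M`. -/
def rejectObj (U V M : GrMod 𝒜) : GrMod 𝒜 where
  X n := rejectSpace U V M n
  act {i d n} h := LinearMap.mk₂ k
    (fun m r => ⟨M.act h m.1 r, mem_rejectSpace.2
      ⟨fun f => by rw [app_act, (mem_rejectSpace.1 m.2).1 f]; simp,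
       fun g => by rw [app_act, (mem_rejectSpace.1 m.2).2 g]; simp⟩⟩)
    (fun _ _ _ => Subtype.ext (by simp))
    (fun _ _ _ => Subtype.ext (by simp))
    (fun _ _ _ => Subtype.ext (by simp))
    (fun _ _ _ => Subtype.ext (by simp))
  act_one m := Subtype.ext (M.act_one m.1)
  act_mul h h' h'' m r s := Subtype.ext (M.act_mul h h' h'' m.1 r s)

/-- The reject of `U ⊕ V`, as a subfunctor of the identity: homomorphisms are restricted. -/
def reject (U V : GrMod 𝒜) : GrMod 𝒜 ⥤ GrMod 𝒜 where
  obj M := rejectObj U V M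
  map {M N} f := mkHom
    (fun n => (app f n).restrict (fun m hm => mem_rejectSpace.2
      ⟨fun g => (mem_rejectSpace.1 hm).1 (f ≫ g), fun g => (mem_rejectSpace.1 hm).2 (f ≫ g)⟩))
    (fun _ _ _ h m r => Subtype.ext (app_act f h m.1 r))

/-! ### Extending a functor from the free modules of rank one to all graded modules

For a functor `G`, the modules `G(R⟨i⟩)` and the maps `G(r·)` between them form a bigraded
bimodule `G(R̄)`, and `extend G` is the functor `M ↦ M ⊗ G(R̄)`, the tensor product over the
`ℤ`-algebra of `R`.  Up to natural isomorphism it is the only `k`-linear functor that preserves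
colimits and agrees with `G` on the modules `R⟨i⟩` and the homomorphisms between them
(when `G` is `k`-linear). -/

variable (G : GrMod 𝒜 ⥤ GrMod 𝒜)

/-- The degree `n` part of `⨁ᵢ Mᵢ ⊗ₖ G(R⟨i⟩)`. -/
abbrev PreTensor (M : GrMod 𝒜) (n : ℤ) : Type u :=
  DirectSum ℤ (fun i => M.X i ⊗[k] (G.obj (free i)).X n)

/-- The relations `(m · r) ⊗ b = m ⊗ (r · b)` that are imposed to obtain the tensor product. -/
def tensorRel (M : GrMod 𝒜) (n : ℤ) : Submodule k (PreTensor G M n) :=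
  Submodule.span k {t | ∃ (i d p : ℤ) (h : i + d = p) (m : M.X i) (r : 𝒜 d)
    (b : (G.obj (free p)).X n),
    t = DirectSum.lof k ℤ (fun i => M.X i ⊗[k] (G.obj (free i)).X n) p (M.act h m r ⊗ₜ b)
      - DirectSum.lof k ℤ (fun i => M.X i ⊗[k] (G.obj (free i)).X n) i
          (m ⊗ₜ app (G.map (lmul h r)) n b)}

/-- The degree `n` part of `M ⊗ G(R̄)`. -/
abbrev Tensor (M : GrMod 𝒜) (n : ℤ) : Type u := PreTensor G M n ⧸ tensorRel G M n

/-- The class of `m ⊗ b` in the tensor product, as a bilinear map. -/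
def tmk (M : GrMod 𝒜) (n i : ℤ) :
    M.X i →ₗ[k] (G.obj (free i)).X n →ₗ[k] Tensor G M n :=
  TensorProduct.curry ((tensorRel G M n).mkQ.comp
    (DirectSum.lof k ℤ (fun i => M.X i ⊗[k] (G.obj (free i)).X n) i))

lemma tmk_act (M : GrMod 𝒜) (n : ℤ) {i d p : ℤ} (h : i + d = p) (m : M.X i) (r : 𝒜 d)
    (b : (G.obj (free p)).X n) :
    tmk G M n p (M.act h m r) b = tmk G M n i m (app (G.map (lmul h r)) n b) :=
  (Submodule.Quotient.eq _).2 (Submodule.subset_span ⟨i, d, p, h, m, r, b, rfl⟩)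

lemma tensor_ext {M : GrMod 𝒜} {n : ℤ} {V : Type*} [AddCommGroup V] [Module k V]
    {f g : Tensor G M n →ₗ[k] V}
    (h : ∀ i (m : M.X i) b, f (tmk G M n i m b) = g (tmk G M n i m b)) : f = g := by
  apply Submodule.linearMap_qext
  apply DirectSum.linearMap_ext
  intro i
  apply TensorProduct.ext'
  intro m b
  exact h i m b

/-- Linear maps out of the tensor product. -/
def tensorLift {M : GrMod 𝒜} {n : ℤ} {V : Type*} [AddCommGroup V] [Module k V]
    (φ : ∀ i, M.X i →ₗ[k] (G.obj (free i)).X n →ₗ[k] V)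
    (hφ : ∀ (i d p : ℤ) (h : i + d = p) (m : M.X i) (r : 𝒜 d) (b : (G.obj (free p)).X n),
      φ p (M.act h m r) b = φ i m (app (G.map (lmul h r)) n b)) :
    Tensor G M n →ₗ[k] V :=
  (tensorRel G M n).liftQ (DirectSum.toModule k ℤ V fun i => TensorProduct.lift (φ i)) (by
    refine Submodule.span_le.2 ?_
    rintro _ ⟨i, d, p, h, m, r, b, rfl⟩
    simp [hφ i d p h m r b])

lemma tensorLift_tmk {M : GrMod 𝒜} {n : ℤ} {V : Type*} [AddCommGroup V] [Module k V]
    (φ : ∀ i, M.X i →ₗ[k] (G.obj (free i)).X n →ₗ[k] V) (hφ) (i : ℤ) (m : M.X i)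
    (b : (G.obj (free i)).X n) :
    tensorLift G φ hφ (tmk G M n i m b) = φ i m b := by
  refine (Submodule.liftQ_apply _ _ _).trans ?_
  simp

/-- The right action `(m ⊗ b) · s = m ⊗ (b · s)`. -/
def tensorAct (M : GrMod 𝒜) {n e q : ℤ} (h : n + e = q) :
    Tensor G M n →ₗ[k] 𝒜 e →ₗ[k] Tensor G M q :=
  tensorLift G
    (fun i => ((LinearMap.llcomp k (𝒜 e) _ _).comp (tmk G M q i)).compl₂
      ((G.obj (free i)).act h))
    (fun i d p h' m r b => LinearMap.ext fun s => by
      simp only [LinearMap.compl₂_apply, LinearMap.comp_apply, LinearMap.llcomp_apply,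
        tmk_act, app_act])

lemma tensorAct_tmk (M : GrMod 𝒜) {n e q : ℤ} (h : n + e = q) (i : ℤ) (m : M.X i)
    (b : (G.obj (free i)).X n) (s : 𝒜 e) :
    tensorAct G M h (tmk G M n i m b) s = tmk G M q i m ((G.obj (free i)).act h b s) := by
  rw [tensorAct, tensorLift_tmk]
  rfl

/-- The module `M ⊗ G(R̄)`. -/
def extendObj (M : GrMod 𝒜) : GrMod 𝒜 where
  X n := Tensor G M n
  act h := tensorAct G M h
  act_one {n} t := by
    refine LinearMap.congr_fun (f := (LinearMap.flip (tensorAct G M (add_zero n))) _)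
      (g := LinearMap.id) (tensor_ext G fun i m b => ?_) t
    rw [LinearMap.flip_apply, tensorAct_tmk, (G.obj (free i)).act_one, LinearMap.id_apply]
  act_mul h h' h'' t r s := by
    refine LinearMap.congr_fun (f := ((LinearMap.flip (tensorAct G M h')) s).comp
      ((LinearMap.flip (tensorAct G M h)) r))
      (g := (LinearMap.flip (tensorAct G M h'')) _) (tensor_ext G fun i m b => ?_) t
    rw [LinearMap.comp_apply, LinearMap.flip_apply, LinearMap.flip_apply, LinearMap.flip_apply,
      tensorAct_tmk, tensorAct_tmk, tensorAct_tmk, (G.obj (free i)).act_mul h h' h'']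

/-- The map `m ⊗ b ↦ f(m) ⊗ b`. -/
def tensorMap {M N : GrMod 𝒜} (f : M ⟶ N) (n : ℤ) : Tensor G M n →ₗ[k] Tensor G N n :=
  tensorLift G (fun i => (tmk G N n i).comp (app f i)) (fun i d p h m r b => by
    rw [LinearMap.comp_apply, LinearMap.comp_apply, app_act, tmk_act])

lemma tensorMap_tmk {M N : GrMod 𝒜} (f : M ⟶ N) (n i : ℤ) (m : M.X i)
    (b : (G.obj (free i)).X n) :
    tensorMap G f n (tmk G M n i m b) = tmk G N n i (app f i m) b := by
  rw [tensorMap, tensorLift_tmk]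
  rfl

lemma tensorMap_act {M N : GrMod 𝒜} (f : M ⟶ N) {n e q : ℤ} (h : n + e = q)
    (t : Tensor G M n) (s : 𝒜 e) :
    tensorMap G f q (tensorAct G M h t s) = tensorAct G N h (tensorMap G f n t) s := by
  refine LinearMap.congr_fun
    (f := (tensorMap G f q).comp ((LinearMap.flip (tensorAct G M h)) s))
    (g := ((LinearMap.flip (tensorAct G N h)) s).comp (tensorMap G f n))
    (tensor_ext G fun i m b => ?_) t
  rw [LinearMap.comp_apply, LinearMap.flip_apply, LinearMap.comp_apply, LinearMap.flip_apply,
    tensorAct_tmk, tensorMap_tmk, tensorMap_tmk, tensorAct_tmk]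

lemma tensorMap_id (M : GrMod 𝒜) (n : ℤ) : tensorMap G (𝟙 M) n = LinearMap.id :=
  tensor_ext G fun i m b => by
    rw [tensorMap_tmk, app_id, LinearMap.id_apply, LinearMap.id_apply]

lemma tensorMap_comp {M N P : GrMod 𝒜} (f : M ⟶ N) (g : N ⟶ P) (n : ℤ) :
    tensorMap G (f ≫ g) n = (tensorMap G g n).comp (tensorMap G f n) :=
  tensor_ext G fun i m b => by
    rw [tensorMap_tmk, LinearMap.comp_apply, tensorMap_tmk, tensorMap_tmk, app_comp,
      LinearMap.comp_apply]

/-- The functor `M ↦ M ⊗ G(R̄)`. -/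
def extend : GrMod 𝒜 ⥤ GrMod 𝒜 where
  obj M := extendObj G M
  map f := mkHom (tensorMap G f) (fun _ _ _ h t s => tensorMap_act G f h t s)
  map_id M := hom_ext fun n => LinearMap.congr_fun (tensorMap_id G M n)
  map_comp f g := hom_ext fun n => LinearMap.congr_fun (tensorMap_comp G f g n)

end GrMod

/-! ## Graded equivalence -/

variable {R' : Type u} [Ring R'] [Algebra k R']

/-- Two `ℤ`-graded `k`-algebras are graded equivalent if their categories of graded right modules
are equivalent by a `k`-linear equivalence. -/
def GradedEquivalent (𝒜 : ℤ → Submodule k R) [SetLike.GradedMonoid 𝒜]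
    (ℬ : ℤ → Submodule k R') [SetLike.GradedMonoid ℬ] : Prop :=
  ∃ Φ : GrMod 𝒜 ⥤ GrMod ℬ, Φ.IsEquivalence ∧ Φ.Additive ∧ Functor.Linear k Φ

/-! ## Gradings -/

/-- The grading of an algebra that is generated by elements `gen g` of degree `deg g`: degree `d`
is spanned by the monomials in the generators of total degree `d`. -/
def wordGrading {γ : Type} (gen : γ → R) (deg : γ → ℤ) (d : ℤ) : Submodule k R :=
  Submodule.span k {a | ∃ w : List γ, (w.map gen).prod = a ∧ (w.map deg).sum = d}

instance wordGrading_gradedMonoid {γ : Type} (gen : γ → R) (deg : γ → ℤ) :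
    SetLike.GradedMonoid (wordGrading (k := k) gen deg) where
  one_mem := Submodule.subset_span ⟨[], rfl, rfl⟩
  mul_mem := by
    intro i j a b ha hb
    have h : a * b ∈ wordGrading (k := k) gen deg i * wordGrading (k := k) gen deg j :=
      Submodule.mul_mem_mul ha hb
    unfold wordGrading at h
    rw [Submodule.span_mul_span] at h
    refine Submodule.span_mono ?_ h
    rintro _ ⟨_, ⟨v, rfl, rfl⟩, _, ⟨w, rfl, rfl⟩, rfl⟩
    exact ⟨v ++ w, by simp, by simp⟩

/-- The grading induced on a subalgebra `S`, with `S_d = S ∩ R_d`. -/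
def subGrading (𝒜 : ℤ → Submodule k R) (S : Subalgebra k R) (d : ℤ) : Submodule k S :=
  (𝒜 d).comap S.val.toLinearMap

instance subGrading_gradedMonoid (𝒜 : ℤ → Submodule k R) [SetLike.GradedMonoid 𝒜]
    (S : Subalgebra k R) : SetLike.GradedMonoid (subGrading 𝒜 S) where
  one_mem := SetLike.GradedOne.one_mem (A := 𝒜)
  mul_mem := fun _ _ _ _ ha hb => SetLike.GradedMul.mul_mem (A := 𝒜) ha hb

/-- The `n`-th Veronese subalgebra `⨁ᵢ R_{ni}`. -/
def veronese (𝒜 : ℤ → Submodule k R) [SetLike.GradedMonoid 𝒜] (n : ℤ) : Subalgebra k R :=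
  (⨆ i : ℤ, 𝒜 (n * i)).toSubalgebra
    (Submodule.mem_iSup_of_mem 0 (by
      rw [mul_zero]; exact SetLike.GradedOne.one_mem))
    (fun a b ha hb => by
      have h := Submodule.mul_mem_mul ha hb
      rw [Submodule.iSup_mul] at h
      revert h
      generalize a * b = c
      intro h
      refine SetLike.le_def.1 (iSup_le fun i => ?_) h
      rw [Submodule.mul_iSup]
      refine iSup_le fun j => Submodule.mul_le.2 fun a ha b hb => ?_
      refine Submodule.mem_iSup_of_mem (i + j) ?_
      rw [mul_add]
      exact SetLike.GradedMul.mul_mem ha hb)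

/-- The grading of the `n`-th Veronese subalgebra, with `R_{ni}` in degree `i`. -/
def veroneseGrading (𝒜 : ℤ → Submodule k R) [SetLike.GradedMonoid 𝒜] (n i : ℤ) :
    Submodule k (veronese 𝒜 n) :=
  (𝒜 (n * i)).comap (veronese 𝒜 n).val.toLinearMap

instance veroneseGrading_gradedMonoid (𝒜 : ℤ → Submodule k R) [SetLike.GradedMonoid 𝒜] (n : ℤ) :
    SetLike.GradedMonoid (veroneseGrading 𝒜 n) where
  one_mem := by
    change (1 : R) ∈ 𝒜 (n * 0)
    rw [mul_zero]
    exact SetLike.GradedOne.one_mem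
  mul_mem := fun i j a b ha hb => by
    change (a : R) * (b : R) ∈ 𝒜 (n * (i + j))
    rw [mul_add]
    exact SetLike.GradedMul.mul_mem ha hb

end GradedModules

/-! ## Twisted endomorphism rings -/

section Twisted

/-- A `ℤ`-sequence of `k`-linear endofunctors of a `k`-linear category: functors `F i` with
`F 0 ≅ id` and compatibility isomorphisms `F (i + j) ≅ F i ∘ F j` that are unital and
associative.  Each `F i` is then an autoequivalence, with quasi-inverse `F (-i)`. -/
structure ZSequence (k : Type*) [Field k] (C : Type*) [Category* C] [Preadditive C]
    [Linear k C] where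
  F : ℤ → C ⥤ C
  additive : ∀ i, (F i).Additive
  linear : ∀ i, Functor.Linear k (F i)
  zero : F 0 ≅ 𝟭 C
  /-- The compatibility isomorphism `F l ≅ F i ∘ F j` for `l = i + j`. -/
  add : ∀ i j l : ℤ, i + j = l → (F l ≅ F j ⋙ F i)
  zero_left : ∀ (j : ℤ) (M : C),
    (add 0 j j (_root_.zero_add j)).hom.app M ≫ zero.hom.app ((F j).obj M) = 𝟙 ((F j).obj M)
  zero_right : ∀ (j : ℤ) (M : C),
    (add j 0 j (_root_.add_zero j)).hom.app M ≫ (F j).map (zero.hom.app M) = 𝟙 ((F j).obj M)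
  assoc : ∀ (i j l ij jl ijl : ℤ) (h₁ : i + j = ij) (h₂ : j + l = jl) (h₃ : i + jl = ijl)
    (h₄ : ij + l = ijl) (M : C),
    (add i jl ijl h₃).hom.app M ≫ (F i).map ((add j l jl h₂).hom.app M) =
      (add ij l ijl h₄).hom.app M ≫ (add i j ij h₁).hom.app ((F l).obj M)

attribute [instance] ZSequence.additive ZSequence.linear

namespace ZSequence

variable {k : Type*} [Field k] {C : Type*} [Category* C] [Preadditive C] [Linear k C]
  (s : ZSequence k C) (P : C)

/-- The degree `n` part `hom(Fₙ P, P)` of the twisted endomorphism ring. -/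
abbrev Piece (n : ℤ) := (s.F n).obj P ⟶ P

variable {P}

/-- The product of `a ∈ hom(Fᵢ P, P)` and `b ∈ hom(Fⱼ P, P)` is the composite
`F_{i+j} P ⟶ Fᵢ (Fⱼ P) ⟶ Fᵢ P ⟶ P` of the compatibility isomorphism, `Fᵢ(b)` and `a`. -/
def pieceMul {i j l : ℤ} (h : i + j = l) (a : s.Piece P i) (b : s.Piece P j) : s.Piece P l :=
  (s.add i j l h).hom.app P ≫ (s.F i).map b ≫ a

variable (P) in
/-- The identity of the twisted endomorphism ring. -/
def pieceOne : s.Piece P 0 := s.zero.hom.app P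

lemma mk_pieceMul {i j l : ℤ} (h : i + j = l) (a : s.Piece P i) (b : s.Piece P j) :
    GradedMonoid.mk (A := s.Piece P) (i + j) (s.pieceMul rfl a b) =
      GradedMonoid.mk l (s.pieceMul h a b) := by
  subst h; rfl

lemma pieceOne_mul {i : ℤ} (a : s.Piece P i) :
    s.pieceMul (zero_add i) (s.pieceOne P) a = a := by
  have := s.zero.hom.naturality a
  simp only [Functor.id_map] at this
  rw [pieceMul, pieceOne, this, ← Category.assoc, zero_left, Category.id_comp]

lemma pieceMul_one {i : ℤ} (a : s.Piece P i) :
    s.pieceMul (add_zero i) a (s.pieceOne P) = a := by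
  rw [pieceMul, pieceOne, ← Category.assoc, zero_right, Category.id_comp]

lemma pieceMul_assoc {i j l ij jl ijl : ℤ} (h₁ : i + j = ij) (h₂ : j + l = jl)
    (h₃ : i + jl = ijl) (h₄ : ij + l = ijl) (a : s.Piece P i) (b : s.Piece P j)
    (c : s.Piece P l) :
    s.pieceMul h₄ (s.pieceMul h₁ a b) c = s.pieceMul h₃ a (s.pieceMul h₂ b c) := by
  have h := (s.add i j ij h₁).hom.naturality c
  simp only [Functor.comp_map] at h
  simp only [pieceMul, Functor.map_comp, Category.assoc]
  rw [reassoc_of% h, reassoc_of% (s.assoc i j l ij jl ijl h₁ h₂ h₃ h₄ P)]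

lemma smul_pieceMul {i j l : ℤ} (h : i + j = l) (c : k) (a : s.Piece P i) (b : s.Piece P j) :
    s.pieceMul h (c • a) b = c • s.pieceMul h a b := by
  simp [pieceMul]

lemma pieceMul_smul {i j l : ℤ} (h : i + j = l) (c : k) (a : s.Piece P i) (b : s.Piece P j) :
    s.pieceMul h a (c • b) = c • s.pieceMul h a b := by
  simp [pieceMul]

instance : GradedMonoid.GMul (s.Piece P) := ⟨fun a b => s.pieceMul rfl a b⟩

instance : GradedMonoid.GOne (s.Piece P) := ⟨s.pieceOne P⟩

instance : DirectSum.GSemiring (s.Piece P) where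
  mul_zero a := by simp [GradedMonoid.GMul.mul, pieceMul]
  zero_mul a := by simp [GradedMonoid.GMul.mul, pieceMul]
  mul_add a b c := by simp [GradedMonoid.GMul.mul, pieceMul]
  add_mul a b c := by simp [GradedMonoid.GMul.mul, pieceMul]
  one_mul a := (s.mk_pieceMul (zero_add a.1) _ _).trans
    (congrArg (GradedMonoid.mk a.1) (s.pieceOne_mul a.2))
  mul_one a := (s.mk_pieceMul (add_zero a.1) _ _).trans
    (congrArg (GradedMonoid.mk a.1) (s.pieceMul_one a.2))
  mul_assoc a b c := (s.mk_pieceMul (add_assoc a.1 b.1 c.1) _ _).trans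
    (congrArg (GradedMonoid.mk (a.1 + (b.1 + c.1)))
      (s.pieceMul_assoc rfl rfl rfl (add_assoc a.1 b.1 c.1) a.2 b.2 c.2))
  natCast n := n • s.pieceOne P
  natCast_zero := zero_smul _ _
  natCast_succ n := succ_nsmul _ n

instance : DirectSum.GAlgebra k (s.Piece P) where
  toFun :=
    { toFun := fun c => c • s.pieceOne P
      map_zero' := zero_smul _ _
      map_add' := fun c d => add_smul c d _ }
  map_one := one_smul _ _
  map_mul c d := ((s.mk_pieceMul (zero_add 0) (c • s.pieceOne P) (d • s.pieceOne P)).trans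
    (congrArg (GradedMonoid.mk 0) (by
      rw [smul_pieceMul, pieceMul_smul, pieceOne_mul, smul_smul]; rfl))).symm
  commutes c x := (s.mk_pieceMul (zero_add x.1) (c • s.pieceOne P) x.2).trans
    ((congrArg (GradedMonoid.mk x.1) (by
      rw [smul_pieceMul, pieceMul_smul, pieceOne_mul, pieceMul_one])).trans
      (s.mk_pieceMul (add_zero x.1) x.2 (c • s.pieceOne P)).symm)
  smul_def c x := ((s.mk_pieceMul (zero_add x.1) (c • s.pieceOne P) x.2).trans
    (congrArg (GradedMonoid.mk x.1) (by
      rw [smul_pieceMul, pieceOne_mul]))).symm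

variable (P) in
/-- The twisted endomorphism ring `⨁ₙ hom(Fₙ P, P)` of `P`, a `ℤ`-graded `k`-algebra. -/
abbrev TwistedEnd := DirectSum ℤ (s.Piece P)

variable (P) in
/-- The degree `n` part of the twisted endomorphism ring. -/
def twistedGrading (n : ℤ) : Submodule k (s.TwistedEnd P) :=
  LinearMap.range (DirectSum.lof k ℤ (s.Piece P) n)

end ZSequence

end Twisted

/-! ## The Weyl algebra, its localization, and generalized Weyl algebras -/

section Algebras

variable (k : Type u) [Field k]

/-- The generators of the Weyl algebra. -/
inductive WeylGen
  | x | y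

open FreeAlgebra in
inductive WeylRel : FreeAlgebra k WeylGen → FreeAlgebra k WeylGen → Prop
  | comm : WeylRel (ι k .x * ι k .y - ι k .y * ι k .x) 1

/-- The first Weyl algebra `A = k{x, y} / (xy - yx - 1)`. -/
abbrev Weyl : Type u := RingQuot (WeylRel k)

namespace Weyl

def gen (g : WeylGen) : Weyl k := RingQuot.mkAlgHom k (WeylRel k) (FreeAlgebra.ι k g)

def deg : WeylGen → ℤ
  | .x => 1
  | .y => -1

/-- The grading of the Weyl algebra with `deg x = 1` and `deg y = -1`. -/
abbrev grading : ℤ → Submodule k (Weyl k) := wordGrading (gen k) deg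

/-- The graded simple module `X = A / xA`. -/
def simpleX : GrMod (grading k) := GrMod.cyclic (grading k) (gen k .x)

/-- The graded simple module `Y = (A / yA)⟨1⟩`. -/
def simpleY : GrMod (grading k) := (GrMod.shift 1).obj (GrMod.cyclic (grading k) (gen k .y))

/-- The involution `ι_j` of the category of graded right `A`-modules: on graded projective modules
of rank one it is the reject of `X⟨j⟩ ⊕ Y⟨j⟩`, with homomorphisms restricted, and it is the
`k`-linear extension of this to all graded modules that preserves colimits. -/
def iota (j : ℤ) : GrMod (grading k) ⥤ GrMod (grading k) :=
  GrMod.extend (GrMod.reject ((GrMod.shift j).obj (simpleX k)) ((GrMod.shift j).obj (simpleY k)))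

/-- The functor `ι_J`, the composite of the `ι_j` for `j ∈ J`. -/
def iotaSet (J : Finset ℤ) : GrMod (grading k) ⥤ GrMod (grading k) :=
  (J.sort (· ≤ ·)).foldr (fun j G => G ⋙ iota k j) (𝟭 _)

end Weyl

/-- The generators of the localized Weyl algebra. -/
inductive LocGen
  | x | y | yinv

open FreeAlgebra in
inductive LocRel : FreeAlgebra k LocGen → FreeAlgebra k LocGen → Prop
  | comm : LocRel (ι k .x * ι k .y - ι k .y * ι k .x) 1
  | mul_inv : LocRel (ι k .y * ι k .yinv) 1
  | inv_mul : LocRel (ι k .yinv * ι k .y) 1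

/-- The localization `A[y⁻¹]` of the Weyl algebra, obtained by adjoining an inverse of `y`. -/
abbrev WeylLoc : Type u := RingQuot (LocRel k)

namespace WeylLoc

def gen (g : LocGen) : WeylLoc k := RingQuot.mkAlgHom k (LocRel k) (FreeAlgebra.ι k g)

def deg : LocGen → ℤ
  | .x => 1
  | .y => -1
  | .yinv => 1

/-- The grading of `A[y⁻¹]` that extends the grading of `A`. -/
abbrev grading : ℤ → Submodule k (WeylLoc k) := wordGrading (gen k) deg

/-- The subring `k + x A[y⁻¹]` of `A[y⁻¹]`. -/
def idealizer : Subalgebra k (WeylLoc k) where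
  carrier := {a | ∃ (c : k) (t : WeylLoc k), a = algebraMap k _ c + gen k .x * t}
  mul_mem' := by
    rintro _ _ ⟨c, t, rfl⟩ ⟨d, u, rfl⟩
    refine ⟨c * d, algebraMap k _ c * u + t * algebraMap k _ d + t * (gen k .x * u), ?_⟩
    have h := Algebra.commutes c (gen k .x)
    simp only [map_mul, mul_add, add_mul, ← mul_assoc, h]
    abel
  add_mem' := by
    rintro _ _ ⟨c, t, rfl⟩ ⟨d, u, rfl⟩
    refine ⟨c + d, t + u, ?_⟩
    simp only [map_add, mul_add]
    abel
  algebraMap_mem' c := ⟨c, 0, by simp⟩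

/-- The grading of `k + x A[y⁻¹]` induced from the grading of `A[y⁻¹]`. -/
abbrev idealizerGrading : ℤ → Submodule k (idealizer k) := subGrading (grading k) (idealizer k)

end WeylLoc

/-- The generators of a generalized Weyl algebra. -/
inductive GWAGen
  | X | Y | z

open FreeAlgebra Polynomial in
inductive GWARel (f : k[X]) (n : ℕ) : FreeAlgebra k GWAGen → FreeAlgebra k GWAGen → Prop
  | Xz : GWARel f n (ι k .X * ι k .z - ι k .z * ι k .X) ((n : k) • ι k .X)
  | Yz : GWARel f n (ι k .Y * ι k .z - ι k .z * ι k .Y) (-((n : k) • ι k .Y))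
  | XY : GWARel f n (ι k .X * ι k .Y) (aeval (ι k GWAGen.z) f)
  | YX : GWARel f n (ι k .Y * ι k .X) (aeval (ι k GWAGen.z - algebraMap k _ (n : k)) f)

open Polynomial in
/-- The generalized Weyl algebra `W(f, n)`: generators `X`, `Y`, `z` with relations
`Xz - zX = nX`, `Yz - zY = -nY`, `XY = f(z)`, `YX = f(z - n)`. -/
abbrev GWA (f : k[X]) (n : ℕ) : Type u := RingQuot (GWARel k f n)

namespace GWA

open Polynomial

variable (f : k[X]) (n : ℕ)

def gen (g : GWAGen) : GWA k f n := RingQuot.mkAlgHom k (GWARel k f n) (FreeAlgebra.ι k g)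

def deg : GWAGen → ℤ
  | .X => 1
  | .Y => -1
  | .z => 0

/-- The grading of `W(f, n)` with `deg X = 1`, `deg Y = -1` and `deg z = 0`. -/
abbrev grading : ℤ → Submodule k (GWA k f n) := wordGrading (gen k f n) deg

end GWA

open Polynomial

/-- The polynomial `f_J = ∏_{j ∈ J} (z + j)`. -/
def fPoly (J : Finset ℤ) : k[X] := ∏ j ∈ J, (X + C (j : k))

/-- The ring `W = W(f_J̄, n)` with `J̄ = {0, …, n - 1} \ J`. -/
abbrev WRing (J : Finset ℤ) (n : ℕ) : Type u := GWA k (fPoly k (Finset.Ico 0 (n : ℤ) \ J)) n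

/-- The element `p(z)` of `W`. -/
def evalZ (J : Finset ℤ) (n : ℕ) : k[X] →ₐ[k] WRing k J n := aeval (GWA.gen k _ n .z)

/-- The ring `S(J, n) = k[z] + f_J W ⊆ W`. -/
def SRing (J : Finset ℤ) (n : ℕ) : Subalgebra k (WRing k J n) where
  carrier := {a | ∃ (p : k[X]) (w : WRing k J n),
    a = evalZ k J n p + evalZ k J n (fPoly k J) * w}
  mul_mem' := by
    rintro _ _ ⟨p, v, rfl⟩ ⟨q, w, rfl⟩
    refine ⟨p * q, evalZ k J n p * w + v * evalZ k J n q
      + v * (evalZ k J n (fPoly k J) * w), ?_⟩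
    have h : evalZ k J n p * evalZ k J n (fPoly k J) =
        evalZ k J n (fPoly k J) * evalZ k J n p := by
      rw [← map_mul, mul_comm, map_mul]
    simp only [map_mul, mul_add, add_mul, ← mul_assoc, h]
    abel
  add_mem' := by
    rintro _ _ ⟨p, v, rfl⟩ ⟨q, w, rfl⟩
    refine ⟨p + q, v + w, ?_⟩
    simp only [map_add, mul_add]
    abel
  algebraMap_mem' c := ⟨C c, 0, by simp [evalZ]⟩

/-- The grading of `S(J, n)` induced from the grading of `W`. -/
abbrev SRing.grading (J : Finset ℤ) (n : ℕ) : ℤ → Submodule k (SRing k J n) :=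
  subGrading (GWA.grading k _ n) (SRing k J n)

end Algebras

end

end GrWeyl

namespace GrWeyl

noncomputable section

open Polynomial
open scoped symmDiff

/-! ## Finite sets of integers, linear factors and the cocycle -/

/-! Everything is read off one `k`-linear category. Its objects are the finite sets `D` of integers,
every Hom space is a copy of `k[X]`, and `p : D → D'` followed by `q : D' → D''` is `cc k D D' D'' *
(p * q)`; the cocycle has one factor `X + m` for each integer `m` whose membership is switched at
the first step and switched back at the second. The map `D ↦ K ∆ (D + s)`, with `X ↦ X + s` on Hom
spaces, is an automorphism of this category (`cc_affine`). An `Orbit` records the images `K i` of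
`∅` under the powers of one such automorphism.

A `Chart` presents a graded algebra as the algebra of such an orbit: an element of degree `d` is a
morphism `K i → K (i + d)` for every `i`. The composites `D → K i → D` are the multiples of `fPoly k
(D ∆ K i)`. These polynomials have no common root among the negatives of the integers, so they
generate the unit ideal (`Orbit.span_eq_top`), and Morita theory makes restriction to the orbit an
equivalence (`Chart.equivalence`). Hence any two algebras with charts are graded equivalent
(`Chart.gradedEquivalent`); the second part and the equivalence in the third only need charts.

The orbit of `(J, n)` is `K i = B ∆ (B + n i)`, with `B` the infinite set `Orbit.base J n`. In the
skew Laurent ring with `t z = (z + n) t`, the subring with degree `d` part `a_d k[z] t^d`, where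
`a_d` is the product of `z + m` over `m ∈ B \ (B + n d)`, has a chart for this orbit
(`cc_mul_aPoly`, `SymbolMap.chart`). By `aPoly_eq` this subring is `S(J, n)`. The algebra `A`
belongs to `(∅, 1)`, its Veronese ring to `(∅, n)`, and `k + xA[y⁻¹]` to `({0}, 1)`.

For the first part, the equivalence for `A` turns the shift by `b` into pullback along `D ↦ K (-b) ∆
(D - b)` (`Chart.shiftIso`), and a computation of rejects in the modules `A⟨i⟩` turns `ι_j` into
pullback along `D ↦ {j} ∆ D` (`Weyl.iotaIso`). So `𝒮ⁿ ∘ ι_J` is pullback along the inverse of the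
generating automorphism of the orbit of `(J, n)` (`Weyl.ofSet_symmDiff_translate`). Its powers give
one coherent sequence. The module `A` corresponds to the module represented by `∅`, whose twisted
endomorphism ring has, by Yoneda, the multiplication prescribed by the chart of `S(J, n)`
(`Orbit.unitPiece_mul`). Every other sequence gives the same ring: intertwining isomorphisms of all
degrees form a group, and the powers of one of degree 1 are a coherent family
(`ZSequence.Intertwine.exists_family`). -/

/-- The translate `D + s` of a finite set of integers. -/
def translate (s : ℤ) (D : Finset ℤ) : Finset ℤ := D.map (Equiv.addRight s).toEmbedding

@[simp] lemma mem_translate {s m : ℤ} {D : Finset ℤ} : m ∈ translate s D ↔ m - s ∈ D := by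
  simp only [translate, Finset.mem_map_equiv, Equiv.addRight_symm, Equiv.coe_addRight,
    sub_eq_add_neg]

lemma translate_zero (D : Finset ℤ) : translate 0 D = D := by ext; simp

@[simp] lemma translate_empty (s : ℤ) : translate s ∅ = ∅ := rfl

section Cocycle

variable (k : Type u) [Field k]

/-- The automorphism `X ↦ X + s` of the polynomial ring. -/
def tr (s : ℤ) : k[X] ≃ₐ[k] k[X] := taylorEquiv (s : k)

variable {k}

lemma tr_apply (s : ℤ) (p : k[X]) : tr k s p = taylor (s : k) p := rfl

@[simp] lemma tr_zero (p : k[X]) : tr k 0 p = p := by simp [tr_apply]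

@[simp] lemma tr_tr (s t : ℤ) (p : k[X]) : tr k s (tr k t p) = tr k (s + t) p := by
  simp [tr_apply, taylor_taylor]

lemma tr_linear (s j : ℤ) : tr k s (X + C (j : k)) = X + C ((j + s : ℤ) : k) := by
  rw [tr_apply, map_add, taylor_X, taylor_C, add_assoc, ← C_add]; push_cast; rw [add_comm (s : k)]

lemma tr_fPoly (s : ℤ) (D : Finset ℤ) : tr k s (fPoly k D) = fPoly k (translate s D) := by
  simp only [fPoly, map_prod, tr_linear, translate, Finset.prod_map]
  rfl

lemma fPoly_ne_zero (D : Finset ℤ) : fPoly k D ≠ 0 :=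
  Finset.prod_ne_zero_iff.2 fun _ _ => X_add_C_ne_zero _

/-- The multiset of linear factors of a product of two is determined by union and intersection.
Identities between such products thus become Boolean identities, checked integer by integer. -/
lemma fPoly_mul_fPoly {D E D' E' : Finset ℤ} (hu : D ∪ E = D' ∪ E') (hi : D ∩ E = D' ∩ E') :
    fPoly k D * fPoly k E = fPoly k D' * fPoly k E' := by
  simp only [fPoly]
  rw [← Finset.prod_union_inter, hu, hi, Finset.prod_union_inter]

@[simp] lemma fPoly_empty : fPoly k ∅ = 1 := rfl

@[simp] lemma fPoly_singleton (j : ℤ) : fPoly k {j} = X + C (j : k) := by simp [fPoly]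

variable (k)

/-- The cocycle that governs the composition of the generators of the rank one modules
`Hom(D, D')` and `Hom(D', D'')`. -/
def cc (D D' D'' : Finset ℤ) : k[X] := fPoly k ((D ∆ D') ∩ (D' ∆ D''))

variable {k}

@[simp] lemma cc_left (D D' : Finset ℤ) : cc k D D D' = 1 := by simp [cc]

@[simp] lemma cc_right (D D' : Finset ℤ) : cc k D D' D' = 1 := by simp [cc]

lemma cc_ne_zero (D D' D'' : Finset ℤ) : cc k D D' D'' ≠ 0 := fPoly_ne_zero _

/-- Associativity of composition. On both sides the exponent of `X + m` is half, rounded down, of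
the number of times `m` is switched along `D, D', D'', E`. -/
lemma cc_assoc (D D' D'' E : Finset ℤ) :
    cc k D D' D'' * cc k D D'' E = cc k D' D'' E * cc k D D' E := by
  apply fPoly_mul_fPoly <;> ext m <;>
    simp only [Finset.mem_union, Finset.mem_inter, Finset.mem_symmDiff] <;> tauto

lemma cc_self (D D' : Finset ℤ) : cc k D D' D = fPoly k (D ∆ D') := by
  rw [cc, symmDiff_comm D' D, Finset.inter_self]

lemma symmDiff_affine (K D D' : Finset ℤ) (s : ℤ) :
    (K ∆ translate s D) ∆ (K ∆ translate s D') = translate s (D ∆ D') := by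
  ext m
  simp only [Finset.mem_symmDiff, mem_translate]; tauto

/-- A symmetric difference with the fixed set `K` does not affect which integers are switched, so
only the translation is visible. -/
lemma cc_affine (K D D' D'' : Finset ℤ) (s : ℤ) :
    cc k (K ∆ translate s D) (K ∆ translate s D') (K ∆ translate s D'') =
      tr k s (cc k D D' D'') := by
  simp only [cc, symmDiff_affine, tr_fPoly]
  congr 1
  ext m
  simp

end Cocycle

/-! ## Orbits of rank one objects -/

/-- A crossed homomorphism from `ℤ` to the finite sets of integers, with step `n`, whose values
generate: no integer is a common root of the associated polynomials. -/
structure Orbit where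
  step : ℤ
  K : ℤ → Finset ℤ
  K_add : ∀ i j, K (i + j) = K i ∆ translate (step * i) (K j)
  exists_notMem : ∀ (D : Finset ℤ) (m : ℤ), ∃ i, m ∉ D ∆ K i

namespace Orbit

variable (o : Orbit)

@[simp] lemma K_zero : o.K 0 = ∅ := by
  have h := o.K_add 0 0
  rw [mul_zero, translate_zero, symmDiff_self, add_zero] at h
  simpa using h

variable {k : Type u} [Field k]

lemma tr_cc (i d e f : ℤ) :
    tr k (o.step * i) (cc k (o.K d) (o.K e) (o.K f)) =
      cc k (o.K (i + d)) (o.K (i + e)) (o.K (i + f)) := by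
  rw [o.K_add, o.K_add, o.K_add, cc_affine]

/-- A maximal ideal containing all these products contains a linear factor `X + m` of one of them.
Some other product lacks the factor `X + m`, so the ideal contains `X + m'` with `m' ≠ m`, and the
difference is a nonzero constant in characteristic 0. -/
lemma span_eq_top [CharZero k] (D : Finset ℤ) :
    Ideal.span (Set.range fun i => fPoly k (D ∆ o.K i)) = ⊤ := by
  by_contra h
  obtain ⟨M, hM, hle⟩ := Ideal.exists_le_maximal _ h
  have key : ∀ i, ∃ m ∈ D ∆ o.K i, (X + C (m : k) : k[X]) ∈ M := fun i =>
    (Ideal.IsPrime.prod_mem_iff (hp := hM.isPrime)).1 (hle (Ideal.subset_span ⟨i, rfl⟩))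
  obtain ⟨m, -, hm⟩ := key 0
  obtain ⟨i, hi⟩ := o.exists_notMem D m
  obtain ⟨m', hm', hm''⟩ := key i
  have hne : m ≠ m' := by rintro rfl; exact hi hm'
  have hsub : C ((m : k) - (m' : k)) ∈ M := by
    have := M.sub_mem hm hm''
    rwa [add_sub_add_left_eq_sub, ← C_sub] at this
  refine hM.ne_top (Ideal.eq_top_of_isUnit_mem _ hsub ?_)
  rw [isUnit_C, isUnit_iff_ne_zero, sub_ne_zero]
  exact_mod_cast hne

/-- A partition of unity: the identity of `D` is a finite sum of endomorphisms that factor through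
the orbit. The weights give the explicit inverses in `toFam_bijective` and `extendMap_bijective`. -/
lemma exists_finsupp [CharZero k] (D : Finset ℤ) :
    ∃ w : ℤ →₀ k[X], ∑ i ∈ w.support, w i * fPoly k (D ∆ o.K i) = 1 := by
  have h : (1 : k[X]) ∈ Ideal.span (Set.range fun i => fPoly k (D ∆ o.K i)) := by
    rw [span_eq_top]; trivial
  obtain ⟨w, hw⟩ := Finsupp.mem_ideal_span_range_iff_exists_finsupp.1 h
  exact ⟨w, hw⟩

/-! ### The orbit of a pair `(J, n)` -/

/-- The set of integers from which the orbit `(J, n)` is obtained by translation. -/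
def base (J : Finset ℤ) (n : ℤ) : Set ℤ := {m | 0 ≤ m ∧ (m < n ∨ m % n ∉ J)}

lemma mem_base {J : Finset ℤ} {n m : ℤ} : m ∈ base J n ↔ 0 ≤ m ∧ (m < n ∨ m % n ∉ J) := Iff.rfl

open Classical in
/-- The symmetric difference of the base set and its translate by `n i`. -/
def baseDiff (J : Finset ℤ) (n i : ℤ) : Finset ℤ :=
  (Finset.Ico (min 0 (n * i)) (max n (n * i + n))).filter
    fun m => ¬(m ∈ base J n ↔ m - n * i ∈ base J n)

/-- Outside the window that defines `baseDiff` the two memberships agree: below it both fail, and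
above it both depend only on the residue modulo `n`, which `m` and `m - n * i` share. -/
lemma mem_baseDiff {J : Finset ℤ} {n i m : ℤ} (hn : 1 ≤ n) :
    m ∈ baseDiff J n i ↔ ¬(m ∈ base J n ↔ m - n * i ∈ base J n) := by
  classical
  simp only [baseDiff, Finset.mem_filter, Finset.mem_Ico, and_iff_right_iff_imp]
  have h : (m - n * i) % n = m % n := by simp
  intro hx
  simp only [mem_base, h] at hx
  constructor
  · by_contra hc
    have h1 : ¬ 0 ≤ m := by omega
    have h2 : ¬ 0 ≤ m - n * i := by omega
    tauto
  · by_contra hc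
    have h1 : ¬ m < n := by omega
    have h2 : ¬ m - n * i < n := by omega
    have h3 : 0 ≤ m := by omega
    have h4 : 0 ≤ m - n * i := by omega
    tauto

/-- The orbit attached to a set `J` and a positive integer `n`. -/
def ofSet (J : Finset ℤ) (n : ℤ) (hn : 1 ≤ n) : Orbit where
  step := n
  K := baseDiff J n
  K_add i j := by
    ext m
    have h : m - n * (i + j) = m - n * i - n * j := by ring
    simp only [Finset.mem_symmDiff, mem_translate, mem_baseDiff hn, h]
    tauto
  exists_notMem D m := by
    by_cases h : m ∈ D ↔ m ∉ base J n
    -- Going back `m / n` blocks leads into `[0, n)`, which lies in the base set. For this `i`,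
    -- membership of `m` in `K i` means that `m` is not in the base set.
    · refine ⟨m / n, ?_⟩
      have h1 : m - n * (m / n) ∈ base J n := by
        have e : m - n * (m / n) = m % n := by rw [Int.emod_def]
        rw [e]
        exact ⟨Int.emod_nonneg _ (by omega), Or.inl (Int.emod_lt_of_pos _ (by omega))⟩
      simp only [Finset.mem_symmDiff, mem_baseDiff hn]
      tauto
    -- Here the translate of `m` is negative, hence outside the base set, and membership in `K i` is
    -- membership in the base set.
    · refine ⟨m.natAbs + 1, ?_⟩
      have h1 : m - n * (m.natAbs + 1) ∉ base J n := by
        rintro ⟨h0, -⟩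
        nlinarith [Int.le_natAbs (a := m), abs_nonneg m]
      simp only [Finset.mem_symmDiff, mem_baseDiff hn]
      tauto

@[simp] lemma ofSet_step (J : Finset ℤ) (n : ℤ) (hn : 1 ≤ n) : (ofSet J n hn).step = n := rfl

lemma mem_ofSet {J : Finset ℤ} {n : ℤ} {hn : 1 ≤ n} {i m : ℤ} :
    m ∈ (ofSet J n hn).K i ↔ ¬(m ∈ base J n ↔ m - n * i ∈ base J n) :=
  mem_baseDiff hn

end Orbit

end

end GrWeyl

namespace GrWeyl

noncomputable section

open scoped Polynomial
open scoped symmDiff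

/-! ## Modules over the category of rank one objects -/

/-- A module over the category whose objects are the finite sets of integers, whose spaces of
morphisms are free of rank one over `k[X]`, and whose composition is given by the cocycle `cc`. -/
structure EMod (k : Type u) [Field k] where
  obj : Finset ℤ → Type u
  [addCommGroup : ∀ D, AddCommGroup (obj D)]
  [module : ∀ D, Module k (obj D)]
  act : ∀ D D' : Finset ℤ, k[X] →ₗ[k] obj D →ₗ[k] obj D'
  act_one : ∀ {D : Finset ℤ} (m : obj D), act D D 1 m = m
  act_act : ∀ {D D' D'' : Finset ℤ} (p q : k[X]) (m : obj D),
    act D' D'' q (act D D' p m) = act D D'' (cc k D D' D'' * (p * q)) m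

attribute [instance] EMod.addCommGroup EMod.module

namespace EMod

variable {k : Type u} [Field k]

/-- The homomorphisms of modules. -/
def homSpace (M N : EMod k) : Submodule k (∀ D, M.obj D →ₗ[k] N.obj D) where
  carrier := {f | ∀ (D D' : Finset ℤ) (p : k[X]) (m : M.obj D),
    f D' (M.act D D' p m) = N.act D D' p (f D m)}
  zero_mem' := by intro D D' p m; simp
  add_mem' := by
    intro f g hf hg D D' p m
    simp [hf D D' p m, hg D D' p m]
  smul_mem' := by
    intro c f hf D D' p m
    simp [hf D D' p m]

instance : Category.{u} (EMod k) where
  Hom M N := homSpace M N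
  id M := ⟨fun _ => LinearMap.id, by intro D D' p m; rfl⟩
  comp f g := ⟨fun D => (g.1 D).comp (f.1 D), by
    intro D D' p m
    simp only [LinearMap.comp_apply]
    rw [f.2 D D' p m, g.2 D D' p]⟩

/-- The component of a homomorphism. -/
def app {M N : EMod k} (f : M ⟶ N) (D : Finset ℤ) : M.obj D →ₗ[k] N.obj D := f.1 D

/-- A homomorphism from its components. -/
def mkHom {M N : EMod k} (f : ∀ D, M.obj D →ₗ[k] N.obj D)
    (hf : ∀ (D D' : Finset ℤ) (p : k[X]) (m : M.obj D),
      f D' (M.act D D' p m) = N.act D D' p (f D m)) : M ⟶ N := ⟨f, hf⟩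

@[simp] lemma app_mkHom {M N : EMod k} (f : ∀ D, M.obj D →ₗ[k] N.obj D) (hf) (D : Finset ℤ) :
    app (mkHom f hf : M ⟶ N) D = f D := rfl

lemma app_act {M N : EMod k} (f : M ⟶ N) {D D' : Finset ℤ} (p : k[X]) (m : M.obj D) :
    app f D' (M.act D D' p m) = N.act D D' p (app f D m) := f.2 D D' p m

@[ext] lemma hom_ext {M N : EMod k} {f g : M ⟶ N} (h : ∀ D m, app f D m = app g D m) : f = g :=
  Subtype.ext (funext fun D => LinearMap.ext (h D))

@[simp] lemma app_id (M : EMod k) (D : Finset ℤ) : app (𝟙 M) D = LinearMap.id := rfl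

@[simp] lemma app_comp {M N P : EMod k} (f : M ⟶ N) (g : N ⟶ P) (D : Finset ℤ) :
    app (f ≫ g) D = (app g D).comp (app f D) := rfl

instance (M N : EMod k) : AddCommGroup (M ⟶ N) :=
  inferInstanceAs (AddCommGroup (homSpace M N))

instance homModule (M N : EMod k) : Module k (M ⟶ N) :=
  inferInstanceAs (Module k (homSpace M N))

@[simp] lemma app_add {M N : EMod k} (f g : M ⟶ N) (D : Finset ℤ) :
    app (f + g) D = app f D + app g D := rfl

@[simp] lemma app_smul {M N : EMod k} (c : k) (f : M ⟶ N) (D : Finset ℤ) :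
    app (c • f) D = c • app f D := rfl

instance : Preadditive (EMod k) where
  add_comp := by intros; ext; simp
  comp_add := by intros; ext; simp

instance : Linear k (EMod k) where
  homModule := homModule
  smul_comp := by intros; ext; simp
  comp_smul := by intros; ext; simp

/-- An isomorphism from bijective components. -/
def isoMk {M N : EMod k} (e : ∀ D, M.obj D ≃ₗ[k] N.obj D)
    (he : ∀ (D D' : Finset ℤ) (p : k[X]) (m : M.obj D),
      e D' (M.act D D' p m) = N.act D D' p (e D m)) : M ≅ N where
  hom := mkHom (fun D => (e D).toLinearMap) he
  inv := mkHom (fun D => (e D).symm.toLinearMap) (fun D D' p m => by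
    simp only [LinearEquiv.coe_coe]
    rw [LinearEquiv.symm_apply_eq, he, LinearEquiv.apply_symm_apply])
  hom_inv_id := by ext; simp
  inv_hom_id := by ext; simp

end EMod

namespace GrMod

variable {k R : Type u} [Field k] [Ring R] [Algebra k R]
  {𝒜 : ℤ → Submodule k R} [SetLike.GradedMonoid 𝒜]

/-- An isomorphism of graded modules from bijective components. -/
def isoMk {M N : GrMod 𝒜} (e : ∀ i, M.X i ≃ₗ[k] N.X i)
    (he : ∀ (i d n : ℤ) (h : i + d = n) (m : M.X i) (r : 𝒜 d),
      e n (M.act h m r) = N.act h (e i m) r) : M ≅ N where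
  hom := mkHom (fun i => (e i).toLinearMap) he
  inv := mkHom (fun i => (e i).symm.toLinearMap) (fun i d n h m r => by
    simp only [LinearEquiv.coe_coe]
    rw [LinearEquiv.symm_apply_eq, he, LinearEquiv.apply_symm_apply])
  hom_inv_id := by ext; simp
  inv_hom_id := by ext; simp

end GrMod

/-! ## Charts of graded algebras -/

section Chart

variable {k R : Type u} [Field k] [Ring R] [Algebra k R]

/-- Coordinates on a graded algebra all of whose pieces are free of rank one over `k[X]`, with the
multiplication that is determined by the orbit `o`. -/
structure Chart (o : Orbit) (𝒜 : ℤ → Submodule k R) [SetLike.GradedMonoid 𝒜] where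
  coord : ∀ d, 𝒜 d ≃ₗ[k] k[X]
  coord_one : coord 0 ⟨1, SetLike.GradedOne.one_mem⟩ = 1
  coord_mul : ∀ {d e : ℤ} (r : 𝒜 d) (s : 𝒜 e),
    coord (d + e) ⟨(r : R) * (s : R), SetLike.GradedMul.mul_mem r.2 s.2⟩ =
      cc k ∅ (o.K d) (o.K (d + e)) * (coord d r * tr k (o.step * d) (coord e s))

namespace Chart

variable {o : Orbit} {𝒜 : ℤ → Submodule k R} [SetLike.GradedMonoid 𝒜] (χ : Chart o 𝒜)

/-- The coordinates on the morphisms from the object `o.K i` to the object `o.K (i + d)`. -/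
def coordAt (i d : ℤ) : 𝒜 d ≃ₗ[k] k[X] :=
  (χ.coord d).trans (tr k (o.step * i)).toLinearEquiv

lemma coordAt_apply (i d : ℤ) (r : 𝒜 d) : χ.coordAt i d r = tr k (o.step * i) (χ.coord d r) := rfl

lemma coordAt_one (i : ℤ) : χ.coordAt i 0 ⟨1, SetLike.GradedOne.one_mem⟩ = 1 := by
  rw [coordAt_apply, coord_one, map_one]

/-- The multiplication rule at the object `K 0 = ∅`, carried along by the `i`-th power of the
automorphism. -/
lemma coordAt_mul {i d n e p : ℤ} (hn : i + d = n) (hp : n + e = p) (r : 𝒜 d) (s : 𝒜 e) :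
    χ.coordAt i (d + e) ⟨(r : R) * (s : R), SetLike.GradedMul.mul_mem r.2 s.2⟩ =
      cc k (o.K i) (o.K n) (o.K p) * (χ.coordAt i d r * χ.coordAt n e s) := by
  subst hn hp
  rw [coordAt_apply, coord_mul, map_mul, map_mul, tr_tr, ← o.K_zero, o.tr_cc, coordAt_apply,
    coordAt_apply, add_zero, ← add_assoc, mul_add]

lemma coordAt_shift {i j d : ℤ} (r : 𝒜 d) :
    χ.coordAt (i + j) d r = tr k (o.step * i) (χ.coordAt j d r) := by
  rw [coordAt_apply, coordAt_apply, tr_tr, mul_add]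

/-- The action of the morphisms from `o.K i` to `o.K l` on a graded module. -/
def kact (M : GrMod 𝒜) (i l : ℤ) : k[X] →ₗ[k] M.X i →ₗ[k] M.X l :=
  ((M.act (show i + (l - i) = l by omega)).flip).comp (χ.coordAt i (l - i)).symm.toLinearMap

lemma kact_coordAt (M : GrMod 𝒜) {i d n : ℤ} (h : i + d = n) (m : M.X i) (r : 𝒜 d) :
    χ.kact M i n (χ.coordAt i d r) m = M.act h m r := by
  obtain rfl : d = n - i := by omega
  simp [kact]

lemma kact_one (M : GrMod 𝒜) {i : ℤ} (m : M.X i) : χ.kact M i i 1 m = m := by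
  rw [← χ.coordAt_one i, kact_coordAt (h := add_zero i), M.act_one]

lemma kact_kact (M : GrMod 𝒜) {i n q : ℤ} (a b : k[X]) (m : M.X i) :
    χ.kact M n q b (χ.kact M i n a m) =
      χ.kact M i q (cc k (o.K i) (o.K n) (o.K q) * (a * b)) m := by
  obtain ⟨r, rfl⟩ := (χ.coordAt i (n - i)).surjective a
  obtain ⟨s, rfl⟩ := (χ.coordAt n (q - n)).surjective b
  rw [← χ.coordAt_mul (by omega) (by omega), kact_coordAt (h := by omega),
    kact_coordAt (h := by omega), kact_coordAt (h := by omega), M.act_mul]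

lemma app_kact {M N : GrMod 𝒜} (f : M ⟶ N) {i n : ℤ} (a : k[X]) (m : M.X i) :
    GrMod.app f n (χ.kact M i n a m) = χ.kact N i n a (GrMod.app f i m) := by
  obtain ⟨r, rfl⟩ := (χ.coordAt i (n - i)).surjective a
  rw [kact_coordAt (h := by omega), kact_coordAt (h := by omega), GrMod.app_act]

/-- Isomorphisms of graded modules need only be compatible with the action in coordinates. -/
lemma act_of_kact {M N : GrMod 𝒜} {f : ∀ i, M.X i →ₗ[k] N.X i}
    (hf : ∀ (i n : ℤ) (a : k[X]) (m : M.X i),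
      f n (χ.kact M i n a m) = χ.kact N i n a (f i m))
    (i d n : ℤ) (h : i + d = n) (m : M.X i) (r : 𝒜 d) :
    f n (M.act h m r) = N.act h (f i m) r := by
  rw [← χ.kact_coordAt M h, hf, χ.kact_coordAt N h]

/-- The restriction of a module to the objects in the orbit. -/
abbrev resObj (M : EMod k) : GrMod 𝒜 where
  X i := M.obj (o.K i)
  act {i d n} _ := ((M.act (o.K i) (o.K n)).comp (χ.coordAt i d).toLinearMap).flip
  act_one {i} m := by
    simp only [LinearMap.flip_apply, LinearMap.comp_apply, LinearEquiv.coe_coe]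
    rw [χ.coordAt_one]
    generalize hj : i + 0 = j
    obtain rfl : i = j := by simpa using hj
    exact M.act_one m
  act_mul {i d n e p} h h' h'' m r s := by
    simp only [LinearMap.flip_apply, LinearMap.comp_apply, LinearEquiv.coe_coe]
    rw [M.act_act, χ.coordAt_mul h h']

/-- The restriction functor. -/
abbrev res : EMod k ⥤ GrMod 𝒜 where
  obj M := χ.resObj M
  map f := GrMod.mkHom (fun i => EMod.app f (o.K i)) (fun _ _ _ _ m r => EMod.app_act f _ m)

lemma kact_res (M : EMod k) {i n : ℤ} (a : k[X]) (m : M.obj (o.K i)) :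
    χ.kact (χ.res.obj M) i n a m = M.act (o.K i) (o.K n) a m := by
  obtain ⟨r, rfl⟩ := (χ.coordAt i (n - i)).surjective a
  rw [kact_coordAt (h := by omega)]
  rfl

instance : χ.res.Additive where
instance : Functor.Linear k χ.res where

/-- The families of elements of a graded module that represent an element in the object `D`. -/
def famSpace (M : GrMod 𝒜) (D : Finset ℤ) : Submodule k (∀ l, M.X l) where
  -- An element at `D` yields the family of its images under the generators `D → K l`. The condition
  -- records what these generators become when followed by `p : K l → K q`.
  carrier := {m | ∀ (l q : ℤ) (p : k[X]),
    χ.kact M l q p (m l) = χ.kact M q q (cc k D (o.K l) (o.K q) * p) (m q)}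
  zero_mem' := by intro l q p; simp
  add_mem' := by intro f g hf hg l q p; simp [hf l q p, hg l q p]
  smul_mem' := by intro c f hf l q p; simp [hf l q p]

lemma fam_kact {M : GrMod 𝒜} {D : Finset ℤ} (m : χ.famSpace M D) (l q : ℤ) (p : k[X]) :
    χ.kact M l q p (m.1 l) = χ.kact M q q (cc k D (o.K l) (o.K q) * p) (m.1 q) := m.2 l q p

/-- The action on families. -/
def famAct (M : GrMod 𝒜) (D D' : Finset ℤ) :
    k[X] →ₗ[k] χ.famSpace M D →ₗ[k] χ.famSpace M D' :=
  LinearMap.mk₂ k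
    (fun p m => ⟨fun l => χ.kact M l l (cc k D D' (o.K l) * p) (m.1 l), fun l q r => by
      rw [kact_kact, fam_kact, kact_kact, cc_left, cc_right]
      congr 2
      linear_combination (p * r) * cc_assoc (k := k) D D' (o.K l) (o.K q)⟩)
    (fun p q m => Subtype.ext (funext fun l => by simp [mul_add]))
    (fun c p m => Subtype.ext (funext fun l => by simp))
    (fun p m n => Subtype.ext (funext fun l => by simp))
    (fun c p m => Subtype.ext (funext fun l => by simp))

lemma famAct_val (M : GrMod 𝒜) (D D' : Finset ℤ) (p : k[X]) (m : χ.famSpace M D) (l : ℤ) :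
    (χ.famAct M D D' p m).1 l = χ.kact M l l (cc k D D' (o.K l) * p) (m.1 l) := rfl

/-- The module that extends a graded module to all objects. -/
abbrev indObj (M : GrMod 𝒜) : EMod k where
  obj D := χ.famSpace M D
  act := χ.famAct M
  act_one m := Subtype.ext (funext fun l => by
    rw [famAct_val, cc_left, one_mul, kact_one])
  act_act {D D' D''} p q m := Subtype.ext (funext fun l => by
    rw [famAct_val, famAct_val, famAct_val, kact_kact, cc_left]
    congr 2
    linear_combination -(p * q) * cc_assoc (k := k) D D' D'' (o.K l))

/-- The extension functor. -/
abbrev ind : GrMod 𝒜 ⥤ EMod k where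
  obj M := χ.indObj M
  map {M N} f := EMod.mkHom
    (fun D => ((LinearMap.pi fun l => (GrMod.app f l).comp (LinearMap.proj l)).restrict
      (p := χ.famSpace M D) (q := χ.famSpace N D) (fun m hm l q p => by
        have h := congrArg (GrMod.app f q) (hm l q p)
        rw [app_kact, app_kact] at h
        exact h)))
    (fun D D' p m => Subtype.ext (funext fun l => χ.app_kact f _ _))

lemma ind_map_val {M N : GrMod 𝒜} (f : M ⟶ N) (D : Finset ℤ) (m : χ.famSpace M D) (l : ℤ) :
    (EMod.app (χ.ind.map f) D m : χ.famSpace N D).1 l = GrMod.app f l (m.1 l) := rfl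

lemma ind_act_val (M : GrMod 𝒜) (D D' : Finset ℤ) (p : k[X]) (m : χ.famSpace M D) (l : ℤ) :
    ((χ.ind.obj M).act D D' p m : χ.famSpace M D').1 l =
      χ.kact M l l (cc k D D' (o.K l) * p) (m.1 l) := rfl

instance : χ.ind.Additive where
instance : Functor.Linear k χ.ind where

/-- Evaluation of families at an object of the orbit. -/
def evalEquiv (M : GrMod 𝒜) (i : ℤ) : χ.famSpace M (o.K i) ≃ₗ[k] M.X i where
  toFun m := m.1 i
  map_add' _ _ := rfl
  map_smul' _ _ := rfl
  invFun m := ⟨fun l => χ.kact M i l 1 m, fun l q p => by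
    rw [kact_kact, kact_kact, cc_right]; simp⟩
  left_inv m := Subtype.ext (funext fun l => by
    change χ.kact M i l 1 (m.1 i) = m.1 l
    rw [fam_kact, cc_left, one_mul, kact_one])
  right_inv m := χ.kact_one M m

lemma evalEquiv_kact (M : GrMod 𝒜) (i n : ℤ) (a : k[X]) (m : χ.famSpace M (o.K i)) :
    χ.evalEquiv M n (χ.kact (χ.res.obj (χ.ind.obj M)) i n a m) =
      χ.kact M i n a (χ.evalEquiv M i m) := by
  rw [kact_res]
  refine (χ.ind_act_val M (o.K i) (o.K n) a m n).trans ?_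
  rw [cc_right, one_mul]
  refine Eq.trans ?_ (χ.fam_kact m i n a).symm
  rw [cc_left, one_mul]

/-- Restricting after extending. -/
def indRes : χ.ind ⋙ χ.res ≅ 𝟭 (GrMod 𝒜) :=
  NatIso.ofComponents
    (fun M => GrMod.isoMk (M := (χ.ind ⋙ χ.res).obj M) (fun i => χ.evalEquiv M i)
      (χ.act_of_kact (M := (χ.ind ⋙ χ.res).obj M) (f := fun i => (χ.evalEquiv M i).toLinearMap)
        (χ.evalEquiv_kact M)))
    (fun _ => rfl)

/-- The comparison map of a module with the extension of its restriction. -/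
def toFam (M : EMod k) (D : Finset ℤ) : M.obj D →ₗ[k] χ.famSpace (χ.res.obj M) D :=
  LinearMap.codRestrict _ (LinearMap.pi fun l => M.act D (o.K l) 1) (fun m l q p => by
    rw [kact_res, kact_res]
    simp only [LinearMap.pi_apply]
    rw [M.act_act, M.act_act]
    simp)

lemma toFam_val (M : EMod k) (D : Finset ℤ) (m : M.obj D) (l : ℤ) :
    (χ.toFam M D m).1 l = M.act D (o.K l) 1 m := rfl

variable [CharZero k]

/-- An element at `D` is recovered from its images in the orbit by returning to `D` along the
weights of a partition of unity and summing. The same sum produces a preimage of an arbitrary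
family. -/
lemma toFam_bijective (M : EMod k) (D : Finset ℤ) : Function.Bijective (χ.toFam M D) := by
  obtain ⟨w, hw⟩ := o.exists_finsupp (k := k) D
  constructor
  · rw [injective_iff_map_eq_zero]
    intro m hm
    have h : ∀ l, M.act D (o.K l) 1 m = 0 := fun l => by
      rw [← χ.toFam_val, hm]; rfl
    rw [← M.act_one m, ← hw, map_sum, LinearMap.sum_apply]
    refine Finset.sum_eq_zero fun i _ => ?_
    have := M.act_act (D'' := D) 1 (w i) m (D' := o.K i)
    rw [h, map_zero, cc_self, one_mul, mul_comm] at this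
    exact this.symm
  · intro m
    refine ⟨∑ i ∈ w.support, M.act (o.K i) D (w i) (m.1 i), Subtype.ext (funext fun l => ?_)⟩
    rw [toFam_val, map_sum]
    have h : ∀ i, M.act D (o.K l) 1 (M.act (o.K i) D (w i) (m.1 i)) =
        M.act (o.K l) (o.K l) (w i * fPoly k (D ∆ o.K i)) (m.1 l) := fun i => by
      have hm := χ.fam_kact m i l (cc k (o.K i) D (o.K l) * w i)
      rw [kact_res, kact_res] at hm
      rw [M.act_act, mul_one]
      refine hm.trans ?_
      congr 2
      -- Associativity along `D, K i, D, K l` merges the two cocycles into the single polynomial of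
      -- `D ∆ K i`.
      have h := cc_assoc (k := k) D (o.K i) D (o.K l)
      rw [cc_left, mul_one, cc_self] at h
      rw [h]
      ring
    rw [Finset.sum_congr rfl fun i _ => h i, ← LinearMap.sum_apply, ← map_sum, hw]
    exact M.act_one _

/-- Extending after restricting. -/
def resInd : 𝟭 (EMod k) ≅ χ.res ⋙ χ.ind :=
  NatIso.ofComponents
    (fun M => EMod.isoMk (N := (χ.res ⋙ χ.ind).obj M)
      (fun D => LinearEquiv.ofBijective (χ.toFam M D) (χ.toFam_bijective M D))
      (fun D D' p m => Subtype.ext (funext fun l => by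
        refine (M.act_act p 1 m).trans ?_
        refine Eq.trans ?_ (χ.ind_act_val (χ.res.obj M) D D' p _ l).symm
        rw [kact_res]
        refine Eq.trans ?_ (M.act_act _ _ m).symm
        rw [cc_right]
        simp)))
    (fun {M N} f => EMod.hom_ext fun D m => Subtype.ext (funext fun l =>
      (EMod.app_act f 1 m).symm))

/-- The Morita equivalence between modules over the category of rank one objects and graded
modules over an algebra with a chart. -/
def equivalence : EMod k ≌ GrMod 𝒜 := CategoryTheory.Equivalence.mk χ.res χ.ind χ.resInd χ.indRes

/-- The category `EMod k` does not depend on an orbit, so it mediates between charts with different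
orbits and steps. -/
lemma gradedEquivalent {R' : Type u} [Ring R'] [Algebra k R'] {o' : Orbit}
    {ℬ : ℤ → Submodule k R'} [SetLike.GradedMonoid ℬ] (χ : Chart o 𝒜) (χ' : Chart o' ℬ) :
    GradedEquivalent 𝒜 ℬ :=
  ⟨χ.ind ⋙ χ'.res, (χ.equivalence.symm.trans χ'.equivalence).isEquivalence_functor,
    inferInstance, inferInstance⟩

end Chart

end Chart

end

end GrWeyl

namespace GrWeyl

noncomputable section

open scoped Polynomial
open scoped symmDiff

/-! ## Pullback along automorphisms of the category of rank one objects -/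

namespace EMod

variable {k : Type u} [Field k]

/-- The cocycle is trivial when two consecutive objects coincide. So the action of `1` serves as
transport along an equality of objects, and coherence of pullbacks reduces to multiplying by `1`. -/
lemma act_act_left (M : EMod k) {D D' D'' : Finset ℤ} (h : D = D') (p q : k[X]) (m : M.obj D) :
    M.act D' D'' q (M.act D D' p m) = M.act D D'' (p * q) m := by
  subst h; rw [M.act_act, cc_left, one_mul]

lemma act_act_right (M : EMod k) {D D' D'' : Finset ℤ} (h : D' = D'') (p q : k[X])
    (m : M.obj D) : M.act D' D'' q (M.act D D' p m) = M.act D D'' (p * q) m := by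
  subst h; rw [M.act_act, cc_right, one_mul]

/-- The identification of the values of a module at equal objects. -/
def castEquiv (M : EMod k) {D D' : Finset ℤ} (h : D = D') : M.obj D ≃ₗ[k] M.obj D' where
  __ := M.act D D' 1
  invFun := M.act D' D 1
  left_inv m := (M.act_act_left h _ _ m).trans (by rw [mul_one]; exact M.act_one m)
  right_inv m := (M.act_act_left h.symm _ _ m).trans (by rw [mul_one]; exact M.act_one m)

/-- The pullback of a module along the automorphism `D ↦ K ∆ (D + s)`. -/
abbrev pullObj (K : Finset ℤ) (s : ℤ) (M : EMod k) : EMod k where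
  obj D := M.obj (K ∆ translate s D)
  act D D' := (M.act (K ∆ translate s D) (K ∆ translate s D')).comp (tr k s).toLinearMap
  act_one m := by
    simp only [LinearMap.comp_apply, AlgEquiv.toLinearMap_apply, map_one, M.act_one]
  act_act p q m := by
    simp only [LinearMap.comp_apply, AlgEquiv.toLinearMap_apply, M.act_act, map_mul, cc_affine]

/-- The pullback functor along the automorphism `D ↦ K ∆ (D + s)`. -/
abbrev pull (K : Finset ℤ) (s : ℤ) : EMod k ⥤ EMod k where
  obj := pullObj K s
  map f := mkHom (fun D => app f (K ∆ translate s D)) (fun _ _ _ m => app_act f _ m)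

instance (K : Finset ℤ) (s : ℤ) : (pull (k := k) K s).Additive where
instance (K : Finset ℤ) (s : ℤ) : Functor.Linear k (pull (k := k) K s) where

/-- Pullback along a composite of automorphisms. -/
def pullComp {K K' K'' : Finset ℤ} {s s' s'' : ℤ}
    (h : ∀ D, K'' ∆ translate s'' D = K ∆ translate s (K' ∆ translate s' D)) (hs : s + s' = s'') :
    pull (k := k) K'' s'' ≅ pull K s ⋙ pull K' s' :=
  NatIso.ofComponents
    (fun M => isoMk (N := (pull K s ⋙ pull K' s').obj M) (fun D => M.castEquiv (h D))
      (fun D D' p m => by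
        change M.act _ _ 1 (M.act _ _ (tr k s'' p) m) =
          M.act _ _ (tr k s (tr k s' p)) (M.act _ _ 1 m)
        rw [M.act_act_right (h D'), M.act_act_left (h D), mul_comm, tr_tr, hs]))
    (fun f => hom_ext fun D m => (app_act f _ m).symm)

/-- Pullback along the identity. -/
def pullId {K : Finset ℤ} {s : ℤ} (h : ∀ D, K ∆ translate s D = D) (hs : s = 0) :
    pull (k := k) K s ≅ 𝟭 (EMod k) :=
  NatIso.ofComponents
    (fun M => isoMk (M := (pull K s).obj M) (fun D => M.castEquiv (h D))
      (fun D D' p m => by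
        change M.act _ _ 1 (M.act _ _ (tr k s p) m) = M.act _ _ p (M.act _ _ 1 m)
        subst hs
        rw [M.act_act_right (h D'), M.act_act_left (h D), mul_comm, tr_zero]))
    (fun f => hom_ext fun D m => (app_act f _ m).symm)

end EMod

namespace Orbit

variable (o : Orbit)

/-- The crossed homomorphism law, read as a statement about automorphisms: those attached to the
integers compose as the integers add. -/
lemma K_add_symmDiff (i j l : ℤ) (h : i + j = l) (D : Finset ℤ) :
    o.K l ∆ translate (o.step * l) D =
      o.K i ∆ translate (o.step * i) (o.K j ∆ translate (o.step * j) D) := by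
  subst h
  have h (m : ℤ) : m - o.step * (i + j) = m - o.step * i - o.step * j := by ring
  ext m
  simp only [o.K_add, Finset.mem_symmDiff, mem_translate, h]
  tauto

variable (k : Type u) [Field k]

/-- The sequence of pullbacks along the powers of the automorphism attached to an orbit. -/
def zSequence : ZSequence k (EMod k) where
  -- The sign agrees with `M⟨i⟩ⱼ = M_{j-i}`: the underlying automorphism has to send `K j` to `K (j
  -- - i)`.
  F i := EMod.pull (o.K (-i)) (o.step * (-i))
  additive _ := inferInstance
  linear _ := inferInstance
  zero := EMod.pullId (by simp [translate_zero, ← Finset.bot_eq_empty]) (by simp)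
  add i j l h := EMod.pullComp (o.K_add_symmDiff (-j) (-i) (-l) (by omega)) (by subst h; ring)
  zero_left j M := EMod.hom_ext fun D m => by
    change M.act _ _ (tr k _ 1) (M.act _ _ 1 m) = m
    rw [map_one, M.act_act_right (by simp [translate_zero, ← Finset.bot_eq_empty]), mul_one, M.act_one]
  zero_right j M := EMod.hom_ext fun D m => by
    change M.act _ _ 1 (M.act _ _ 1 m) = m
    rw [M.act_act_right (by simp [translate_zero, ← Finset.bot_eq_empty]), mul_one, M.act_one]
  assoc i j l ij jl ijl h₁ h₂ h₃ h₄ M := EMod.hom_ext fun D m => by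
    change M.act _ _ 1 (M.act _ _ 1 m) = M.act _ _ (tr k _ 1) (M.act _ _ 1 m)
    rw [M.act_act_left (o.K_add_symmDiff (-jl) (-i) (-ijl) (by omega) D),
      map_one, M.act_act_left (o.K_add_symmDiff (-l) (-ij) (-ijl) (by omega) D)]

end Orbit

/-! ## Sequences of functors -/

namespace ZSequence

universe v₁ v₂ u₁ u₂

variable {k : Type*} [Field k] {C : Type u₁} [Category.{v₁} C] [Preadditive C] [Linear k C]
  {C' : Type u₂} [Category.{v₂} C'] [Preadditive C'] [Linear k C']

/-- The transport of a sequence along an equivalence. -/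
def transport (s : ZSequence k C') (e : C ≌ C') [e.functor.Additive] [e.inverse.Additive]
    [Functor.Linear k e.functor] [Functor.Linear k e.inverse] : ZSequence k C where
  F i := e.functor ⋙ s.F i ⋙ e.inverse
  additive _ := inferInstance
  linear _ := inferInstance
  zero := NatIso.ofComponents
    (fun M => e.inverse.mapIso (s.zero.app (e.functor.obj M)) ≪≫ (e.unitIso.app M).symm)
    (fun f => by
      have h := e.inverse.congr_map (s.zero.hom.naturality (e.functor.map f))
      simp only [Functor.map_comp] at h
      simp [reassoc_of% h])
  add i j l h := NatIso.ofComponents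
    (fun M => e.inverse.mapIso ((s.add i j l h).app (e.functor.obj M) ≪≫
      (s.F i).mapIso (e.counitIso.symm.app ((s.F j).obj (e.functor.obj M)))))
    (fun f => by
      simp only [Functor.comp_map, Functor.mapIso_hom, ← e.inverse.map_comp, Iso.trans_hom,
        Iso.app_hom, Iso.symm_hom]
      congr 1
      rw [(s.add i j l h).hom.naturality_assoc, Functor.comp_map, Category.assoc,
        ← (s.F i).map_comp, ← (s.F i).map_comp]
      simp)
  zero_left j M := by
    simp only [NatIso.ofComponents_hom_app, Iso.trans_hom, Functor.mapIso_hom, Iso.app_hom,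
      Iso.symm_hom, Functor.comp_obj, Functor.map_comp, Category.assoc, Iso.app_inv]
    have h := e.inverse.congr_map (s.zero.hom.naturality
      (e.counitIso.inv.app ((s.F j).obj (e.functor.obj M))))
    have h' := e.inverse.congr_map (s.zero_left j (e.functor.obj M))
    simp only [Functor.map_comp, Functor.id_map] at h h'
    rw [reassoc_of% h, reassoc_of% h']
    simp
  zero_right j M := by
    have h' := e.inverse.congr_map (s.zero_right j (e.functor.obj M))
    simp only [Functor.map_comp] at h'
    simp [h']
  assoc i j l ij jl ijl h₁ h₂ h₃ h₄ M := by
    have h := e.inverse.congr_map (s.assoc i j l ij jl ijl h₁ h₂ h₃ h₄ (e.functor.obj M))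
    have h' := e.inverse.congr_map ((s.add i j ij h₁).hom.naturality
      (e.counitIso.inv.app ((s.F l).obj (e.functor.obj M))))
    simp only [Functor.map_comp] at h h'
    simp
    rw [reassoc_of% h, reassoc_of% h']

lemma isEquivalence (s : ZSequence k C) (i : ℤ) : (s.F i).IsEquivalence :=
  (CategoryTheory.Equivalence.mk (s.F i) (s.F (-i)) (s.zero.symm ≪≫ s.add (-i) i 0 (by omega))
    ((s.add i (-i) 0 (by omega)).symm ≪≫ s.zero)).isEquivalence_functor

/-! ### Coherence of isomorphisms between two sequences -/

section Intertwine

variable (s : ZSequence k C) (s' : ZSequence k C') (E : C ⥤ C')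

/-- The isomorphisms that intertwine the `i`-th functors of two sequences. -/
abbrev Intertwine (i : ℤ) := s.F i ⋙ E ≅ E ⋙ s'.F i

namespace Intertwine

variable {s s' E}

/-- The intertwining isomorphism of a composite. -/
def mul {i j l : ℤ} (h : i + j = l) (a : Intertwine s s' E i) (b : Intertwine s s' E j) :
    Intertwine s s' E l :=
  NatIso.ofComponents
    (fun M => E.mapIso ((s.add i j l h).app M) ≪≫ a.app ((s.F j).obj M) ≪≫
      (s'.F i).mapIso (b.app M) ≪≫ ((s'.add i j l h).app (E.obj M)).symm)
    (fun {M N} f => by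
      have h₁ := E.congr_map ((s.add i j l h).hom.naturality f)
      have h₂ := a.hom.naturality ((s.F j).map f)
      have h₃ := (s'.F i).congr_map (b.hom.naturality f)
      have h₄ := (s'.add i j l h).inv.naturality (E.map f)
      simp only [Functor.map_comp, Functor.comp_map] at h₁ h₂ h₃ h₄
      simp only [Functor.comp_map, Iso.trans_hom, Functor.mapIso_hom, Iso.app_hom, Iso.symm_hom,
        Iso.app_inv, Category.assoc]
      rw [reassoc_of% h₁, reassoc_of% h₂, reassoc_of% h₃, h₄])

@[simp] lemma mul_hom_app {i j l : ℤ} (h : i + j = l) (a : Intertwine s s' E i)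
    (b : Intertwine s s' E j) (M : C) :
    (mul h a b).hom.app M = E.map ((s.add i j l h).hom.app M) ≫ a.hom.app ((s.F j).obj M) ≫
      (s'.F i).map (b.hom.app M) ≫ (s'.add i j l h).inv.app (E.obj M) := rfl

@[simp] lemma mul_inv_app {i j l : ℤ} (h : i + j = l) (a : Intertwine s s' E i)
    (b : Intertwine s s' E j) (M : C) :
    (mul h a b).inv.app M = (s'.add i j l h).hom.app (E.obj M) ≫ (s'.F i).map (b.inv.app M) ≫
      a.inv.app ((s.F j).obj M) ≫ E.map ((s.add i j l h).inv.app M) := by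
  simp [mul]

variable (s s' E) in
/-- The intertwining isomorphism of the identities. -/
def one : Intertwine s s' E 0 :=
  NatIso.ofComponents (fun M => E.mapIso (s.zero.app M) ≪≫ (s'.zero.app (E.obj M)).symm)
    (fun {M N} f => by
      have h₁ := E.congr_map (s.zero.hom.naturality f)
      have h₂ := s'.zero.inv.naturality (E.map f)
      simp only [Functor.map_comp, Functor.id_map] at h₁ h₂
      simp only [Functor.comp_map, Iso.trans_hom, Functor.mapIso_hom, Iso.app_hom, Iso.symm_hom,
        Iso.app_inv, Category.assoc]
      rw [reassoc_of% h₁, h₂])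

@[simp] lemma one_hom_app (M : C) :
    (one s s' E).hom.app M = E.map (s.zero.hom.app M) ≫ s'.zero.inv.app (E.obj M) := rfl

lemma one_mul {i : ℤ} (a : Intertwine s s' E i) : mul (zero_add i) (one s s' E) a = a := by
  ext M
  have h₁ := E.congr_map (s.zero_left i M)
  have h₂ := congrArg Iso.inv (Iso.ext (α := (s'.add 0 i i (zero_add i)).app (E.obj M) ≪≫
    s'.zero.app ((s'.F i).obj (E.obj M))) (β := Iso.refl _) (s'.zero_left i (E.obj M)))
  have h₃ := s'.zero.inv.naturality (a.hom.app M)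
  simp only [Functor.map_comp, Functor.id_map, Iso.trans_inv, Iso.app_inv,
    Iso.refl_inv] at h₁ h₂ h₃
  simp only [mul_hom_app, one_hom_app, Category.assoc]
  rw [reassoc_of% h₁, ← reassoc_of% h₃, E.map_id, Category.id_comp]
  exact (congrArg _ h₂).trans (Category.comp_id _)

lemma mul_assoc {i j l ij jl ijl : ℤ} (h₁ : i + j = ij) (h₂ : j + l = jl)
    (h₃ : i + jl = ijl) (h₄ : ij + l = ijl) (a : Intertwine s s' E i) (b : Intertwine s s' E j)
    (c : Intertwine s s' E l) : mul h₄ (mul h₁ a b) c = mul h₃ a (mul h₂ b c) := by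
  ext M
  have e₁ := E.congr_map (s.assoc i j l ij jl ijl h₁ h₂ h₃ h₄ M)
  have e₂ := congrArg Iso.inv (Iso.ext (α := (s'.add i jl ijl h₃).app (E.obj M) ≪≫
    (s'.F i).mapIso ((s'.add j l jl h₂).app (E.obj M))) (β := (s'.add ij l ijl h₄).app (E.obj M) ≪≫
    (s'.add i j ij h₁).app ((s'.F l).obj (E.obj M))) (s'.assoc i j l ij jl ijl h₁ h₂ h₃ h₄ (E.obj M)))
  have e₃ := a.hom.naturality ((s.add j l jl h₂).hom.app M)
  have e₄ := (s'.add i j ij h₁).inv.naturality (c.hom.app M)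
  simp only [Functor.map_comp, Functor.comp_map, Iso.trans_inv, Iso.app_inv,
    Functor.mapIso_inv] at e₁ e₂ e₃ e₄
  simp only [mul_hom_app, Functor.map_comp, Category.assoc]
  rw [← reassoc_of% e₁, ← reassoc_of% e₄, reassoc_of% e₃, e₂]

lemma mk_mul {i j l : ℤ} (h : i + j = l) (a : Intertwine s s' E i) (b : Intertwine s s' E j) :
    (⟨i + j, mul rfl a b⟩ : Σ i, Intertwine s s' E i) = ⟨l, mul h a b⟩ := by
  subst h; rfl

/-- Precomposition with the equivalence `s.F i` is fully faithful, and after it the desired identity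
prescribes what the inverse must be. -/
lemma exists_mul_eq_one {i : ℤ} (a : Intertwine s s' E i) :
    ∃ b : Intertwine s s' E (-i), mul (neg_add_cancel i) b a = one s s' E := by
  have := s.isEquivalence i
  let β : s.F i ⋙ (s.F (-i) ⋙ E) ≅ s.F i ⋙ (E ⋙ s'.F (-i)) :=
    (Functor.isoWhiskerRight (s.add (-i) i 0 (neg_add_cancel i)) E).symm ≪≫ one s s' E ≪≫
      Functor.isoWhiskerLeft E (s'.add (-i) i 0 (neg_add_cancel i)) ≪≫
        (Functor.isoWhiskerRight a (s'.F (-i))).symm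
  refine ⟨((Functor.whiskeringLeft C C C').obj (s.F i)).preimageIso β, ?_⟩
  ext M
  have h : (((Functor.whiskeringLeft C C C').obj (s.F i)).preimageIso β).hom.app ((s.F i).obj M) =
      β.hom.app M :=
    NatTrans.congr_app (((Functor.whiskeringLeft C C C').obj (s.F i)).map_preimage β.hom) M
  rw [mul_hom_app, h]
  simp [β, ← Functor.map_comp_assoc, -Functor.map_comp]

variable (s s' E) in
/-- The group of all intertwining isomorphisms. -/
abbrev Total := Σ i, Intertwine s s' E i

instance : Mul (Total s s' E) := ⟨fun a b => ⟨a.1 + b.1, mul rfl a.2 b.2⟩⟩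
instance : One (Total s s' E) := ⟨⟨0, one s s' E⟩⟩
instance : Inv (Total s s' E) := ⟨fun a => ⟨-a.1, (exists_mul_eq_one a.2).choose⟩⟩

/-- Coherence of both sequences gives associativity and the left unit. Inverses are what makes the
members of negative index of a family available. -/
instance : Group (Total s s' E) := Group.ofLeftAxioms
  (fun a b c => (mk_mul (add_assoc a.1 b.1 c.1) _ _).trans
    (congrArg (Sigma.mk (a.1 + (b.1 + c.1))) (mul_assoc rfl rfl rfl (add_assoc _ _ _) _ _ _)))
  (fun a => (mk_mul (zero_add a.1) _ _).trans (congrArg (Sigma.mk a.1) (one_mul a.2)))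
  (fun a => (mk_mul (neg_add_cancel a.1) _ _).trans
    (congrArg (Sigma.mk 0) (exists_mul_eq_one a.2).choose_spec))

/-- The degree of an intertwining isomorphism. -/
def degree : Total s s' E →* Multiplicative ℤ where
  toFun a := Multiplicative.ofAdd a.1
  map_one' := rfl
  map_mul' _ _ := rfl

/-- Two sequences whose first functors are intertwined are intertwined by a compatible family. -/
lemma exists_family (φ : Intertwine s s' E 1) :
    ∃ f : ∀ i, Intertwine s s' E i, f 0 = one s s' E ∧
      ∀ (i j l : ℤ) (h : i + j = l), f l = mul h (f i) (f j) := by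
  -- The family consists of the powers of `φ` in the group, and its compatibility is the law of
  -- exponents.
  let g : Total s s' E := ⟨1, φ⟩
  have hg (i : ℤ) : (g ^ i).1 = i := by
    have h : degree (g ^ i) = Multiplicative.ofAdd i := by
      rw [map_zpow]
      change Multiplicative.ofAdd 1 ^ i = _
      rw [← ofAdd_zsmul, smul_eq_mul, mul_one]
    exact h
  have hs (i : ℤ) : ∃ a : Intertwine s s' E i, g ^ i = ⟨i, a⟩ := by
    have := hg i
    generalize g ^ i = t at this
    subst this
    exact ⟨t.2, rfl⟩
  choose f hf using hs
  refine ⟨f, ?_, ?_⟩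
  · have h := hf 0
    rw [zpow_zero] at h
    exact (eq_of_heq (Sigma.mk.inj h).2).symm
  · rintro i j l rfl
    have h := zpow_add g i j
    rw [hf, hf, hf] at h
    exact eq_of_heq (Sigma.mk.inj h).2

end Intertwine

variable {s s' E}

/-- The transfer of the pieces of a twisted endomorphism ring along a compatible family of
intertwining isomorphisms. -/
def pieceEquiv [E.Full] [E.Faithful] [E.Additive] [Functor.Linear k E] {i : ℤ}
    (f : Intertwine s s' E i) {P : C} {P' : C'} (α : E.obj P ≅ P') :
    s.Piece P i ≃ₗ[k] s'.Piece P' i where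
  toFun a := (s'.F i).map α.inv ≫ f.inv.app P ≫ E.map a ≫ α.hom
  invFun b := E.preimage (f.hom.app P ≫ (s'.F i).map α.hom ≫ b ≫ α.inv)
  map_add' a b := by simp
  map_smul' c a := by simp
  left_inv a := E.map_injective (by simp [← Functor.map_comp_assoc])
  right_inv b := by simp [← Functor.map_comp_assoc]

lemma pieceEquiv_apply [E.Full] [E.Faithful] [E.Additive] [Functor.Linear k E] {i : ℤ}
    (f : Intertwine s s' E i) {P : C} {P' : C'} (α : E.obj P ≅ P') (a : s.Piece P i) :
    pieceEquiv f α a = (s'.F i).map α.inv ≫ f.inv.app P ≫ E.map a ≫ α.hom := rfl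

lemma pieceEquiv_one [E.Full] [E.Faithful] [E.Additive] [Functor.Linear k E]
    {P : C} {P' : C'} (α : E.obj P ≅ P') :
    pieceEquiv (Intertwine.one s s' E) α (s.pieceOne P) = s'.pieceOne P' := by
  have h := s'.zero.hom.naturality α.inv
  simp only [Functor.id_map] at h
  simp [pieceEquiv_apply, pieceOne, Intertwine.one, reassoc_of% h, ← Functor.map_comp_assoc]

lemma pieceEquiv_mul [E.Full] [E.Faithful] [E.Additive] [Functor.Linear k E] {i j l : ℤ}
    (h : i + j = l) (f : Intertwine s s' E i) (g : Intertwine s s' E j)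
    {P : C} {P' : C'} (α : E.obj P ≅ P') (a : s.Piece P i) (b : s.Piece P j) :
    pieceEquiv (Intertwine.mul h f g) α (s.pieceMul h a b) =
      s'.pieceMul h (pieceEquiv f α a) (pieceEquiv g α b) := by
  have h₁ := (s'.add i j l h).hom.naturality α.inv
  have h₂ := f.inv.naturality b
  have h₃ : E.map ((s.add i j l h).inv.app P) ≫ E.map ((s.add i j l h).hom.app P) =
      𝟙 (E.obj ((s.F i).obj ((s.F j).obj P))) := by
    rw [← E.map_comp, Iso.inv_hom_id_app]
    exact E.map_id _
  simp only [Functor.comp_map] at h₁ h₂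
  simp only [pieceEquiv_apply, pieceMul, Intertwine.mul_inv_app, Category.assoc, Functor.map_comp]
  rw [reassoc_of% h₁, reassoc_of% h₃, ← reassoc_of% h₂, ← Functor.map_comp_assoc _ α.hom]
  simp

end Intertwine

end ZSequence

end

end GrWeyl

namespace GrWeyl

noncomputable section

open scoped Polynomial
open scoped symmDiff

/-! ### The representable module and its twisted endomorphisms -/

namespace EMod

variable (k : Type u) [Field k]

/-- The representable module on the empty set. -/
abbrev unit : EMod k where
  obj _ := k[X]
  act D D' := LinearMap.mk₂ k (fun p q => cc k ∅ D D' * (q * p))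
    (fun p p' q => by ring) (fun c p q => by simp)
    (fun p q q' => by ring) (fun c p q => by simp)
  act_one m := by simp
  act_act {D D' D''} p q m := by
    simp only [LinearMap.mk₂_apply]
    linear_combination (m * p * q) * cc_assoc (k := k) ∅ D D' D''

variable {k}

lemma unit_act (D D' : Finset ℤ) (p q : k[X]) :
    (unit k).act D D' p q = cc k ∅ D D' * (q * p) := rfl

end EMod

namespace Orbit

variable (o : Orbit) {k : Type u} [Field k]

lemma K_neg_symmDiff (i : ℤ) (D : Finset ℤ) :
    o.K i ∆ translate (o.step * i) (o.K (-i) ∆ translate (o.step * (-i)) D) = D := by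
  rw [← o.K_add_symmDiff i (-i) 0 (by omega)]
  simp [translate_zero, ← Finset.bot_eq_empty]

lemma K_neg_symmDiff_K {i j l : ℤ} (h : i + j = l) :
    o.K (-i) ∆ translate (o.step * (-i)) (o.K l) = o.K j := by
  rw [← o.K_add]
  congr 1
  omega

/-- The `i`-th functor of the sequence turns the module represented by `∅` into one represented by
`K i`; this is the comparison of their cocycles. -/
lemma tr_cc_neg (i : ℤ) (D D' : Finset ℤ) :
    tr k (o.step * i) (cc k ∅ (o.K (-i) ∆ translate (o.step * (-i)) D)
      (o.K (-i) ∆ translate (o.step * (-i)) D')) = cc k (o.K i) D D' := by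
  rw [← cc_affine (o.K i), K_neg_symmDiff, K_neg_symmDiff, translate_empty,
    ← Finset.bot_eq_empty, symmDiff_bot]

lemma unitPieceOf_aux (i : ℤ) (D D' : Finset ℤ) (p q m : k[X]) :
    cc k ∅ (o.K i) D' * (tr k (o.step * i) (cc k ∅ (o.K (-i) ∆ translate (o.step * (-i)) D)
      (o.K (-i) ∆ translate (o.step * (-i)) D') * (m * tr k (o.step * (-i)) q)) * p) =
      cc k ∅ D D' * (cc k ∅ (o.K i) D * (tr k (o.step * i) m * p) * q) := by
  rw [map_mul, tr_cc_neg, map_mul, tr_tr, ← mul_add, add_neg_cancel, mul_zero, tr_zero]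
  linear_combination -(tr k (o.step * i) m * q * p) * cc_assoc (k := k) ∅ (o.K i) D D'

/-- The homomorphism with a given coordinate in a piece of the twisted endomorphism ring of the
representable module. -/
def unitPieceOf (i : ℤ) (p : k[X]) : (o.zSequence k).Piece (EMod.unit k) i :=
  EMod.mkHom (M := (EMod.pull (o.K (-i)) (o.step * (-i))).obj (EMod.unit k)) (N := EMod.unit k)
    (fun D => (LinearMap.mulLeft k (cc k ∅ (o.K i) D)).comp
      ((LinearMap.mulRight k p).comp (tr k (o.step * i)).toLinearMap))
    (fun D D' q m => o.unitPieceOf_aux i D D' p q m)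

/-- Yoneda: the pulled back module is generated by `1` at the object `K i`, so a homomorphism is
determined by its value there. -/
lemma unitPiece_app {i : ℤ} (a : (o.zSequence k).Piece (EMod.unit k) i) (D : Finset ℤ) (q : k[X]) :
    EMod.app a D q = cc k ∅ (o.K i) D *
      (tr k (o.step * i) q * (EMod.app a (o.K i) (1 : k[X]) : k[X])) := by
  have h := EMod.app_act a (D := o.K i) (D' := D) (tr k (o.step * i) q) (1 : k[X])
  have h' : (((o.zSequence k).F i).obj (EMod.unit k)).act (o.K i) D (tr k (o.step * i) q)
      (1 : k[X]) = q := by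
    change cc k ∅ (o.K (-i) ∆ translate (o.step * (-i)) (o.K i)) _ *
      ((1 : k[X]) * tr k (o.step * (-i)) (tr k (o.step * i) q)) = q
    rw [o.K_neg_symmDiff_K (add_zero i), K_zero, cc_left, tr_tr, ← mul_add, neg_add_cancel,
      mul_zero, tr_zero, one_mul, one_mul]
  rw [h'] at h
  rw [h]
  refine (EMod.unit_act (o.K i) D _ _).trans ?_
  rw [mul_comm (EMod.app a (o.K i) (1 : k[X]) : k[X])]

/-- The coordinate on the pieces of the twisted endomorphism ring of the representable module. -/
def unitPiece (i : ℤ) : (o.zSequence k).Piece (EMod.unit k) i ≃ₗ[k] k[X] where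
  toFun a := EMod.app a (o.K i) (1 : k[X])
  map_add' _ _ := rfl
  map_smul' _ _ := rfl
  invFun := o.unitPieceOf i
  left_inv a := EMod.hom_ext fun D q => (o.unitPiece_app a D q).symm
  right_inv p := by
    change cc k ∅ (o.K i) (o.K i) * (tr k _ 1 * p) = p
    rw [cc_right, map_one, one_mul, one_mul]

lemma unitPiece_apply {i : ℤ} (a : (o.zSequence k).Piece (EMod.unit k) i) :
    o.unitPiece i a = EMod.app a (o.K i) (1 : k[X]) := rfl

lemma unitPiece_one : o.unitPiece 0 ((o.zSequence k).pieceOne (EMod.unit k)) = 1 := by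
  change cc k ∅ (o.K (-0) ∆ translate (o.step * (-0)) (o.K 0)) (o.K 0) * ((1 : k[X]) * 1) = 1
  simp [translate_zero, ← Finset.bot_eq_empty]

/-- The composite is evaluated on the generator: the structure isomorphism fixes it, `b` turns it
into the coordinate of `b`, and `a` contributes the translation and the cocycle. The result is the
rule of `Chart.coord_mul`. -/
lemma unitPiece_mul {i j l : ℤ} (h : i + j = l) (a : (o.zSequence k).Piece (EMod.unit k) i)
    (b : (o.zSequence k).Piece (EMod.unit k) j) :
    o.unitPiece l ((o.zSequence k).pieceMul h a b) =
      cc k ∅ (o.K i) (o.K l) * (o.unitPiece i a * tr k (o.step * i) (o.unitPiece j b)) := by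
  have h₁ : (EMod.unit k).act (o.K (-l) ∆ translate (o.step * (-l)) (o.K l))
      (o.K (-j) ∆ translate (o.step * (-j)) (o.K (-i) ∆ translate (o.step * (-i)) (o.K l)))
      1 (1 : k[X]) = (1 : k[X]) := by
    rw [← o.K_add_symmDiff (-j) (-i) (-l) (by omega)]
    exact (EMod.unit k).act_one _
  have h₂ : o.unitPiece l ((o.zSequence k).pieceMul h a b) =
      EMod.app a (o.K l) (EMod.app b (o.K (-i) ∆ translate (o.step * (-i)) (o.K l))
        ((EMod.unit k).act (o.K (-l) ∆ translate (o.step * (-l)) (o.K l))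
      (o.K (-j) ∆ translate (o.step * (-j)) (o.K (-i) ∆ translate (o.step * (-i)) (o.K l)))
      1 (1 : k[X]))) := rfl
  rw [h₂, h₁, o.K_neg_symmDiff_K h]
  refine (o.unitPiece_app a (o.K l) _).trans ?_
  rw [unitPiece_apply, unitPiece_apply, mul_comm (tr k _ _)]

end Orbit

/-! ## Twisted endomorphism rings in coordinates -/

section TwistedChart

variable {k : Type u} [Field k]

/-- Coordinates on the pieces of a twisted endomorphism ring, with the multiplication that is
determined by the orbit `o`. -/
structure PieceChart (o : Orbit) {C : Type*} [Category* C] [Preadditive C] [Linear k C]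
    (s : ZSequence k C) (P : C) where
  coord : ∀ i, s.Piece P i ≃ₗ[k] k[X]
  coord_one : coord 0 (s.pieceOne P) = 1
  coord_mul : ∀ {i j l : ℤ} (h : i + j = l) (a : s.Piece P i) (b : s.Piece P j),
    coord l (s.pieceMul h a b) =
      cc k ∅ (o.K i) (o.K l) * (coord i a * tr k (o.step * i) (coord j b))

namespace PieceChart

/-- The coordinates on the twisted endomorphism ring of the representable module. -/
def unit (o : Orbit) : PieceChart o (o.zSequence k) (EMod.unit k) where
  coord := o.unitPiece
  coord_one := o.unitPiece_one
  coord_mul := o.unitPiece_mul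

variable {o : Orbit} {C : Type*} [Category* C] [Preadditive C] [Linear k C]
    {s : ZSequence k C} {P : C}

/-- Coordinates are transported along intertwined sequences. -/
lemma nonempty_of_intertwine {C' : Type*} [Category* C'] [Preadditive C'] [Linear k C']
    {s' : ZSequence k C'} {P' : C'} (c : PieceChart o s' P') (E : C ⥤ C') [E.Full] [E.Faithful]
    [E.Additive] [Functor.Linear k E] (φ : s.F 1 ⋙ E ≅ E ⋙ s'.F 1) (α : E.obj P ≅ P') :
    Nonempty (PieceChart o s P) := by
  obtain ⟨f, hf₀, hf⟩ := ZSequence.Intertwine.exists_family φ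
  refine ⟨⟨fun i => (ZSequence.pieceEquiv (f i) α).trans (c.coord i), ?_, ?_⟩⟩
  · rw [LinearEquiv.trans_apply, hf₀, ZSequence.pieceEquiv_one, c.coord_one]
  · intro i j l h a b
    rw [LinearEquiv.trans_apply, hf i j l h, ZSequence.pieceEquiv_mul, c.coord_mul]
    rfl

variable {R : Type u} [Ring R] [Algebra k R] {𝒜 : ℤ → Submodule k R} [SetLike.GradedMonoid 𝒜]

/-- Two rings with coordinates for the same orbit are isomorphic. -/
lemma exists_algEquiv (c : PieceChart o s P) (χ : Chart o 𝒜) (h𝒜 : DirectSum.IsInternal 𝒜) :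
    ∃ e : s.TwistedEnd P ≃ₐ[k] R, ∀ d : ℤ, (s.twistedGrading P d).map e.toLinearMap = 𝒜 d := by
  let g (i : ℤ) : s.Piece P i ≃ₗ[k] 𝒜 i := (c.coord i).trans (χ.coord i).symm
  have hg (i : ℤ) (a) : χ.coord i (g i a) = c.coord i a := LinearEquiv.apply_symm_apply _ _
  let f (i : ℤ) : s.Piece P i →ₗ[k] R := (𝒜 i).subtype.comp (g i).toLinearMap
  let F : s.TwistedEnd P →ₐ[k] R := DirectSum.toAlgebra k (s.Piece P) f
    (congrArg Subtype.val (show g 0 (s.pieceOne P) = ⟨1, SetLike.GradedOne.one_mem⟩ from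
      (χ.coord 0).injective (by rw [hg, c.coord_one, χ.coord_one])))
    (fun {i j} a b => congrArg Subtype.val (show g (i + j) (s.pieceMul rfl a b) =
      ⟨(g i a : R) * (g j b : R), SetLike.GradedMul.mul_mem (g i a).2 (g j b).2⟩ from
      (χ.coord (i + j)).injective (by rw [hg, c.coord_mul, χ.coord_mul, hg, hg])))
  have hF (i : ℤ) (a : s.Piece P i) : F (DirectSum.lof k ℤ (s.Piece P) i a) = g i a :=
    DirectSum.toModule_lof k i a
  -- The map is a direct sum of isomorphisms of pieces followed by the canonical map to the ring;
  -- internality of the grading makes the latter bijective.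
  have hF' : F.toLinearMap = (DirectSum.coeLinearMap 𝒜).comp
      (DFinsupp.mapRange.linearEquiv g).toLinearMap := by
    apply DirectSum.linearMap_ext
    intro i
    ext a
    rw [LinearMap.comp_apply, LinearMap.comp_apply, LinearMap.comp_apply, AlgHom.toLinearMap_apply,
      hF]
    have : (DFinsupp.mapRange.linearEquiv g) (DirectSum.lof k ℤ (s.Piece P) i a) =
        DirectSum.lof k ℤ (fun i => 𝒜 i) i (g i a) := DFinsupp.mapRange_single (hf := fun i => map_zero _)
    rw [LinearEquiv.coe_coe, this, DirectSum.coeLinearMap_lof]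
  have hbij : Function.Bijective F := by
    have := h𝒜.comp (DFinsupp.mapRange.linearEquiv g).bijective
    have h : ⇑F = DirectSum.coeLinearMap 𝒜 ∘ DFinsupp.mapRange.linearEquiv g :=
      congrArg (fun φ : s.TwistedEnd P →ₗ[k] R => ⇑φ) hF'
    rw [h]
    exact this
  refine ⟨AlgEquiv.ofBijective F hbij, fun d => ?_⟩
  ext r
  simp only [ZSequence.twistedGrading, Submodule.mem_map, LinearMap.mem_range,
    exists_exists_eq_and]
  constructor
  · rintro ⟨a, rfl⟩
    change F _ ∈ _
    rw [hF]
    exact (g d a).2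
  · intro hr
    refine ⟨(g d).symm ⟨r, hr⟩, ?_⟩
    change F _ = _
    rw [hF, LinearEquiv.apply_symm_apply]

end PieceChart

namespace Chart

variable {R : Type u} [Ring R] [Algebra k R] {o : Orbit} {𝒜 : ℤ → Submodule k R}
  [SetLike.GradedMonoid 𝒜] (χ : Chart o 𝒜)

/-- A ring with a chart is the restriction of the representable module. -/
def resUnit : χ.res.obj (EMod.unit k) ≅ GrMod.self 𝒜 :=
  (GrMod.isoMk (M := GrMod.self 𝒜) (N := χ.res.obj (EMod.unit k)) (fun i => χ.coord i) (by
    rintro i d n rfl m r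
    refine (χ.coord_mul m r).trans ?_
    exact (EMod.unit_act (o.K i) (o.K (i + d)) _ _).symm)).symm

variable [CharZero k]

instance : χ.ind.IsEquivalence := χ.equivalence.isEquivalence_inverse

/-- The extension of a ring with a chart is the representable module. -/
def indSelf : χ.ind.obj (GrMod.self 𝒜) ≅ EMod.unit k :=
  χ.ind.mapIso χ.resUnit.symm ≪≫ (χ.resInd.app (EMod.unit k)).symm

/-- Autoequivalences that correspond to automorphisms of the category of rank one objects extend
to sequences. -/
lemma exists_zSequence (o' : Orbit) {F : GrMod 𝒜 ⥤ GrMod 𝒜}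
    (hF : Nonempty (F ≅ χ.ind ⋙ (o'.zSequence k).F 1 ⋙ χ.res)) :
    ∃ s : ZSequence k (GrMod 𝒜), Nonempty (s.F 1 ≅ F) := by
  have : χ.equivalence.symm.functor.Additive := inferInstanceAs χ.ind.Additive
  have : χ.equivalence.symm.inverse.Additive := inferInstanceAs χ.res.Additive
  have : Functor.Linear k χ.equivalence.symm.functor := inferInstanceAs (Functor.Linear k χ.ind)
  have : Functor.Linear k χ.equivalence.symm.inverse := inferInstanceAs (Functor.Linear k χ.res)
  exact ⟨(o'.zSequence k).transport χ.equivalence.symm, hF.map Iso.symm⟩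

/-- The twisted endomorphism ring of the regular module has coordinates. -/
lemma nonempty_pieceChart (o' : Orbit) {s : ZSequence k (GrMod 𝒜)}
    (hF : Nonempty (s.F 1 ≅ χ.ind ⋙ (o'.zSequence k).F 1 ⋙ χ.res)) :
    Nonempty (PieceChart o' s (GrMod.self 𝒜)) := by
  obtain ⟨φ⟩ := hF
  exact (PieceChart.unit o').nonempty_of_intertwine χ.ind
    (Functor.isoWhiskerRight φ χ.ind ≪≫
      Functor.isoWhiskerLeft (χ.ind ⋙ (o'.zSequence k).F 1) χ.resInd.symm) χ.indSelf

end Chart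

end TwistedChart

end

end GrWeyl

namespace GrWeyl

noncomputable section

open Polynomial (X C aeval)
open scoped Polynomial symmDiff

/-! ## Skew Laurent operators -/

section SkewOp

variable (k : Type u) [Field k]

/-- The space on which skew Laurent polynomials act. -/
abbrev OpSpace := ℤ → k[X]

variable {k}

/-- The operator `p(z) t^d`, where `t z = (z + n) t`. -/
def mon (n : ℤ) (p : k[X]) (d : ℤ) : Module.End k (OpSpace k) where
  toFun f i := tr k (n * i) p * f (i + d)
  map_add' f g := by ext1 i; simp [mul_add]
  map_smul' c f := by ext1 i; simp

lemma mon_apply (n : ℤ) (p : k[X]) (d : ℤ) (f : OpSpace k) (i : ℤ) :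
    mon n p d f i = tr k (n * i) p * f (i + d) := rfl

/-- The operators multiply as skew Laurent polynomials. Acting by them shows that the algebras
defined by relations do not collapse. -/
lemma mon_mul (n : ℤ) (p q : k[X]) (d e : ℤ) :
    mon n p d * mon n q e = mon n (p * tr k (n * d) q) (d + e) := by
  ext f i : 2
  simp only [Module.End.mul_apply, mon_apply, map_mul, tr_tr, mul_add, add_assoc, mul_assoc]

/-- The operators of multiplication by polynomials in `z`. -/
def opZ (n : ℤ) : k[X] →ₐ[k] Module.End k (OpSpace k) where
  toFun p := mon n p 0
  map_one' := by ext f i : 2; simp [mon_apply]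
  map_mul' p q := by simp [mon_mul]
  map_zero' := by ext f i : 2; simp [mon_apply]
  map_add' p q := by ext f i : 2; simp [mon_apply, add_mul]
  commutes' c := by
    ext f i : 2
    simp only [mon_apply, AlgEquiv.commutes, add_zero, Module.algebraMap_end_apply, Pi.smul_apply,
      Algebra.smul_def]

lemma opZ_apply (n : ℤ) (p : k[X]) : opZ n p = mon n p 0 := rfl

lemma mon_zero (n d : ℤ) : mon n (0 : k[X]) d = 0 := by
  ext f i : 2
  simp [mon_apply]

lemma mon_add (n : ℤ) (p q : k[X]) (d : ℤ) : mon n (p + q) d = mon n p d + mon n q d := by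
  ext f i : 2
  simp [mon_apply, add_mul]

lemma mon_sub (n : ℤ) (p q : k[X]) (d : ℤ) : mon n (p - q) d = mon n p d - mon n q d := by
  ext f i : 2
  simp [mon_apply, sub_mul]

lemma mon_smul (n : ℤ) (c : k) (p : k[X]) (d : ℤ) : mon n (c • p) d = c • mon n p d := by
  ext f i : 2
  simp [mon_apply]

lemma opZ_mul_mon (n : ℤ) (p q : k[X]) (d : ℤ) : opZ n p * mon n q d = mon n (p * q) d := by
  simp [opZ_apply, mon_mul]

/-- The coefficient of `t^d` in an operator. -/
def symbol (d : ℤ) : Module.End k (OpSpace k) →ₗ[k] k[X] :=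
  (LinearMap.proj 0).comp (LinearMap.applyₗ (Pi.single d 1))

lemma symbol_apply (d : ℤ) (φ : Module.End k (OpSpace k)) : symbol d φ = φ (Pi.single d 1) 0 := rfl

lemma symbol_mon (n : ℤ) (p : k[X]) (d : ℤ) : symbol d (mon n p d) = p := by
  simp [symbol_apply, mon_apply]

lemma symbol_mon_of_ne (n : ℤ) (p : k[X]) {d e : ℤ} (h : e ≠ d) : symbol d (mon n p e) = 0 := by
  simp [symbol_apply, mon_apply, h]

lemma symbol_opZ_mul (n : ℤ) (p : k[X]) (d : ℤ) (φ : Module.End k (OpSpace k)) :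
    symbol d (opZ n p * φ) = p * symbol d φ := by
  simp [symbol_apply, opZ_apply, mon_apply]

end SkewOp

/-! ## Symbols of graded algebras -/

section Symbol

variable {k R : Type u} [Field k] [Ring R] [Algebra k R]

/-- A realization of a graded algebra inside the skew Laurent polynomials, with the coefficients in
degree `d` the multiples of `a d`. -/
structure SymbolMap (n : ℤ) (a : ℤ → k[X]) (𝒜 : ℤ → Submodule k R) where
  sym : ℤ → R →ₗ[k] k[X]
  sym_of_ne : ∀ {d e : ℤ} {r : R}, r ∈ 𝒜 e → e ≠ d → sym d r = 0
  eq_zero : ∀ {d : ℤ} {r : R}, r ∈ 𝒜 d → sym d r = 0 → r = 0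
  dvd : ∀ (d : ℤ) (r : R), a d ∣ sym d r
  exists_sym : ∀ (d : ℤ) (p : k[X]), ∃ r ∈ 𝒜 d, sym d r = a d * p
  sym_one : sym 0 1 = 1
  sym_mul : ∀ {d e : ℤ} {r s : R}, r ∈ 𝒜 d → s ∈ 𝒜 e →
    sym (d + e) (r * s) = sym d r * tr k (n * d) (sym e s)
  iSup_eq_top : ⨆ d, 𝒜 d = ⊤

namespace SymbolMap

variable {n : ℤ} {a : ℤ → k[X]} {𝒜 : ℤ → Submodule k R} (σ : SymbolMap n a 𝒜)

-- The coefficient functional of a degree is injective on that degree and kills all others, so the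
-- degrees are independent.
include σ in
lemma isInternal : DirectSum.IsInternal 𝒜 := by
  rw [DirectSum.isInternal_submodule_iff_iSupIndep_and_iSup_eq_top]
  refine ⟨fun i => ?_, σ.iSup_eq_top⟩
  rw [Submodule.disjoint_def]
  intro x hx hx'
  refine σ.eq_zero hx ?_
  have : ⨆ j, ⨆ (_ : j ≠ i), 𝒜 j ≤ LinearMap.ker (σ.sym i) :=
    iSup₂_le fun j hj y hy => σ.sym_of_ne hy hj
  exact this hx'

lemma exists_sum (r : R) : ∃ c : ℤ →₀ R, (∀ d, c d ∈ 𝒜 d) ∧ r = ∑ d ∈ c.support, c d ∧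
    ∀ d, σ.sym d r = σ.sym d (c d) := by
  have hr : r ∈ ⨆ d, 𝒜 d := by rw [σ.iSup_eq_top]; trivial
  obtain ⟨c, hc, hs⟩ := (Submodule.mem_iSup_iff_exists_finsupp _ _).1 hr
  refine ⟨c, hc, hs.symm, fun d => ?_⟩
  rw [← hs, Finsupp.sum, map_sum, Finset.sum_eq_single d]
  · exact fun e _ he => σ.sym_of_ne (hc e) he
  · intro hd
    rw [Finsupp.notMem_support_iff.1 hd, map_zero]

/-- The chart given by a realization inside the skew Laurent polynomials. -/
def chart [SetLike.GradedMonoid 𝒜] (o : Orbit) (ho : o.step = n) (ha : ∀ d, a d ≠ 0)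
    (hcc : ∀ d e, cc k ∅ (o.K d) (o.K (d + e)) * a (d + e) = a d * tr k (n * d) (a e))
    (ha0 : a 0 = 1) : Chart o 𝒜 :=
  let L (d : ℤ) : k[X] →ₗ[k] k[X] := LinearMap.mulLeft k (a d)
  have hL (d : ℤ) : Function.Injective (L d) := mul_right_injective₀ (ha d)
  let e (d : ℤ) : 𝒜 d ≃ₗ[k] k[X] :=
    (LinearEquiv.ofBijective (((σ.sym d).comp (𝒜 d).subtype).codRestrict (LinearMap.range (L d))
      fun r => by obtain ⟨p, hp⟩ := σ.dvd d r; exact ⟨p, hp.symm⟩) (by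
        constructor
        · rw [injective_iff_map_eq_zero]
          intro r hr
          exact Subtype.ext (σ.eq_zero r.2 (congrArg Subtype.val hr))
        · rintro ⟨_, p, rfl⟩
          obtain ⟨r, hr, h⟩ := σ.exists_sym d p
          exact ⟨⟨r, hr⟩, Subtype.ext h⟩)).trans (LinearEquiv.ofInjective (L d) (hL d)).symm
  have he (d : ℤ) (r : 𝒜 d) : a d * e d r = σ.sym d r :=
    congrArg Subtype.val ((LinearEquiv.ofInjective (L d) (hL d)).apply_symm_apply _)
  { coord := e
    coord_one := by
      have := he 0 ⟨1, SetLike.GradedOne.one_mem⟩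
      rwa [ha0, one_mul, σ.sym_one] at this
    coord_mul := by
      intro d d' r s
      -- The coordinate is the symbol divided by `a d`. After multiplying back, multiplicativity of
      -- symbols and the cocycle relation `hcc` give the claim.
      apply mul_left_cancel₀ (ha (d + d'))
      rw [he, σ.sym_mul r.2 s.2, ← he, ← he, map_mul, ho]
      linear_combination -(e d r * tr k (n * d) (e d' s)) * hcc d d' }

lemma mem_of_dvd {S : Subalgebra k R} {b : ℤ → k[X]}
    (hS : ∀ d p, ∃ r ∈ S, r ∈ 𝒜 d ∧ σ.sym d r = b d * p) {d : ℤ} {r : R} (hr : r ∈ 𝒜 d)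
    (h : b d ∣ σ.sym d r) : r ∈ S := by
  obtain ⟨p, hp⟩ := h
  obtain ⟨r', hr', hr'', h'⟩ := hS d p
  have : r - r' = 0 := σ.eq_zero ((𝒜 d).sub_mem hr hr'') (by rw [map_sub, hp, h', sub_self])
  rwa [sub_eq_zero.1 this]

/-- The realization of a graded subalgebra. -/
def subalgebra (S : Subalgebra k R) (b : ℤ → k[X]) (hb : ∀ r ∈ S, ∀ d, b d ∣ σ.sym d r)
    (hS : ∀ d p, ∃ r ∈ S, r ∈ 𝒜 d ∧ σ.sym d r = b d * p) :
    SymbolMap n b (subGrading 𝒜 S) where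
  sym d := (σ.sym d).comp S.val.toLinearMap
  sym_of_ne hr h := σ.sym_of_ne hr h
  eq_zero hr h := Subtype.ext (σ.eq_zero hr h)
  dvd d r := hb r r.2 d
  exists_sym d p := by
    obtain ⟨r, hr, hr', h⟩ := hS d p
    exact ⟨⟨r, hr⟩, hr', h⟩
  sym_one := σ.sym_one
  sym_mul hr hs := σ.sym_mul hr hs
  iSup_eq_top := by
    rw [eq_top_iff]
    rintro r -
    obtain ⟨c, hc, hr, h⟩ := σ.exists_sum (r : R)
    -- The subalgebra contains the homogeneous components of its elements, because divisibility of
    -- the symbol detects membership in each degree.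
    have hcS (d : ℤ) : c d ∈ S := σ.mem_of_dvd hS (hc d) (h d ▸ hb r r.2 d)
    have : r = ∑ d ∈ c.support, (⟨c d, hcS d⟩ : S) := Subtype.ext (by
      rw [hr]
      simp)
    rw [this]
    exact Submodule.sum_mem _ fun d _ => Submodule.mem_iSup_of_mem d (hc d)

end SymbolMap

/-! ### Normal forms in generalized Weyl algebras -/

/-- The elements `x`, `y`, `z` of an algebra satisfy the relations of a generalized Weyl algebra,
and the algebra acts by skew Laurent operators. -/
structure GWATriple (R : Type u) [Ring R] [Algebra k R] (f : k[X]) (n : ℤ) where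
  x : R
  y : R
  z : R
  xz : x * z = (z + algebraMap k R n) * x
  yz : y * z = (z - algebraMap k R n) * y
  xy : x * y = aeval z f
  yx : y * x = aeval z (tr k (-n) f)
  rep : R →ₐ[k] Module.End k (OpSpace k)
  rep_x : rep x = mon n f 1
  rep_y : rep y = mon n 1 (-1)
  rep_z : rep z = mon n X 0

/-- The coefficients of the powers of the generator of degree `1` of a generalized Weyl algebra. -/
def wPoly (f : k[X]) (n d : ℤ) : k[X] := ∏ l ∈ Finset.range d.toNat, tr k (n * l) f

lemma wPoly_natCast_succ (f : k[X]) (n : ℤ) (d : ℕ) :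
    wPoly f n (d + 1) = wPoly f n d * tr k (n * d) f := by
  have h : ((d : ℤ) + 1).toNat = d + 1 := by omega
  rw [wPoly, wPoly, h, Finset.prod_range_succ, Int.toNat_natCast]

lemma wPoly_of_nonpos (f : k[X]) (n : ℤ) {d : ℤ} (hd : d ≤ 0) : wPoly f n d = 1 := by
  rw [wPoly, Int.toNat_of_nonpos hd, Finset.prod_range_zero]

lemma wPoly_ne_zero {f : k[X]} (hf : f ≠ 0) (n d : ℤ) : wPoly f n d ≠ 0 :=
  Finset.prod_ne_zero_iff.2 fun _ _ => (map_ne_zero_iff _ (tr k _).injective).2 hf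

lemma tr_X (s : ℤ) : tr k s X = X + C (s : k) := by rw [tr_apply, Polynomial.taylor_X]

lemma aeval_mem_zero {𝒜 : ℤ → Submodule k R} [SetLike.GradedMonoid 𝒜] {z : R} (hz : z ∈ 𝒜 0)
    (p : k[X]) : aeval z p ∈ 𝒜 0 := by
  induction p using Polynomial.induction_on' with
  | add p q hp hq => rw [map_add]; exact Submodule.add_mem _ hp hq
  | monomial m c =>
    rw [Polynomial.aeval_monomial, ← Algebra.smul_def]
    refine Submodule.smul_mem _ _ ?_
    have := SetLike.pow_mem_graded m hz
    rwa [smul_zero] at this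

namespace GWATriple

variable {f : k[X]} {n : ℤ} (T : GWATriple R f n)

lemma rep_aeval (p : k[X]) : T.rep (aeval T.z p) = opZ n p := by
  rw [← Polynomial.aeval_algHom_apply, T.rep_z, ← opZ_apply, Polynomial.aeval_algHom_apply,
    Polynomial.aeval_X_left_apply]

lemma commute_aeval {s : ℤ} {r : R} (h : r * T.z = (T.z + algebraMap k R s) * r) (p : k[X]) :
    r * aeval T.z p = aeval T.z (tr k s p) * r := by
  induction p using Polynomial.induction_on' with
  | add p q hp hq => simp only [map_add, mul_add, add_mul, hp, hq]
  | monomial m c =>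
    have h' : ∀ m : ℕ, r * T.z ^ m = (T.z + algebraMap k R s) ^ m * r := by
      intro m
      induction m with
      | zero => simp
      | succ m ih => rw [pow_succ, ← mul_assoc, ih, mul_assoc, h, ← mul_assoc, ← pow_succ]
    have e : aeval T.z (tr k s X) = T.z + algebraMap k R s := by simp [tr_X]
    rw [← Polynomial.C_mul_X_pow_eq_monomial]
    simp only [map_mul, map_pow, e, Polynomial.aeval_C, Polynomial.aeval_X]
    have : tr k s (C c) = C c := (tr k s).commutes c
    rw [this, Polynomial.aeval_C, ← mul_assoc, ← Algebra.commutes, mul_assoc, h', mul_assoc]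

lemma x_aeval (p : k[X]) : T.x * aeval T.z p = aeval T.z (tr k n p) * T.x :=
  T.commute_aeval T.xz p

lemma y_aeval (p : k[X]) : T.y * aeval T.z p = aeval T.z (tr k (-n) p) * T.y :=
  T.commute_aeval (by rw [T.yz, Int.cast_neg, map_neg, sub_eq_add_neg]) p

lemma xpow_aeval (m : ℕ) (p : k[X]) :
    T.x ^ m * aeval T.z p = aeval T.z (tr k (n * m) p) * T.x ^ m := by
  induction m generalizing p with
  | zero => simp
  | succ m ih =>
    rw [pow_succ, mul_assoc, x_aeval, ← mul_assoc, ih, tr_tr, mul_assoc]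
    congr 4
    push_cast
    ring

lemma ypow_aeval (m : ℕ) (p : k[X]) :
    T.y ^ m * aeval T.z p = aeval T.z (tr k (n * (-m)) p) * T.y ^ m := by
  induction m generalizing p with
  | zero => simp
  | succ m ih =>
    rw [pow_succ, mul_assoc, y_aeval, ← mul_assoc, ih, tr_tr, mul_assoc]
    congr 4
    push_cast
    ring

/-- The generator of degree `d`. -/
def t (d : ℤ) : R := if 0 ≤ d then T.x ^ d.toNat else T.y ^ (-d).toNat

lemma t_natCast (m : ℕ) : T.t m = T.x ^ m := by simp [t]

lemma t_neg_natCast (m : ℕ) : T.t (-m) = T.y ^ m := by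
  cases m with
  | zero => simp [t]
  | succ m =>
    rw [t, if_neg (by omega)]
    congr 1

@[simp] lemma t_zero : T.t 0 = 1 := by simpa using T.t_natCast 0

@[simp] lemma t_one : T.t 1 = T.x := by simpa using T.t_natCast 1

@[simp] lemma t_neg_one : T.t (-1) = T.y := by simpa using T.t_neg_natCast 1

lemma t_aeval (d : ℤ) (p : k[X]) : T.t d * aeval T.z p = aeval T.z (tr k (n * d) p) * T.t d := by
  obtain ⟨m, rfl | rfl⟩ := d.eq_nat_or_neg
  · rw [t_natCast, xpow_aeval]
  · rw [t_neg_natCast, ypow_aeval]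

/-- A step away from degree 0 only lengthens the power. In negative degree, `y * x` is a polynomial
in `z`, which is then moved to the left. -/
lemma t_mul_x (d : ℤ) : ∃ q : k[X], T.t d * T.x = aeval T.z q * T.t (d + 1) := by
  obtain ⟨m, rfl | rfl⟩ := d.eq_nat_or_neg
  · refine ⟨1, ?_⟩
    have : ((m : ℤ) + 1) = (m + 1 : ℕ) := by push_cast; rfl
    rw [this, t_natCast, t_natCast, pow_succ, map_one, one_mul]
  · cases m with
    | zero => exact ⟨1, by simp⟩
    | succ m =>
      refine ⟨tr k (n * (-m)) (tr k (-n) f), ?_⟩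
      have : -((m + 1 : ℕ) : ℤ) + 1 = -m := by push_cast; ring
      rw [this, t_neg_natCast, t_neg_natCast, ← ypow_aeval, pow_succ, mul_assoc, T.yx]

lemma t_mul_y (d : ℤ) : ∃ q : k[X], T.t d * T.y = aeval T.z q * T.t (d + -1) := by
  obtain ⟨m, rfl | rfl⟩ := d.eq_nat_or_neg
  · cases m with
    | zero => exact ⟨1, by simp⟩
    | succ m =>
      refine ⟨tr k (n * m) f, ?_⟩
      have : ((m + 1 : ℕ) : ℤ) + -1 = m := by push_cast; ring
      rw [this, t_natCast, t_natCast, ← xpow_aeval, pow_succ, mul_assoc, T.xy]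
  · refine ⟨1, ?_⟩
    have : (-(m : ℤ) + -1) = -(m + 1 : ℕ) := by push_cast; ring
    rw [this, t_neg_natCast, t_neg_natCast, pow_succ, map_one, one_mul]

/-- Since `x` acts as `f t` and `y` as `t⁻¹`, positive powers collect translates of `f` and negative
powers collect nothing. -/
lemma rep_t (d : ℤ) : T.rep (T.t d) = mon n (wPoly f n d) d := by
  obtain ⟨m, rfl | rfl⟩ := d.eq_nat_or_neg
  · rw [t_natCast]
    induction m with
    | zero => simp [wPoly, ← opZ_apply]
    | succ m ih => rw [pow_succ, map_mul, ih, T.rep_x, mon_mul, Nat.cast_succ, wPoly_natCast_succ]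
  · rw [t_neg_natCast, wPoly_of_nonpos _ _ (by omega)]
    induction m with
    | zero => simp [← opZ_apply]
    | succ m ih =>
      rw [pow_succ, map_mul, ih, T.rep_y, mon_mul, map_one, mul_one]
      congr 1
      push_cast
      ring

/-- The realization of an algebra that contains a triple, graded by words in generators that are
multiples of the generators of the triple. -/
def symbolMap {γ : Type} {gen : γ → R} {deg : γ → ℤ} (hf : f ≠ 0)
    (hgen : Algebra.adjoin k (Set.range gen) = ⊤)
    (hx : T.x ∈ wordGrading (k := k) gen deg 1) (hy : T.y ∈ wordGrading (k := k) gen deg (-1))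
    (hz : T.z ∈ wordGrading (k := k) gen deg 0)
    (hg : ∀ g, (deg g = 0 ∨ deg g = 1 ∨ deg g = -1) ∧ ∃ q : k[X], gen g = aeval T.z q * T.t (deg g)) :
    SymbolMap n (wPoly f n) (wordGrading (k := k) gen deg) :=
  have hz' := aeval_mem_zero (k := k) hz
  have ht (d : ℤ) : T.t d ∈ wordGrading (k := k) gen deg d := by
    obtain ⟨m, rfl | rfl⟩ := d.eq_nat_or_neg
    · have := SetLike.pow_mem_graded m hx
      rw [t_natCast]
      convert this using 1
      simp
    · have := SetLike.pow_mem_graded m hy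
      rw [t_neg_natCast]
      convert this using 1
      simp
  have hzt (d : ℤ) (p : k[X]) : aeval T.z p * T.t d ∈ wordGrading (k := k) gen deg d := by
    have h := SetLike.GradedMul.mul_mem (hz' p) (ht d)
    rwa [zero_add] at h
  have hgt (g : γ) (d : ℤ) : ∃ q : k[X], T.t d * gen g = aeval T.z q * T.t (d + deg g) := by
    obtain ⟨hd, q, hq⟩ := hg g
    rw [hq, ← mul_assoc, t_aeval, mul_assoc]
    have key : ∃ q' : k[X], T.t d * T.t (deg g) = aeval T.z q' * T.t (d + deg g) := by
      rcases hd with h | h | h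
      · exact ⟨1, by simp [h]⟩
      · rw [h, t_one]; exact T.t_mul_x d
      · rw [h, t_neg_one]; exact T.t_mul_y d
    obtain ⟨q', hq'⟩ := key
    exact ⟨tr k (n * d) q * q', by rw [hq', map_mul, mul_assoc]⟩
  have hword (w : List γ) : ∃ q : k[X], (w.map gen).prod = aeval T.z q * T.t (w.map deg).sum := by
    induction w using List.reverseRecOn with
    | nil => exact ⟨1, by simp⟩
    | append_singleton w g ih =>
      obtain ⟨q, hq⟩ := ih
      obtain ⟨q', hq'⟩ := hgt g (w.map deg).sum
      refine ⟨q * q', ?_⟩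
      simp only [List.map_append, List.map_cons, List.map_nil, List.prod_append, List.prod_singleton,
        List.sum_append, List.sum_singleton]
      rw [hq, mul_assoc, hq', map_mul, mul_assoc]
  -- Every element of degree `d` is a polynomial in `z` times `t d`. The polynomial is unique
  -- because the operator representation multiplies it by the nonzero `wPoly f n d`.
  have hspan {d : ℤ} {r : R} (hr : r ∈ wordGrading (k := k) gen deg d) :
      ∃ q : k[X], r = aeval T.z q * T.t d := by
    refine Submodule.span_induction ?_ ⟨0, by simp⟩ ?_ ?_ hr
    · rintro _ ⟨w, rfl, rfl⟩
      exact hword w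
    · rintro _ _ _ _ ⟨p, rfl⟩ ⟨q, rfl⟩
      exact ⟨p + q, by rw [map_add, add_mul]⟩
    · rintro c _ _ ⟨p, rfl⟩
      exact ⟨c • p, by rw [map_smul, smul_mul_assoc]⟩
  have hrep (p : k[X]) (d : ℤ) : T.rep (aeval T.z p * T.t d) = mon n (p * wPoly f n d) d := by
    rw [map_mul, rep_aeval, rep_t, opZ_mul_mon]
  have hne (d : ℤ) : wPoly f n d ≠ 0 := wPoly_ne_zero hf n d
  have htop : ⨆ d, wordGrading (k := k) gen deg d = ⊤ := by
    rw [eq_top_iff, ← Algebra.top_toSubmodule, ← hgen, Algebra.adjoin_eq_span, Submodule.span_le]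
    intro r hr
    obtain ⟨l, hl, rfl⟩ := Submonoid.exists_list_of_mem_closure hr
    obtain ⟨w, rfl⟩ : ∃ w : List γ, w.map gen = l := by
      rw [← Set.mem_range, Set.range_list_map]
      exact hl
    exact Submodule.mem_iSup_of_mem (w.map deg).sum (Submodule.subset_span ⟨w, rfl, rfl⟩)
  { sym d := (symbol d).comp T.rep.toLinearMap
    sym_of_ne := by
      intro d e r hr h
      obtain ⟨q, rfl⟩ := hspan hr
      rw [LinearMap.comp_apply, AlgHom.toLinearMap_apply, hrep, symbol_mon_of_ne _ _ h]
    eq_zero := by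
      intro d r hr h
      obtain ⟨q, rfl⟩ := hspan hr
      rw [LinearMap.comp_apply, AlgHom.toLinearMap_apply, hrep, symbol_mon] at h
      rw [(mul_eq_zero.1 h).resolve_right (hne d), map_zero, zero_mul]
    dvd := by
      intro d r
      have hr : r ∈ ⨆ d, wordGrading (k := k) gen deg d := by rw [htop]; trivial
      induction hr using Submodule.iSup_induction' with
      | mem e r hr =>
        obtain ⟨q, rfl⟩ := hspan hr
        rw [LinearMap.comp_apply, AlgHom.toLinearMap_apply, hrep]
        by_cases h : e = d
        · subst h
          rw [symbol_mon]
          exact dvd_mul_left _ _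
        · rw [symbol_mon_of_ne _ _ h]
          exact dvd_zero _
      | zero => rw [map_zero]; exact dvd_zero _
      | add r s _ _ hr hs => rw [map_add]; exact dvd_add hr hs
    exists_sym := by
      intro d p
      refine ⟨_, hzt d p, ?_⟩
      rw [LinearMap.comp_apply, AlgHom.toLinearMap_apply, hrep, symbol_mon, mul_comm]
    sym_one := by
      rw [LinearMap.comp_apply, AlgHom.toLinearMap_apply, map_one, ← map_one (opZ n), opZ_apply,
        symbol_mon]
    sym_mul := by
      intro d e r s hr hs
      obtain ⟨p, rfl⟩ := hspan hr
      obtain ⟨q, rfl⟩ := hspan hs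
      simp only [LinearMap.comp_apply, AlgHom.toLinearMap_apply]
      rw [map_mul, hrep, hrep, mon_mul, symbol_mon, symbol_mon, symbol_mon]
    iSup_eq_top := htop }

end GWATriple

end Symbol

end

end GrWeyl

namespace GrWeyl

noncomputable section

open Polynomial (X C aeval)
open scoped Polynomial symmDiff

/-! ## The coefficients attached to an orbit -/

section OrbitPoly

variable (k : Type u) [Field k]

open Classical in
/-- The coefficient in degree `d` attached to the orbit of `(J, n)`. -/
def aPoly (J : Finset ℤ) (n : ℤ) (d : ℤ) : k[X] :=
  fPoly k ((Orbit.baseDiff J n d).filter (· ∈ Orbit.base J n))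

variable {k} {J : Finset ℤ} {n : ℤ}

lemma aPoly_ne_zero (J : Finset ℤ) (n d : ℤ) : aPoly k J n d ≠ 0 := fPoly_ne_zero _

lemma aPoly_zero (hn : 1 ≤ n) : aPoly k J n 0 = 1 := by
  classical
  have : (Orbit.baseDiff J n 0).filter (· ∈ Orbit.base J n) = ∅ := by
    ext m
    simp [Orbit.mem_baseDiff hn]
  rw [aPoly, this, fPoly_empty]

/-- Write `B` for the base set. The linear factors of `aPoly k J n d` are indexed by `B \ (B + n
d)`, so the cocycle becomes the coboundary of these polynomials; this is seen separately for each
integer. -/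
lemma cc_mul_aPoly (hn : 1 ≤ n) (d e : ℤ) :
    cc k ∅ ((Orbit.ofSet J n hn).K d) ((Orbit.ofSet J n hn).K (d + e)) * aPoly k J n (d + e) =
      aPoly k J n d * tr k (n * d) (aPoly k J n e) := by
  classical
  have h (m : ℤ) : m - n * (d + e) = m - n * d - n * e := by ring
  simp only [aPoly, cc, tr_fPoly]
  apply fPoly_mul_fPoly <;> ext m <;>
    simp only [Finset.mem_union, Finset.mem_inter, Finset.mem_symmDiff, Orbit.mem_ofSet,
      Finset.mem_filter, Orbit.mem_baseDiff hn, mem_translate, h, Finset.notMem_empty] <;> tauto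

/-- Membership depends only on the block `m / n` and on whether the residue lies in `J`. The set
identities below thereby reduce to a few cases. -/
lemma Orbit.mem_base_iff (hn : 1 ≤ n) {m : ℤ} :
    m ∈ base J n ↔ 0 ≤ m / n ∧ (m / n = 0 ∨ m % n ∉ J) := by
  rw [mem_base, Int.ediv_nonneg_iff_of_pos (by omega)]
  have h := Int.emod_add_mul_ediv m n
  have h1 := Int.emod_nonneg m (b := n) (by omega)
  have h2 := Int.emod_lt_of_pos m (b := n) (by omega)
  refine and_congr_right fun h0 => or_congr_left ?_
  constructor
  · intro h3; exact Int.ediv_eq_zero_of_lt h0 h3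
  · intro h3; rw [h3] at h; omega

lemma mem_iff_ediv (hJ : J ⊆ Finset.Ico 0 n) {m : ℤ} :
    m ∈ J ↔ m / n = 0 ∧ m % n ∈ J := by
  have h := Int.emod_add_mul_ediv m n
  constructor
  · intro hm
    obtain ⟨h0, h1⟩ := Finset.mem_Ico.1 (hJ hm)
    refine ⟨Int.ediv_eq_zero_of_lt h0 h1, ?_⟩
    rwa [Int.emod_eq_of_lt h0 h1]
  · rintro ⟨h0, h1⟩
    rw [h0] at h
    have : m % n = m := by omega
    rwa [this] at h1

lemma mem_Ico_iff_ediv (hn : 1 ≤ n) {m : ℤ} : m ∈ Finset.Ico 0 n ↔ m / n = 0 := by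
  rw [mem_iff_ediv subset_rfl, Finset.mem_Ico, and_iff_left_iff_imp]
  exact fun _ => ⟨Int.emod_nonneg m (by omega), Int.emod_lt_of_pos m (by omega)⟩

lemma sub_mul_ediv (hn : 1 ≤ n) (m i : ℤ) : (m - n * i) / n = m / n - i := by
  rw [sub_eq_add_neg, ← mul_neg, Int.add_mul_ediv_left _ _ (by omega), sub_eq_add_neg]

/-- For a base point `m`, the integer `m - n * d` lies beyond the first block, so it leaves the base
set exactly when its residue is in `J`. A base point with such a residue lies in the first block,
hence in `J`. -/
lemma aPoly_of_neg (hn : 1 ≤ n) (hJ : J ⊆ Finset.Ico 0 n) {d : ℤ} (hd : d < 0) :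
    aPoly k J n d = fPoly k J := by
  classical
  rw [aPoly]
  congr 1
  ext m
  have h : (m - n * d) % n = m % n := by simp
  rw [Finset.mem_filter, Orbit.mem_baseDiff hn, mem_iff_ediv hJ, Orbit.mem_base_iff hn,
    Orbit.mem_base_iff hn, h, sub_mul_ediv hn]
  generalize m / n = q
  by_cases hr : m % n ∈ J <;> simp only [hr, not_true, not_false_iff, or_false, or_true, and_true,
    and_false] <;> grind

/-- The new factors are the base points of block `d`, whose residues avoid `J`. The bound on `d`
excludes block 0, which is full and also contributes `f_J`. -/
lemma aPoly_succ (hn : 1 ≤ n) (hJ : J ⊆ Finset.Ico 0 n) {d : ℤ} (hd : 1 ≤ d) :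
    aPoly k J n (d + 1) = aPoly k J n d * tr k (n * d) (fPoly k (Finset.Ico 0 n \ J)) := by
  classical
  simp only [aPoly, tr_fPoly]
  -- The factor `1` is the polynomial of the empty set; with it, both sides have the shape compared
  -- by `fPoly_mul_fPoly`.
  rw [← mul_one (fPoly k (Finset.filter _ (Orbit.baseDiff J n (d + 1)))), ← fPoly_empty]
  have h (m i : ℤ) : (m - n * i) % n = m % n := by simp
  have hm (m : ℤ) : m - n * d ∈ J ↔ m / n - d = 0 ∧ m % n ∈ J := by
    rw [mem_iff_ediv hJ, h, sub_mul_ediv hn]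
  apply fPoly_mul_fPoly <;> ext m <;>
    simp only [Finset.mem_union, Finset.mem_inter, Finset.mem_filter, Orbit.mem_baseDiff hn,
      mem_translate, Finset.notMem_empty, Finset.mem_sdiff, mem_Ico_iff_ediv hn, hm,
      Orbit.mem_base_iff hn, h, sub_mul_ediv hn] <;>
    generalize m / n = q <;>
    by_cases hr : m % n ∈ J <;> simp only [hr, not_true, not_false_iff, or_false, or_true,
      and_true, and_false] <;> grind

lemma aPoly_one (hn : 1 ≤ n) (hJ : J ⊆ Finset.Ico 0 n) :
    aPoly k J n 1 = fPoly k J * fPoly k (Finset.Ico 0 n \ J) := by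
  classical
  simp only [aPoly]
  rw [← mul_one (fPoly k (Finset.filter _ (Orbit.baseDiff J n 1))), ← fPoly_empty]
  have h (m i : ℤ) : (m - n * i) % n = m % n := by simp
  have hm (m : ℤ) : m ∈ J ↔ m / n = 0 ∧ m % n ∈ J := mem_iff_ediv hJ
  apply fPoly_mul_fPoly <;> ext m <;>
    simp only [Finset.mem_union, Finset.mem_inter, Finset.mem_filter, Orbit.mem_baseDiff hn,
      Finset.notMem_empty, Finset.mem_sdiff, mem_Ico_iff_ediv hn,
      Orbit.mem_base_iff hn, h, sub_mul_ediv hn] <;>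
    rw [hm m] <;>
    generalize m / n = q <;>
    by_cases hr : m % n ∈ J <;> simp only [hr, not_true, not_false_iff, or_false, or_true,
      and_true, and_false] <;> grind

/-- These are the coefficients of `f_J W`. Degree 0 is excluded because there `S(J, n)` contains all
of `k[z]`. -/
lemma aPoly_eq (hn : 1 ≤ n) (hJ : J ⊆ Finset.Ico 0 n) {d : ℤ} (hd : d ≠ 0) :
    aPoly k J n d = fPoly k J * wPoly (fPoly k (Finset.Ico 0 n \ J)) n d := by
  obtain h | h : d < 0 ∨ 1 ≤ d := by omega
  · rw [aPoly_of_neg hn hJ h, wPoly_of_nonpos _ _ h.le, mul_one]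
  · induction d, h using Int.leInduction with
    | base =>
      rw [aPoly_one hn hJ]
      simp [wPoly]
    | succ d hd' ih =>
      obtain ⟨m, rfl⟩ := Int.eq_ofNat_of_zero_le (show 0 ≤ d by omega)
      rw [aPoly_succ hn hJ hd', ih (by omega), wPoly_natCast_succ, mul_assoc]

/-- The chart of a realization with the coefficients attached to an orbit. -/
def SymbolMap.chartOfSet {R : Type u} [Ring R] [Algebra k R] {𝒜 : ℤ → Submodule k R}
    [SetLike.GradedMonoid 𝒜] (hn : 1 ≤ n) (σ : SymbolMap n (aPoly k J n) 𝒜) :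
    Chart (Orbit.ofSet J n hn) 𝒜 :=
  σ.chart _ rfl (aPoly_ne_zero J n) (cc_mul_aPoly hn) (aPoly_zero hn)

end OrbitPoly

/-! ## Generators of quotients of free algebras -/

lemma adjoin_range_mkAlgHom {k : Type u} [Field k] {γ : Type}
    (r : FreeAlgebra k γ → FreeAlgebra k γ → Prop) :
    Algebra.adjoin k (Set.range fun g => RingQuot.mkAlgHom k r (FreeAlgebra.ι k g)) = ⊤ := by
  have h : (Set.range fun g => RingQuot.mkAlgHom k r (FreeAlgebra.ι k g)) =
      RingQuot.mkAlgHom k r '' Set.range (FreeAlgebra.ι k) := by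
    rw [← Set.range_comp]; rfl
  rw [h, ← AlgHom.map_adjoin, FreeAlgebra.adjoin_range_ι, Algebra.map_top, AlgHom.range_eq_top]
  exact RingQuot.mkAlgHom_surjective k r

lemma gen_mem_wordGrading {k R : Type u} [Field k] [Ring R] [Algebra k R] {γ : Type} (gen : γ → R)
    (deg : γ → ℤ) (g : γ) : gen g ∈ wordGrading (k := k) gen deg (deg g) :=
  Submodule.subset_span ⟨[g], by simp, by simp⟩

/-! ## The Weyl algebra -/

namespace Weyl

variable (k : Type u) [Field k]

lemma comm : gen k .x * gen k .y - gen k .y * gen k .x = 1 := by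
  have h := RingQuot.mkAlgHom_rel k (WeylRel.comm (k := k))
  simp only [map_sub, map_mul, map_one] at h
  exact h

/-- The action of the Weyl algebra by skew Laurent operators. -/
def rep : Weyl k →ₐ[k] Module.End k (OpSpace k) :=
  RingQuot.liftAlgHom k ⟨FreeAlgebra.lift k fun
    | .x => mon 1 X 1
    | .y => mon 1 1 (-1), by
    rintro _ _ ⟨⟩
    simp only [map_sub, map_mul, FreeAlgebra.lift_ι_apply, map_one, mon_mul]
    have : mon 1 (1 : k[X]) 0 = 1 := map_one (opZ 1)
    rw [show (1 : ℤ) + -1 = 0 by rfl, show (-1 : ℤ) + 1 = 0 by rfl, ← mon_sub, ← this]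
    congr 1
    simp [tr_X]⟩

lemma rep_gen (g : WeylGen) : rep k (gen k g) = match g with
    | .x => mon 1 X 1
    | .y => mon 1 1 (-1) := by
  rw [rep, gen, RingQuot.liftAlgHom_mkAlgHom_apply, FreeAlgebra.lift_ι_apply]

/-- The Weyl algebra as a generalized Weyl algebra. -/
def triple : GWATriple (Weyl k) (X : k[X]) 1 where
  x := gen k .x
  y := gen k .y
  z := gen k .x * gen k .y
  xz := by
    have h := comm k
    rw [sub_eq_iff_eq_add] at h
    rw [Int.cast_one, map_one]
    calc gen k .x * (gen k .x * gen k .y) = gen k .x * (1 + gen k .y * gen k .x) := by rw [h]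
      _ = _ := by noncomm_ring
  yz := by
    have h := comm k
    rw [sub_eq_iff_eq_add] at h
    have h' : gen k .x * gen k .y - 1 = gen k .y * gen k .x := by rw [h, add_sub_cancel_left]
    rw [Int.cast_one, map_one, h', mul_assoc]
  xy := by simp
  yx := by
    simp [tr_X, ← comm k]
  rep := rep k
  rep_x := rep_gen k .x
  rep_y := rep_gen k .y
  rep_z := by rw [map_mul, rep_gen, rep_gen, mon_mul]; simp

lemma z_mem : gen k .x * gen k .y ∈ grading k 0 := by
  have h := SetLike.GradedMul.mul_mem (gen_mem_wordGrading (k := k) (gen k) deg .x)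
    (gen_mem_wordGrading (k := k) (gen k) deg .y)
  have e : deg .x + deg .y = 0 := rfl
  rwa [e] at h

/-- The realization of the Weyl algebra by skew Laurent polynomials. -/
def symbolMap : SymbolMap 1 (wPoly (X : k[X]) 1) (grading k) :=
  (triple k).symbolMap Polynomial.X_ne_zero (adjoin_range_mkAlgHom _)
    (gen_mem_wordGrading (gen k) deg .x) (gen_mem_wordGrading (gen k) deg .y)
    (z_mem k)
    (by
      rintro (_ | _)
      · exact ⟨.inr (.inl rfl), 1, by
          rw [map_one, one_mul]
          exact (triple k).t_one.symm⟩
      · exact ⟨.inr (.inr rfl), 1, by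
          rw [map_one, one_mul]
          exact (triple k).t_neg_one.symm⟩)

lemma wPoly_eq_aPoly : wPoly (X : k[X]) 1 = aPoly k ∅ 1 := by
  ext1 d
  by_cases hd : d = 0
  · rw [hd, aPoly_zero le_rfl, wPoly_of_nonpos _ _ le_rfl]
  · rw [aPoly_eq le_rfl (Finset.empty_subset _) hd, fPoly_empty, one_mul]
    congr 1
    rw [Finset.sdiff_empty, show Finset.Ico (0 : ℤ) 1 = {0} from rfl, fPoly_singleton]
    simp

/-- The orbit of the Weyl algebra. -/
abbrev orbit : Orbit := Orbit.ofSet ∅ 1 le_rfl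

/-- The chart of the Weyl algebra. -/
def chart : Chart orbit (grading k) :=
  SymbolMap.chartOfSet le_rfl (wPoly_eq_aPoly k ▸ symbolMap k)

end Weyl

/-! ## Veronese algebras -/

namespace Chart

variable {k R : Type u} [Field k] [Ring R] [Algebra k R]

lemma coord_mul_of_eq {o : Orbit} {𝒜 : ℤ → Submodule k R} [SetLike.GradedMonoid 𝒜] (χ : Chart o 𝒜)
    {d e f : ℤ} (h : d + e = f) (r : 𝒜 d) (s : 𝒜 e) (t : 𝒜 f) (ht : (t : R) = r * s) :
    χ.coord f t = cc k ∅ (o.K d) (o.K f) * (χ.coord d r * tr k (o.step * d) (χ.coord e s)) := by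
  subst h
  rw [← χ.coord_mul]
  congr 1
  exact Subtype.ext ht

lemma coord_eq_one {o : Orbit} {𝒜 : ℤ → Submodule k R} [SetLike.GradedMonoid 𝒜] (χ : Chart o 𝒜)
    {d : ℤ} (h : d = 0) (t : 𝒜 d) (ht : (t : R) = 1) : χ.coord d t = 1 := by
  subst h
  rw [← χ.coord_one]
  congr 1
  exact Subtype.ext ht

/-- For empty `J` the base set consists of the nonnegative integers whatever `n` is, so the orbit is
a subsequence of the one for `n = 1`. -/
lemma ofSet_empty_K {n : ℤ} (hn : 1 ≤ n) (d : ℤ) :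
    (Orbit.ofSet ∅ n hn).K d = (Orbit.ofSet ∅ 1 le_rfl).K (n * d) := by
  ext m
  simp [Orbit.mem_ofSet, Orbit.mem_base]

/-- The pieces of a Veronese algebra. -/
def veroneseEquiv (𝒜 : ℤ → Submodule k R) [SetLike.GradedMonoid 𝒜] (n d : ℤ) :
    veroneseGrading 𝒜 n d ≃ₗ[k] 𝒜 (n * d) where
  toFun r := ⟨r.1.1, r.2⟩
  map_add' _ _ := rfl
  map_smul' _ _ := rfl
  invFun r := ⟨⟨r, Submodule.mem_iSup_of_mem (p := fun i => 𝒜 (n * i)) d r.2⟩, r.2⟩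
  left_inv _ := rfl
  right_inv _ := rfl

/-- The chart of a Veronese algebra. -/
def ofVeronese {𝒜 : ℤ → Submodule k R} [SetLike.GradedMonoid 𝒜]
    (χ : Chart (Orbit.ofSet ∅ 1 le_rfl) 𝒜) (n : ℤ) (hn : 1 ≤ n) :
    Chart (Orbit.ofSet ∅ n hn) (veroneseGrading 𝒜 n) where
  coord d := (veroneseEquiv 𝒜 n d).trans (χ.coord (n * d))
  coord_one := χ.coord_eq_one (mul_zero n) _ rfl
  coord_mul {d e} r s := by
    rw [LinearEquiv.trans_apply, χ.coord_mul_of_eq (mul_add n d e).symm (veroneseEquiv 𝒜 n d r)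
      (veroneseEquiv 𝒜 n e s) (veroneseEquiv 𝒜 n (d + e) _) rfl, ofSet_empty_K hn,
      ofSet_empty_K hn, Orbit.ofSet_step, Orbit.ofSet_step, one_mul]
    rfl

end Chart

/-! ## The localized Weyl algebra -/

namespace WeylLoc

variable (k : Type u) [Field k]

lemma comm : gen k .x * gen k .y - gen k .y * gen k .x = 1 := by
  have h := RingQuot.mkAlgHom_rel k (LocRel.comm (k := k))
  simp only [map_sub, map_mul, map_one] at h
  exact h

lemma mul_inv : gen k .y * gen k .yinv = 1 := by
  have h := RingQuot.mkAlgHom_rel k (LocRel.mul_inv (k := k))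
  simp only [map_mul, map_one] at h
  exact h

lemma inv_mul : gen k .yinv * gen k .y = 1 := by
  have h := RingQuot.mkAlgHom_rel k (LocRel.inv_mul (k := k))
  simp only [map_mul, map_one] at h
  exact h

/-- The action of the localized Weyl algebra by skew Laurent operators. -/
def rep : WeylLoc k →ₐ[k] Module.End k (OpSpace k) :=
  RingQuot.liftAlgHom k ⟨FreeAlgebra.lift k fun
    | .x => mon 1 X 1
    | .y => mon 1 1 (-1)
    | .yinv => mon 1 1 1, by
    have h1 : mon 1 (1 : k[X]) 0 = 1 := map_one (opZ 1)
    rintro _ _ (_ | _ | _) <;>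
      simp only [map_sub, map_mul, FreeAlgebra.lift_ι_apply, map_one, mon_mul]
    · rw [show (1 : ℤ) + -1 = 0 by rfl, show (-1 : ℤ) + 1 = 0 by rfl, ← mon_sub, ← h1]
      congr 1
      simp [tr_X]
    · simpa using h1
    · simpa using h1⟩

lemma rep_gen (g : LocGen) : rep k (gen k g) = match g with
    | .x => mon 1 X 1
    | .y => mon 1 1 (-1)
    | .yinv => mon 1 1 1 := by
  rw [rep, gen, RingQuot.liftAlgHom_mkAlgHom_apply, FreeAlgebra.lift_ι_apply]

lemma mul_y_yinv (r : WeylLoc k) : r * gen k .y * gen k .yinv = r := by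
  rw [mul_assoc, mul_inv, mul_one]

/-- The localized Weyl algebra as a generalized Weyl algebra. -/
def triple : GWATriple (WeylLoc k) (1 : k[X]) 1 where
  x := gen k .yinv
  y := gen k .y
  z := gen k .x * gen k .y
  xz := by
    have h := comm k
    rw [sub_eq_iff_eq_add] at h
    rw [Int.cast_one, map_one, add_mul, mul_y_yinv, one_mul, h, mul_add, ← mul_assoc, inv_mul,
      one_mul, mul_one, add_comm]
  yz := by
    have h := comm k
    rw [sub_eq_iff_eq_add] at h
    have h' : gen k .x * gen k .y - 1 = gen k .y * gen k .x := by rw [h, add_sub_cancel_left]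
    rw [Int.cast_one, map_one, h', mul_assoc]
  xy := by rw [map_one, inv_mul]
  yx := by rw [map_one, map_one, mul_inv]
  rep := rep k
  rep_x := rep_gen k .yinv
  rep_y := rep_gen k .y
  rep_z := by rw [map_mul, rep_gen, rep_gen, mon_mul]; simp

lemma z_mem : gen k .x * gen k .y ∈ grading k 0 := by
  have h := SetLike.GradedMul.mul_mem (gen_mem_wordGrading (k := k) (gen k) deg .x)
    (gen_mem_wordGrading (k := k) (gen k) deg .y)
  have e : deg .x + deg .y = 0 := rfl
  rwa [e] at h

/-- The realization of the localized Weyl algebra by skew Laurent polynomials. -/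
def symbolMap : SymbolMap 1 (wPoly (1 : k[X]) 1) (grading k) :=
  (triple k).symbolMap one_ne_zero (adjoin_range_mkAlgHom _)
    (gen_mem_wordGrading (gen k) deg .yinv) (gen_mem_wordGrading (gen k) deg .y) (z_mem k)
    (by
      rintro (_ | _ | _)
      · refine ⟨.inr (.inl rfl), X, ?_⟩
        change _ = aeval _ X * (triple k).t 1
        rw [Polynomial.aeval_X, (triple k).t_one]
        exact (mul_y_yinv k _).symm
      · exact ⟨.inr (.inr rfl), 1, by
          rw [map_one, one_mul]
          exact (triple k).t_neg_one.symm⟩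
      · exact ⟨.inr (.inl rfl), 1, by
          rw [map_one, one_mul]
          exact (triple k).t_one.symm⟩)

lemma symbolMap_sym (d : ℤ) (r : WeylLoc k) : (symbolMap k).sym d r = symbol d (rep k r) := rfl

lemma wPoly_one (n d : ℤ) : wPoly (1 : k[X]) n d = 1 := by simp [wPoly]

lemma aPoly_eq_X {d : ℤ} (hd : d ≠ 0) : aPoly k {0} 1 d = X := by
  have h : Finset.Ico (0 : ℤ) 1 = {0} := rfl
  rw [aPoly_eq le_rfl (by rw [h]) hd, h, Finset.sdiff_self, fPoly_empty, wPoly_one, mul_one,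
    fPoly_singleton]
  simp

lemma sym_z_mul (d : ℤ) (r : WeylLoc k) :
    (symbolMap k).sym d (gen k .x * gen k .y * r) = X * (symbolMap k).sym d r := by
  rw [symbolMap_sym, map_mul, (show rep k (gen k .x * gen k .y) = opZ 1 X from (triple k).rep_z),
    symbol_opZ_mul, symbolMap_sym]

/-- Since `x = z y⁻¹` with `z = xy`, the right ideals generated by `x` and by `z` coincide. -/
lemma sym_x_mul (d : ℤ) (r : WeylLoc k) :
    (symbolMap k).sym d (gen k .x * r) = X * (symbolMap k).sym d (gen k .yinv * r) := by
  rw [← sym_z_mul, ← mul_assoc, mul_y_yinv]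

lemma sym_algebraMap {d : ℤ} (hd : d ≠ 0) (c : k) :
    (symbolMap k).sym d (algebraMap k _ c) = 0 := by
  rw [Algebra.algebraMap_eq_smul_one]
  exact (symbolMap k).sym_of_ne (Submodule.smul_mem _ c SetLike.GradedOne.one_mem) hd.symm

lemma idealizer_dvd (r : WeylLoc k) (hr : r ∈ idealizer k) (d : ℤ) :
    aPoly k {0} 1 d ∣ (symbolMap k).sym d r := by
  by_cases hd : d = 0
  · rw [hd, aPoly_zero le_rfl]
    exact one_dvd _
  · obtain ⟨c, t, rfl⟩ := hr
    rw [aPoly_eq_X k hd, map_add, sym_algebraMap k hd, zero_add, sym_x_mul]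
    exact dvd_mul_right _ _

lemma x_mul_mem_idealizer (r : WeylLoc k) : gen k .x * r ∈ idealizer k := ⟨0, r, by simp⟩

lemma idealizer_exists (d : ℤ) (p : k[X]) :
    ∃ r ∈ idealizer k, r ∈ grading k d ∧ (symbolMap k).sym d r = aPoly k {0} 1 d * p := by
  have key (d : ℤ) (p : k[X]) : ∃ r ∈ idealizer k, r ∈ grading k d ∧
      (symbolMap k).sym d r = X * p := by
    obtain ⟨r, hr, h⟩ := (symbolMap k).exists_sym d p
    refine ⟨gen k .x * gen k .y * r, ?_, ?_, ?_⟩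
    · rw [mul_assoc]
      exact x_mul_mem_idealizer k _
    · have := SetLike.GradedMul.mul_mem (z_mem k) hr
      rwa [zero_add] at this
    · rw [sym_z_mul, h, wPoly_one, one_mul]
  by_cases hd : d = 0
  · subst hd
    -- In degree 0 the subring is `k + z k[z] = k[z]`: the constant term is split off and the rest
    -- is a multiple of `z`.
    obtain ⟨r, hr, hr', h⟩ := key 0 p.divX
    refine ⟨r + algebraMap k _ (p.coeff 0), add_mem hr (Subalgebra.algebraMap_mem _ _),
      add_mem hr' ?_, ?_⟩
    · rw [Algebra.algebraMap_eq_smul_one]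
      exact Submodule.smul_mem _ _ SetLike.GradedOne.one_mem
    · rw [map_add, h, aPoly_zero le_rfl, one_mul, Algebra.algebraMap_eq_smul_one, map_smul,
        (symbolMap k).sym_one, ← Algebra.algebraMap_eq_smul_one]
      exact p.X_mul_divX_add
  · rw [aPoly_eq_X k hd]
    exact key d p

/-- The chart of the idealizer. -/
def idealizerChart : Chart (R := idealizer k) (Orbit.ofSet {0} 1 le_rfl) (idealizerGrading k) :=
  SymbolMap.chartOfSet le_rfl
    ((symbolMap k).subalgebra (idealizer k) (aPoly k {0} 1) (idealizer_dvd k) (idealizer_exists k))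

lemma mem_idealizer_iff [CharZero k] (a : WeylLoc k) :
    a ∈ idealizer k ↔ ∀ t : WeylLoc k, ∃ u : WeylLoc k, a * (gen k .x * t) = gen k .x * u := by
  constructor
  · rintro ⟨c, s, rfl⟩ t
    refine ⟨algebraMap k _ c * t + s * (gen k .x * t), ?_⟩
    have h := Algebra.commutes c (gen k .x)
    simp only [add_mul, mul_add, ← mul_assoc, h]
  · intro h
    -- The single test `t = y` suffices: it says that `a * z` is a left multiple of `x`, hence of
    -- `z`.
    obtain ⟨u, hu⟩ := h (gen k .y)
    obtain ⟨c, hc, hs, hsym⟩ := (symbolMap k).exists_sum a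
    have hmem (d : ℤ) : c d ∈ idealizer k := by
      refine (symbolMap k).mem_of_dvd (idealizer_exists k) (hc d) ?_
      by_cases hd : d = 0
      · rw [hd, aPoly_zero le_rfl]
        exact one_dvd _
      · rw [aPoly_eq_X k hd]
        have h1 : (symbolMap k).sym d (a * (gen k .x * gen k .y)) =
            (symbolMap k).sym d (c d) * tr k (1 * d) X := by
          have hz : (symbolMap k).sym 0 (gen k .x * gen k .y) = X := by
            rw [symbolMap_sym, (show rep k (gen k .x * gen k .y) = mon 1 X 0 from
              (triple k).rep_z), symbol_mon]
          have hmul (e : ℤ) : c e * (gen k .x * gen k .y) ∈ grading k e := by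
            have := SetLike.GradedMul.mul_mem (hc e) (z_mem k)
            rwa [add_zero] at this
          rw [hs, Finset.sum_mul, map_sum, Finset.sum_eq_single d]
          · have := (symbolMap k).sym_mul (hc d) (z_mem k)
            rwa [add_zero, hz] at this
          · exact fun e _ he => (symbolMap k).sym_of_ne (hmul e) he
          · intro hd'
            rw [Finsupp.notMem_support_iff.1 hd', zero_mul, map_zero]
        rw [hu, sym_x_mul, tr_X, one_mul] at h1
        have hX : (X : k[X]) ∣ (symbolMap k).sym d (c d) * (X + C (d : k)) := ⟨_, h1.symm⟩
        -- Modulo `X` the factor `X + d` is the constant `d`, which is nonzero for `d ≠ 0` in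
        -- characteristic 0.
        refine (Polynomial.prime_X.dvd_or_dvd hX).resolve_right fun h2 => hd ?_
        have h3 := (dvd_add_right (dvd_refl X)).1 h2
        rw [Polynomial.X_dvd_iff, Polynomial.coeff_C_zero] at h3
        exact_mod_cast h3
    rw [hs]
    exact sum_mem fun d _ => hmem d

end WeylLoc

/-! ## Generalized Weyl algebras -/

namespace GWA

variable (k : Type u) [Field k] (f : k[X]) (n : ℕ)

lemma Xz : gen k f n .X * gen k f n .z - gen k f n .z * gen k f n .X =
    (n : k) • gen k f n .X := by
  have h := RingQuot.mkAlgHom_rel k (GWARel.Xz (f := f) (n := n))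
  simp only [map_sub, map_mul, map_smul] at h
  exact h

lemma Yz : gen k f n .Y * gen k f n .z - gen k f n .z * gen k f n .Y =
    -((n : k) • gen k f n .Y) := by
  have h := RingQuot.mkAlgHom_rel k (GWARel.Yz (f := f) (n := n))
  simp only [map_sub, map_mul, map_smul, map_neg] at h
  exact h

lemma XY : gen k f n .X * gen k f n .Y = aeval (gen k f n .z) f := by
  have h := RingQuot.mkAlgHom_rel k (GWARel.XY (f := f) (n := n))
  rw [map_mul, ← Polynomial.aeval_algHom_apply] at h
  exact h

lemma YX : gen k f n .Y * gen k f n .X =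
    aeval (gen k f n .z - algebraMap k _ (n : k)) f := by
  have h := RingQuot.mkAlgHom_rel k (GWARel.YX (f := f) (n := n))
  rw [map_mul, ← Polynomial.aeval_algHom_apply, map_sub, AlgHom.commutes] at h
  exact h

lemma aeval_sub_eq_tr {R : Type u} [Ring R] [Algebra k R] (z : R) :
    aeval (z - algebraMap k _ (n : k)) f = aeval z (tr k (-n) f) := by
  rw [tr_apply, Polynomial.taylor_apply, Polynomial.aeval_comp]
  congr 1
  simp [sub_eq_add_neg]

/-- The action of a generalized Weyl algebra by skew Laurent operators. -/
def rep : GWA k f n →ₐ[k] Module.End k (OpSpace k) :=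
  RingQuot.liftAlgHom k ⟨FreeAlgebra.lift k fun
    | .X => mon n f 1
    | .Y => mon n 1 (-1)
    | .z => mon n X 0, by
    have hz (p : k[X]) : aeval (mon (n : ℤ) (X : k[X]) 0) p = mon n p 0 := by
      rw [← opZ_apply, Polynomial.aeval_algHom_apply, Polynomial.aeval_X_left_apply, opZ_apply]
    rintro _ _ (_ | _ | _ | _) <;>
      simp only [map_sub, map_mul, map_smul, map_neg, map_one, FreeAlgebra.lift_ι_apply, mon_mul,
        ← Polynomial.aeval_algHom_apply, aeval_sub_eq_tr, hz]
    · rw [zero_add, add_zero, ← mon_sub, ← mon_smul]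
      congr 1
      rw [tr_X, Algebra.smul_def]
      simp
      ring
    · rw [zero_add, add_zero, ← mon_sub, eq_neg_iff_add_eq_zero, ← mon_smul, ← mon_add,
        ← mon_zero n (-1)]
      congr 1
      rw [tr_X, Algebra.smul_def]
      simp
    · simp
    · simp⟩

lemma rep_gen (g : GWAGen) : rep k f n (gen k f n g) = match g with
    | .X => mon n f 1
    | .Y => mon n 1 (-1)
    | .z => mon n X 0 := by
  rw [rep, gen, RingQuot.liftAlgHom_mkAlgHom_apply, FreeAlgebra.lift_ι_apply]

/-- A generalized Weyl algebra with its generators. -/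
def triple : GWATriple (GWA k f n) f n where
  x := gen k f n .X
  y := gen k f n .Y
  z := gen k f n .z
  xz := by
    have h := Xz k f n
    rw [sub_eq_iff_eq_add] at h
    rw [h, add_mul, Algebra.smul_def, add_comm]
    simp
  yz := by
    have h := Yz k f n
    rw [sub_eq_iff_eq_add] at h
    rw [h, sub_mul, Algebra.smul_def, neg_add_eq_sub]
    simp
  xy := XY k f n
  yx := by rw [YX, aeval_sub_eq_tr]
  rep := rep k f n
  rep_x := rep_gen k f n .X
  rep_y := rep_gen k f n .Y
  rep_z := rep_gen k f n .z

variable {f} in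
/-- The realization of a generalized Weyl algebra by skew Laurent polynomials. -/
def symbolMap (hf : f ≠ 0) : SymbolMap n (wPoly f n) (grading k f n) :=
  (triple k f n).symbolMap hf (adjoin_range_mkAlgHom _)
    (gen_mem_wordGrading (gen k f n) deg .X) (gen_mem_wordGrading (gen k f n) deg .Y)
    (gen_mem_wordGrading (gen k f n) deg .z)
    (by
      rintro (_ | _ | _)
      · exact ⟨.inr (.inl rfl), 1, by
          rw [map_one, one_mul]
          exact (triple k f n).t_one.symm⟩
      · exact ⟨.inr (.inr rfl), 1, by
          rw [map_one, one_mul]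
          exact (triple k f n).t_neg_one.symm⟩
      · refine ⟨.inl rfl, X, ?_⟩
        change _ = aeval _ X * (triple k f n).t 0
        rw [Polynomial.aeval_X, (triple k f n).t_zero, mul_one]
        rfl)

variable {f} in
lemma symbolMap_sym (hf : f ≠ 0) (d : ℤ) (r : GWA k f n) :
    (symbolMap k n hf).sym d r = symbol d (rep k f n r) := rfl

end GWA

/-! ### The rings `S(J, n)` -/

namespace SRing

variable (k : Type u) [Field k] (J : Finset ℤ) (n : ℕ)

/-- The realization of the ring `W`. -/
abbrev wSymbolMap : SymbolMap n (wPoly (fPoly k (Finset.Ico 0 (n : ℤ) \ J)) n)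
    (GWA.grading k (fPoly k (Finset.Ico 0 (n : ℤ) \ J)) n) :=
  GWA.symbolMap k n (fPoly_ne_zero _)

lemma rep_evalZ (p : k[X]) : GWA.rep k _ n (evalZ k J n p) = opZ n p :=
  (GWA.triple k _ n).rep_aeval p

lemma evalZ_mem (p : k[X]) : evalZ k J n p ∈ GWA.grading k _ n 0 :=
  aeval_mem_zero (gen_mem_wordGrading (GWA.gen k _ n) GWA.deg .z) p

lemma sym_evalZ_mul (d : ℤ) (p : k[X]) (r : WRing k J n) :
    (wSymbolMap k J n).sym d (evalZ k J n p * r) = p * (wSymbolMap k J n).sym d r := by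
  rw [GWA.symbolMap_sym, map_mul, rep_evalZ, symbol_opZ_mul, GWA.symbolMap_sym]

/-- The summand `k[z]` lives in degree 0, so in the other degrees only `f_J W` contributes. -/
lemma dvd_sym (hn : 1 ≤ (n : ℤ)) (hJ : J ⊆ Finset.Ico 0 (n : ℤ)) (r : WRing k J n)
    (hr : r ∈ SRing k J n) (d : ℤ) : aPoly k J n d ∣ (wSymbolMap k J n).sym d r := by
  by_cases hd : d = 0
  · rw [hd, aPoly_zero hn]
    exact one_dvd _
  · obtain ⟨p, w, rfl⟩ := hr
    rw [aPoly_eq hn hJ hd, map_add, (wSymbolMap k J n).sym_of_ne (evalZ_mem k J n p) (Ne.symm hd),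
      zero_add, sym_evalZ_mul]
    exact mul_dvd_mul_left _ ((wSymbolMap k J n).dvd d w)

lemma exists_sym (hn : 1 ≤ (n : ℤ)) (hJ : J ⊆ Finset.Ico 0 (n : ℤ)) (d : ℤ) (p : k[X]) :
    ∃ r ∈ SRing k J n, r ∈ GWA.grading k _ n d ∧
      (wSymbolMap k J n).sym d r = aPoly k J n d * p := by
  by_cases hd : d = 0
  · subst hd
    refine ⟨evalZ k J n p, ⟨p, 0, by simp⟩, evalZ_mem k J n p, ?_⟩
    rw [aPoly_zero hn, ← mul_one (evalZ k J n p), sym_evalZ_mul, (wSymbolMap k J n).sym_one,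
      mul_one, one_mul]
  · obtain ⟨r, hr, h⟩ := (wSymbolMap k J n).exists_sym d p
    refine ⟨evalZ k J n (fPoly k J) * r, ⟨0, r, by simp⟩, ?_, ?_⟩
    · have := SetLike.GradedMul.mul_mem (evalZ_mem k J n (fPoly k J)) hr
      rwa [zero_add] at this
    · rw [sym_evalZ_mul, h, aPoly_eq hn hJ hd, mul_assoc]

/-- The realization of the ring `S(J, n)`. -/
def symbolMap (hn : 1 ≤ (n : ℤ)) (hJ : J ⊆ Finset.Ico 0 (n : ℤ)) :
    SymbolMap (R := SRing k J n) n (aPoly k J n) (grading k J n) :=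
  (wSymbolMap k J n).subalgebra (SRing k J n) (aPoly k J n) (dvd_sym k J n hn hJ)
    (exists_sym k J n hn hJ)

/-- The chart of the ring `S(J, n)`. -/
def chart (hn : 1 ≤ (n : ℤ)) (hJ : J ⊆ Finset.Ico 0 (n : ℤ)) :
    Chart (R := SRing k J n) (Orbit.ofSet J n hn) (grading k J n) := SymbolMap.chartOfSet hn (symbolMap k J n hn hJ)

end SRing

end

end GrWeyl

namespace GrWeyl

noncomputable section

open Polynomial (X C aeval)
open scoped Polynomial symmDiff

/-! ## Functors given by pullbacks -/

lemma cc_mul_cc_self {k : Type u} [Field k] (D E L : Finset ℤ) :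
    cc k D E L * cc k E D L = fPoly k (D ∆ E) := by
  have h := cc_assoc (k := k) D E D L
  rw [cc_left, mul_one, cc_self] at h
  rw [h, mul_comm]

namespace Chart

variable {k R : Type u} [Field k] [Ring R] [Algebra k R] {o : Orbit} {𝒜 : ℤ → Submodule k R}
  [SetLike.GradedMonoid 𝒜] (χ : Chart o 𝒜)

lemma coordAt_mul_of_eq {i d e f n p : ℤ} (hf : d + e = f) (hn : i + d = n) (hp : i + f = p)
    (r : 𝒜 d) (s : 𝒜 e) (t : 𝒜 f) (ht : (t : R) = r * s) :
    χ.coordAt i f t =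
      cc k (o.K i) (o.K n) (o.K p) * (χ.coordAt i d r * χ.coordAt n e s) := by
  subst hf
  rw [← χ.coordAt_mul hn (by omega)]
  congr 1
  exact Subtype.ext ht

lemma evalEquiv_symm_act (M : GrMod 𝒜) {i d n : ℤ} (h : i + d = n) (m : M.X i) (r : 𝒜 d) :
    (χ.evalEquiv M n).symm (M.act h m r) =
      (χ.ind.obj M).act (o.K i) (o.K n) (χ.coordAt i d r) ((χ.evalEquiv M i).symm m) := by
  rw [LinearEquiv.symm_apply_eq, ← χ.kact_coordAt M h, ← χ.kact_res]
  refine Eq.trans ?_ (χ.evalEquiv_kact M i n _ _).symm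
  rw [LinearEquiv.apply_symm_apply]

lemma evalEquiv_symm_app {M N : GrMod 𝒜} (f : M ⟶ N) (i : ℤ) (m : M.X i) :
    (χ.evalEquiv N i).symm (GrMod.app f i m) =
      EMod.app (χ.ind.map f) (o.K i) ((χ.evalEquiv M i).symm m) := by
  rw [LinearEquiv.symm_apply_eq]
  refine Eq.trans ?_ (χ.ind_map_val f (o.K i) _ i).symm
  exact congrArg _ ((χ.evalEquiv M i).apply_symm_apply m).symm

lemma kact_shift (M : GrMod 𝒜) (b : ℤ) {i n : ℤ} (a : k[X]) (m : M.X (i - b)) :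
    χ.kact ((GrMod.shift b).obj M) i n a m =
      χ.kact M (i - b) (n - b) (tr k (o.step * (-b)) a) m := by
  obtain ⟨r, rfl⟩ := (χ.coordAt i (n - i)).surjective a
  have h := χ.coordAt_shift (i := -b) (j := i) r
  rw [← h, show -b + i = i - b by ring, kact_coordAt (h := by omega)]
  exact χ.kact_coordAt ((GrMod.shift b).obj M) (show i + (n - i) = n by omega) m r

lemma K_shift (b n : ℤ) :
    o.K (-b) ∆ translate (o.step * (-b)) (o.K n) = o.K (n - b) := by
  rw [← o.K_add]
  congr 1
  omega

/-- The shift functor as a pullback. -/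
def shiftIso (b : ℤ) :
    χ.ind ⋙ EMod.pull (o.K (-b)) (o.step * (-b)) ⋙ χ.res ≅ GrMod.shift b :=
  NatIso.ofComponents
    (fun M => GrMod.isoMk
      (M := (χ.ind ⋙ EMod.pull (o.K (-b)) (o.step * (-b)) ⋙ χ.res).obj M)
      (N := (GrMod.shift b).obj M)
      (fun n => ((χ.ind.obj M).castEquiv (K_shift b n)).trans (χ.evalEquiv M (n - b)))
      (χ.act_of_kact (M := (χ.ind ⋙ EMod.pull (o.K (-b)) (o.step * (-b)) ⋙ χ.res).obj M)
        (N := (GrMod.shift b).obj M)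
        (f := fun n => (((χ.ind.obj M).castEquiv (K_shift b n)).trans
          (χ.evalEquiv M (n - b))).toLinearMap) fun i n a m => by
        refine Eq.trans ?_ (χ.kact_shift M b a _).symm
        refine Eq.trans ?_ (χ.evalEquiv_kact M (i - b) (n - b) (tr k (o.step * (-b)) a)
          ((χ.ind.obj M).castEquiv (K_shift b i) m))
        change χ.evalEquiv M (n - b) ((χ.ind.obj M).castEquiv (K_shift b n)
          (χ.kact (χ.res.obj ((EMod.pull (o.K (-b)) (o.step * (-b))).obj (χ.ind.obj M))) i n a
            m)) = _
        refine congrArg (χ.evalEquiv M (n - b)) ?_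
        rw [kact_res, kact_res]
        refine ((χ.ind.obj M).act_act_right (K_shift b n) _ _ _).trans ?_
        refine Eq.trans ?_ ((χ.ind.obj M).act_act_left (K_shift b i) _ _ _).symm
        rw [mul_one, one_mul]
        rfl))
    (fun {M N} f => GrMod.hom_ext fun n m => by
      have h := congrArg (χ.evalEquiv N (n - b))
        (EMod.app_act (χ.ind.map f) (D' := o.K (n - b)) (1 : k[X]) m)
      exact h.symm)

/-! ### Functors extended from free modules, as pullbacks -/

section Extend

variable (G : GrMod 𝒜 ⥤ GrMod 𝒜) (S : Finset ℤ)
  (ψ : ∀ i n, (G.obj (GrMod.free i)).X n ≃ₗ[k] k[X])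

/-- The objects to which a functor sends the objects of the orbit. -/
abbrev target (o : Orbit) (S : Finset ℤ) (n : ℤ) : Finset ℤ := S ∆ translate 0 (o.K n)

-- The coordinates `ψ i n` identify `G(R⟨i⟩)` in degree `n` with the morphisms from `K i` to the
-- target object. The two conditions say that the right action is postcomposition and that left
-- multiplications are precomposition.
variable
  (hact : ∀ {i n e q : ℤ} (h : n + e = q) (b : (G.obj (GrMod.free i)).X n) (s : 𝒜 e),
    ψ i q ((G.obj (GrMod.free i)).act h b s) =
      cc k (o.K i) (target o S n) (target o S q) * (ψ i n b * χ.coordAt n e s))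
  (hmap : ∀ {i d p n : ℤ} (h : i + d = p) (r : 𝒜 d) (b : (G.obj (GrMod.free p)).X n),
    ψ i n (GrMod.app (G.map (GrMod.lmul h r)) n b) =
      cc k (o.K i) (o.K p) (target o S n) * (χ.coordAt i d r * ψ p n b))

include hmap in
lemma extendAux (M : GrMod 𝒜) (n : ℤ) (i d p : ℤ) (h : i + d = p) (m : M.X i) (r : 𝒜 d)
    (b : (G.obj (GrMod.free p)).X n) :
    (χ.ind.obj M).act (o.K p) (target o S n) (ψ p n b) ((χ.evalEquiv M p).symm (M.act h m r)) =
    (χ.ind.obj M).act (o.K i) (target o S n) (ψ i n (GrMod.app (G.map (GrMod.lmul h r)) n b))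
      ((χ.evalEquiv M i).symm m) := by
  rw [evalEquiv_symm_act, hmap]
  exact (χ.ind.obj M).act_act _ _ _

/-- The comparison of the tensor product with a pullback. -/
def extendMap (M : GrMod 𝒜) (n : ℤ) :
    GrMod.Tensor G M n →ₗ[k] χ.famSpace M (target o S n) :=
  GrMod.tensorLift G (fun i => (((χ.ind.obj M).act (o.K i) (target o S n)).comp
      (ψ i n).toLinearMap).flip.comp (χ.evalEquiv M i).symm.toLinearMap)
    (fun i d p h m r b => χ.extendAux G S ψ hmap M n i d p h m r b)

lemma extendMap_tmk (M : GrMod 𝒜) (n i : ℤ) (m : M.X i) (b : (G.obj (GrMod.free i)).X n) :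
    χ.extendMap G S ψ hmap M n (GrMod.tmk G M n i m b) =
      (χ.ind.obj M).act (o.K i) (target o S n) (ψ i n b) ((χ.evalEquiv M i).symm m) :=
  GrMod.tensorLift_tmk G _ _ i m b

lemma extendMap_tmk_val (M : GrMod 𝒜) (n i l : ℤ) (m : M.X i) (b : (G.obj (GrMod.free i)).X n) :
    (χ.extendMap G S ψ hmap M n (GrMod.tmk G M n i m b)).1 l =
      χ.kact M i l (cc k (o.K i) (target o S n) (o.K l) * ψ i n b) m := by
  rw [extendMap_tmk]
  refine (χ.ind_act_val M (o.K i) _ _ _ l).trans ?_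
  change χ.kact M l l _ (χ.kact M i l 1 m) = _
  rw [kact_kact, cc_right, one_mul, one_mul]

-- A co-Yoneda argument: tensoring with the morphisms into the target evaluates the module there.
-- The target need not lie in the orbit, so the inverse `m ↦ ∑ m_j ⊗ w_j` uses a partition of unity.
include hmap in
lemma extendMap_bijective [CharZero k] (M : GrMod 𝒜) (n : ℤ) :
    Function.Bijective (χ.extendMap G S ψ hmap M n) := by
  obtain ⟨w, hw⟩ := o.exists_finsupp (k := k) (target o S n)
  let inv : χ.famSpace M (target o S n) →ₗ[k] GrMod.Tensor G M n :=
    ∑ j ∈ w.support, ((GrMod.tmk G M n j).flip ((ψ j n).symm (w j))).comp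
      ((LinearMap.proj j).comp (χ.famSpace M (target o S n)).subtype)
  have hinv (m : χ.famSpace M (target o S n)) : inv m =
      ∑ j ∈ w.support, GrMod.tmk G M n j (m.1 j) ((ψ j n).symm (w j)) := by
    simp [inv]
  have hl : inv.comp (χ.extendMap G S ψ hmap M n) = LinearMap.id := by
    refine GrMod.tensor_ext G fun i m b => ?_
    rw [LinearMap.comp_apply, hinv, LinearMap.id_apply]
    have h (j : ℤ) : GrMod.tmk G M n j
        ((χ.extendMap G S ψ hmap M n (GrMod.tmk G M n i m b)).1 j) ((ψ j n).symm (w j)) =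
        GrMod.tmk G M n i m ((ψ i n).symm (w j * fPoly k (target o S n ∆ o.K j) * ψ i n b)) := by
      rw [extendMap_tmk_val]
      -- The component at `j` is `m` times a ring element, which the tensor relation moves to the
      -- other side.
      obtain ⟨r, hr⟩ := (χ.coordAt i (j - i)).surjective
        (cc k (o.K i) (target o S n) (o.K j) * ψ i n b)
      rw [← hr, χ.kact_coordAt M (show i + (j - i) = j by omega), GrMod.tmk_act]
      congr 1
      rw [LinearEquiv.eq_symm_apply, hmap, hr, LinearEquiv.apply_symm_apply]
      have h := cc_assoc (k := k) (o.K i) (target o S n) (o.K j) (target o S n)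
      rw [cc_self, cc_right, mul_one] at h
      rw [← h]
      ring
    rw [Finset.sum_congr rfl fun j _ => h j, ← map_sum, ← map_sum, ← Finset.sum_mul, hw, one_mul,
      LinearEquiv.symm_apply_apply]
  have hr (m : χ.famSpace M (target o S n)) : χ.extendMap G S ψ hmap M n (inv m) = m := by
    refine Subtype.ext (funext fun l => ?_)
    rw [hinv, map_sum]
    have h (j : ℤ) : (χ.extendMap G S ψ hmap M n
        (GrMod.tmk G M n j (m.1 j) ((ψ j n).symm (w j)))).1 l =
        χ.kact M l l (w j * fPoly k (target o S n ∆ o.K j)) (m.1 l) := by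
      rw [extendMap_tmk_val, LinearEquiv.apply_symm_apply, fam_kact, ← mul_assoc, cc_mul_cc_self,
        mul_comm]
    rw [AddSubmonoidClass.coe_finsetSum, Finset.sum_apply, Finset.sum_congr rfl fun j _ => h j,
      ← LinearMap.sum_apply, ← map_sum, hw]
    exact χ.kact_one M _
  exact ⟨Function.LeftInverse.injective (LinearMap.congr_fun hl), fun m => ⟨_, hr m⟩⟩

include hact in
lemma extendMap_act (M : GrMod 𝒜) (n e q : ℤ) (h : n + e = q) (t : GrMod.Tensor G M n) (s : 𝒜 e) :
    χ.extendMap G S ψ hmap M q (GrMod.tensorAct G M h t s) =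
      (χ.ind.obj M).act (target o S n) (target o S q) (tr k 0 (χ.coordAt n e s))
        (χ.extendMap G S ψ hmap M n t) := by
  refine LinearMap.congr_fun
    (f := (χ.extendMap G S ψ hmap M q).comp ((LinearMap.flip (GrMod.tensorAct G M h)) s))
    (g := ((χ.ind.obj M).act (target o S n) (target o S q) (tr k 0 (χ.coordAt n e s))).comp
      (χ.extendMap G S ψ hmap M n)) (GrMod.tensor_ext G fun i m b => ?_) t
  rw [LinearMap.comp_apply, LinearMap.flip_apply, LinearMap.comp_apply, GrMod.tensorAct_tmk,
    extendMap_tmk, hact, extendMap_tmk, tr_zero]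
  exact ((χ.ind.obj M).act_act _ _ _).symm

lemma extendMap_natural {M N : GrMod 𝒜} (f : M ⟶ N) (n : ℤ) (t : GrMod.Tensor G M n) :
    χ.extendMap G S ψ hmap N n (GrMod.tensorMap G f n t) =
      EMod.app (χ.ind.map f) (target o S n) (χ.extendMap G S ψ hmap M n t) := by
  refine LinearMap.congr_fun
    (f := (χ.extendMap G S ψ hmap N n).comp (GrMod.tensorMap G f n))
    (g := (EMod.app (χ.ind.map f) (target o S n)).comp (χ.extendMap G S ψ hmap M n))
    (GrMod.tensor_ext G fun i m b => ?_) t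
  rw [LinearMap.comp_apply, LinearMap.comp_apply, GrMod.tensorMap_tmk, extendMap_tmk,
    extendMap_tmk, evalEquiv_symm_app]
  exact (EMod.app_act (χ.ind.map f) _ _).symm

include hact in
/-- A functor whose values on free modules of rank one have coordinates extends to a pullback. -/
def extendIso [CharZero k] : GrMod.extend G ≅ χ.ind ⋙ EMod.pull S 0 ⋙ χ.res :=
  NatIso.ofComponents
    (fun M => GrMod.isoMk (M := (GrMod.extend G).obj M)
      (N := (χ.ind ⋙ EMod.pull S 0 ⋙ χ.res).obj M)
      (fun n => LinearEquiv.ofBijective (χ.extendMap G S ψ hmap M n)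
        (χ.extendMap_bijective G S ψ hmap M n))
      (fun n e q h t s => χ.extendMap_act G S ψ hact hmap M n e q h t s))
    (fun f => GrMod.hom_ext fun n t => χ.extendMap_natural G S ψ hmap f n t)

end Extend

end Chart

end

end GrWeyl

namespace GrWeyl

noncomputable section

open Polynomial (X C aeval)
open scoped Polynomial symmDiff

/-! ## Rejects -/

section Divide

variable {k V : Type u} [Field k] [AddCommGroup V] [Module k V]

/-- The coordinate on a subspace that consists of the multiples of a polynomial. -/
def divEquiv (e : V ≃ₗ[k] k[X]) (S : Submodule k V) (g : k[X]) (hg : g ≠ 0)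
    (hS : ∀ v, v ∈ S ↔ g ∣ e v) : S ≃ₗ[k] k[X] :=
  (LinearEquiv.ofBijective ((e.symm.toLinearMap.comp (LinearMap.mulLeft k g)).codRestrict S
    fun p => (hS _).2 ⟨p, e.apply_symm_apply _⟩) (by
      constructor
      · intro p q h
        exact mul_left_cancel₀ hg (e.symm.injective (congrArg Subtype.val h))
      · rintro ⟨v, hv⟩
        obtain ⟨p, hp⟩ := (hS v).1 hv
        exact ⟨p, Subtype.ext ((LinearEquiv.symm_apply_eq e).2 hp.symm)⟩)).symm

lemma mul_divEquiv (e : V ≃ₗ[k] k[X]) (S : Submodule k V) (g : k[X]) (hg : g ≠ 0)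
    (hS : ∀ v, v ∈ S ↔ g ∣ e v) (v : S) : g * divEquiv e S g hg hS v = e v := by
  obtain ⟨p, rfl⟩ := (divEquiv e S g hg hS).symm.surjective v
  rw [LinearEquiv.apply_symm_apply]
  exact (e.apply_symm_apply _).symm

end Divide

section RejectIso

variable {k R : Type u} [Field k] [Ring R] [Algebra k R]

/-- Projectivity: the image of the generator lifts through `π`, so every map to `M` is a left
multiplication followed by `π`. -/
lemma GrMod.app_free_eq_zero_iff {𝒜 : ℤ → Submodule k R} [SetLike.GradedMonoid 𝒜] {M : GrMod 𝒜}
    {e : ℤ} (π : GrMod.free e ⟶ M) (hπ : ∀ n, Function.Surjective (GrMod.app π n)) (i n : ℤ)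
    (m : (GrMod.free i : GrMod 𝒜).X n) :
    (∀ f : GrMod.free i ⟶ M, GrMod.app f n m = 0) ↔
      ∀ u : 𝒜 (i - e), GrMod.app π n
        (GrMod.app (GrMod.lmul (show e + (i - e) = i by omega) u) n m) = 0 := by
  refine ⟨fun h u => h (GrMod.lmul _ u ≫ π), fun h f => ?_⟩
  let w : (GrMod.free i : GrMod 𝒜).X i :=
    (⟨1, by rw [sub_self]; exact SetLike.GradedOne.one_mem⟩ : 𝒜 (i - i))
  have hw : (GrMod.free i : GrMod 𝒜).act (show i + (n - i) = n by omega) w m = m :=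
    Subtype.ext (one_mul (Subtype.val (p := (· ∈ 𝒜 (n - i))) m))
  obtain ⟨u, hu⟩ := hπ i (GrMod.app f i w)
  refine (congrArg (GrMod.app f n) hw.symm).trans ((GrMod.app_act f _ w m).trans ?_)
  rw [← hu]
  exact (GrMod.app_act π (show i + (n - i) = n by omega) u m).symm.trans (h u)

namespace Chart

variable {o : Orbit} {𝒜 : ℤ → Submodule k R} [SetLike.GradedMonoid 𝒜] (χ : Chart o 𝒜)
  {U V : GrMod 𝒜} {S : Finset ℤ}

lemma coordAt_lmul {i d p : ℤ} (h : i + d = p) (r : 𝒜 d) (n : ℤ)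
    (m : (GrMod.free p : GrMod 𝒜).X n) :
    χ.coordAt i (n - i) (GrMod.app (GrMod.lmul h r) n m) =
      cc k (o.K i) (o.K p) (o.K n) * (χ.coordAt i d r * χ.coordAt p (n - p) m) :=
  χ.coordAt_mul_of_eq (by omega) h (by omega) r m _ rfl

lemma coordAt_free_act (i : ℤ) {n e q : ℤ} (h : n + e = q)
    (m : (GrMod.free i : GrMod 𝒜).X n) (s : 𝒜 e) :
    χ.coordAt i (q - i) ((GrMod.free i : GrMod 𝒜).act h m s) =
      cc k (o.K i) (o.K n) (o.K q) * (χ.coordAt i (n - i) m * χ.coordAt n e s) :=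
  χ.coordAt_mul_of_eq (by omega) (by omega) (by omega) m s _ rfl

/-- Both cocycles are given by `S ∩ (K n ∆ K q)`: the generators `target n → K n` are compatible
with the right action. -/
lemma cc_target (S : Finset ℤ) (n q : ℤ) :
    cc k (target o S n) (target o S q) (o.K q) = cc k (target o S n) (o.K n) (o.K q) := by
  rw [cc, cc]
  congr 1
  ext m
  simp only [target, translate_zero, Finset.mem_inter, Finset.mem_symmDiff]
  tauto

/-- A reject with known values on free modules of rank one extends to a pullback. -/
def rejectIso [CharZero k]
    (hS : ∀ (i n : ℤ) (m : (GrMod.free i : GrMod 𝒜).X n),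
      m ∈ GrMod.rejectSpace U V (GrMod.free i) n ↔
        cc k (o.K i) (target o S n) (o.K n) ∣ χ.coordAt i (n - i) m) :
    GrMod.extend (GrMod.reject U V) ≅ χ.ind ⋙ EMod.pull S 0 ⋙ χ.res :=
  -- The hypothesis says that the reject consists of the morphisms `K i → K n` that factor through
  -- the generator `target n → K n`. Dividing by the cocycle gives the coordinate of the factor.
  let ψ (i n : ℤ) : GrMod.rejectSpace U V (GrMod.free i) n ≃ₗ[k] k[X] :=
    divEquiv (V := (GrMod.free i : GrMod 𝒜).X n) (χ.coordAt i (n - i))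
      (GrMod.rejectSpace U V (GrMod.free i) n) _ (cc_ne_zero _ _ _) (hS i n)
  have hψ (i n : ℤ) (b : GrMod.rejectSpace U V (GrMod.free i) n) :
      cc k (o.K i) (target o S n) (o.K n) * ψ i n b = χ.coordAt i (n - i) b.1 :=
    mul_divEquiv _ _ _ _ _ b
  χ.extendIso (GrMod.reject U V) S ψ
    (fun {i n e q} h b s => by
      apply mul_left_cancel₀ (cc_ne_zero (k := k) (o.K i) (target o S q) (o.K q))
      refine (hψ i q _).trans ((χ.coordAt_free_act i h b.1 s).trans ?_)
      have hb := hψ i n b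
      have h1 := cc_assoc (k := k) (o.K i) (target o S n) (o.K n) (o.K q)
      have h2 := cc_assoc (k := k) (o.K i) (target o S n) (target o S q) (o.K q)
      rw [cc_target, ← h1] at h2
      linear_combination -(ψ i n b * χ.coordAt n e s) * h2 -
        cc k (o.K i) (o.K n) (o.K q) * χ.coordAt n e s * hb)
    (fun {i d p n} h r b => by
      apply mul_left_cancel₀ (cc_ne_zero (k := k) (o.K i) (target o S n) (o.K n))
      refine (hψ i n _).trans ((χ.coordAt_lmul h r n b.1).trans ?_)
      have hb := hψ p n b
      have h1 := cc_assoc (k := k) (o.K i) (o.K p) (target o S n) (o.K n)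
      linear_combination -(χ.coordAt i d r * ψ p n b) * h1 -
        cc k (o.K i) (o.K p) (o.K n) * χ.coordAt i d r * hb)

end Chart

end RejectIso

/-! ### Homomorphisms into cyclic modules -/

section CyclicModules

variable {k R : Type u} [Field k] [Ring R] [Algebra k R] {n : ℤ} {a : ℤ → k[X]}
  {𝒜 : ℤ → Submodule k R} [SetLike.GradedMonoid 𝒜] (σ : SymbolMap n a 𝒜)

include σ in
lemma SymbolMap.exists_homogeneous {c d e : ℤ} (h : c + e = d) {v w : R} (hv : v ∈ 𝒜 c)
    (hw : w ∈ 𝒜 d) {t : R} (ht : v * t = w) : ∃ t' ∈ 𝒜 e, v * t' = w := by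
  obtain ⟨s, hs, rfl, -⟩ := σ.exists_sum t
  refine ⟨s e, hs e, ?_⟩
  have hm : v * s e ∈ 𝒜 d := h ▸ SetLike.GradedMul.mul_mem hv (hs e)
  have hd : v * s e - w = 0 := by
    refine σ.eq_zero (sub_mem hm hw) ?_
    rw [map_sub, ← ht, Finset.mul_sum, map_sum, Finset.sum_eq_single e, sub_self]
    · intro f _ hf
      exact σ.sym_of_ne (SetLike.GradedMul.mul_mem hv (hs f)) (by omega)
    · intro he
      rw [Finsupp.notMem_support_iff.1 he, mul_zero, map_zero]
  rwa [sub_eq_zero] at hd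

lemma SymbolMap.mul_chart_coord (o : Orbit) (ho : o.step = n) (ha hcc ha0) (d : ℤ) (r : 𝒜 d) :
    a d * (σ.chart o ho ha hcc ha0).coord d r = σ.sym d r :=
  congrArg Subtype.val ((LinearEquiv.ofInjective (LinearMap.mulLeft k (a d))
    (mul_right_injective₀ (ha d))).apply_symm_apply _)

-- An element with coordinate `1` is the generator `K e → K (e + c)`, so its right multiples are the
-- morphisms that factor through `K (e + c)`.
include σ in
lemma Chart.exists_mul_iff {o : Orbit} (χ : Chart o 𝒜) {c : ℤ} (v : 𝒜 c) (hv : χ.coord c v = 1)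
    (e q : ℤ) (w : 𝒜 (q - e)) :
    (∃ t : R, (v : R) * t = w) ↔
      cc k (o.K e) (o.K (e + c)) (o.K q) ∣ χ.coordAt e (q - e) w := by
  have hv' : χ.coordAt e c v = 1 := by rw [coordAt_apply, hv, map_one]
  constructor
  · rintro ⟨t, ht⟩
    obtain ⟨t, ht', ht⟩ := σ.exists_homogeneous (show c + (q - e - c) = q - e by omega) v.2 w.2 ht
    exact ⟨_, (χ.coordAt_mul_of_eq (show c + (q - e - c) = q - e by omega) (rfl : e + c = e + c)
      (show e + (q - e) = q by omega) v ⟨t, ht'⟩ w ht.symm).trans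
      (by rw [hv', one_mul])⟩
  · rintro ⟨p, hp⟩
    obtain ⟨t, rfl⟩ := (χ.coordAt (e + c) (q - e - c)).surjective p
    refine ⟨t, ?_⟩
    have hm : (v : R) * t ∈ 𝒜 (q - e) := by
      have h := SetLike.GradedMul.mul_mem v.2 t.2
      rwa [show c + (q - e - c) = q - e by omega] at h
    have h := χ.coordAt_mul_of_eq (show c + (q - e - c) = q - e by omega) (rfl : e + c = e + c)
      (show e + (q - e) = q by omega) v t ⟨_, hm⟩ rfl
    rw [hv', one_mul, ← hp] at h
    exact congrArg Subtype.val ((χ.coordAt e (q - e)).injective h)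

-- Only the left multiplication with coordinate `1` has to be tested, since any other one changes
-- the polynomial by a factor.
include σ in
lemma Chart.app_free_eq_zero_iff {o : Orbit} (χ : Chart o 𝒜) {c : ℤ} (v : 𝒜 c)
    (hv : χ.coord c v = 1) {M : GrMod 𝒜} {e : ℤ} (π : GrMod.free e ⟶ M)
    (hπ : ∀ q, Function.Surjective (GrMod.app π q))
    (hπ' : ∀ q (w : 𝒜 (q - e)), GrMod.app π q w = 0 ↔ ∃ t : R, (v : R) * t = w) (i q : ℤ)
    (m : (GrMod.free i : GrMod 𝒜).X q) :
    (∀ f : GrMod.free i ⟶ M, GrMod.app f q m = 0) ↔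
      cc k (o.K e) (o.K (e + c)) (o.K q) ∣
        cc k (o.K e) (o.K i) (o.K q) * χ.coordAt i (q - i) m := by
  have h (u : 𝒜 (i - e)) : GrMod.app π q
      (GrMod.app (GrMod.lmul (show e + (i - e) = i by omega) u) q m) = 0 ↔
      cc k (o.K e) (o.K (e + c)) (o.K q) ∣
        cc k (o.K e) (o.K i) (o.K q) * (χ.coordAt e (i - e) u * χ.coordAt i (q - i) m) := by
    have h1 := χ.coordAt_lmul (show e + (i - e) = i by omega) u q m
    exact (hπ' q _).trans ((χ.exists_mul_iff σ v hv e q _).trans (by rw [← h1]))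
  rw [GrMod.app_free_eq_zero_iff π hπ]
  constructor
  · intro h'
    have := (h ((χ.coordAt e (i - e)).symm 1)).1 (h' _)
    rwa [LinearEquiv.apply_symm_apply, one_mul] at this
  · intro h' u
    rw [h, mul_left_comm]
    exact h'.mul_left _

end CyclicModules

end

end GrWeyl

namespace GrWeyl

noncomputable section

open Polynomial (X C aeval)
open scoped Polynomial symmDiff

/-! ## The involutions of the Weyl algebra -/

section LinearFactors

variable {k : Type u} [Field k]

lemma X_add_C_prime (c : k) : Prime (X + C c : k[X]) := by
  have h := Polynomial.prime_X_sub_C (-c)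
  rwa [map_neg, sub_neg_eq_add] at h

lemma X_add_C_dvd_fPoly [CharZero k] {j : ℤ} {D : Finset ℤ} :
    (X + C (j : k)) ∣ fPoly k D ↔ j ∈ D := by
  rw [fPoly, (X_add_C_prime (j : k)).dvd_finsetProd_iff]
  constructor
  · rintro ⟨i, hi, h⟩
    rw [← sub_neg_eq_add, ← map_neg, Polynomial.dvd_iff_isRoot] at h
    have : (i : k) = j := by
      simpa [neg_add_eq_zero, eq_comm] using h
    rwa [← Int.cast_injective this]
  · exact fun h => ⟨j, h, dvd_rfl⟩

lemma fPoly_inter_dvd_iff {j : ℤ} {D E : Finset ℤ} (hD : D = {j}) (p : k[X]) :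
    fPoly k (D ∩ E) ∣ p ↔ (j ∈ E → (X + C (j : k)) ∣ p) := by
  subst hD
  by_cases h : j ∈ E
  · rw [Finset.singleton_inter_of_mem h, fPoly_singleton]
    simp [h]
  · rw [Finset.singleton_inter_of_notMem h, fPoly_empty]
    simp [h]

end LinearFactors

namespace GrMod

variable {k R : Type u} [Field k] [Ring R] [Algebra k R] {𝒜 : ℤ → Submodule k R}
  [SetLike.GradedMonoid 𝒜]

variable (𝒜) in
/-- The projection to a shift of a cyclic module. -/
def cyclicProj (v : R) (b : ℤ) : (free b : GrMod 𝒜) ⟶ (shift b).obj (cyclic 𝒜 v) :=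
  mkHom (N := (shift b).obj (cyclic 𝒜 v)) (fun n => (cyclicIdeal 𝒜 v (n - b)).mkQ)
    (fun _ _ _ _ _ _ => rfl)

lemma cyclicProj_surjective (v : R) (b n : ℤ) :
    Function.Surjective (app (cyclicProj 𝒜 v b) n) := Submodule.mkQ_surjective _

lemma cyclicProj_eq_zero_iff (v : R) (b n : ℤ) (w : 𝒜 (n - b)) :
    app (cyclicProj 𝒜 v b) n w = 0 ↔ ∃ t : R, v * t = w :=
  Submodule.Quotient.mk_eq_zero _

variable (𝒜) in
/-- The identification of iterated shifts of the regular module. -/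
def freeShift (b : ℤ) : (free (b + 1) : GrMod 𝒜) ⟶ (shift b).obj (free 1) :=
  mkHom (N := (shift b).obj (free 1)) (fun n =>
      (LinearEquiv.ofEq (𝒜 (n - (b + 1))) (𝒜 (n - b - 1)) (by rw [sub_add_eq_sub_sub])).toLinearMap)
    (fun _ _ _ _ _ _ => rfl)

lemma freeShift_surjective (b n : ℤ) : Function.Surjective (app (freeShift 𝒜 b) n) :=
  (LinearEquiv.ofEq (𝒜 (n - (b + 1))) (𝒜 (n - b - 1)) (by rw [sub_add_eq_sub_sub])).surjective

lemma freeShift_comp_eq_zero_iff (v : R) (b n : ℤ) (w : 𝒜 (n - (b + 1))) :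
    app (freeShift 𝒜 b ≫ (shift b).map (cyclicProj 𝒜 v 1)) n w = 0 ↔ ∃ t : R, v * t = w :=
  Submodule.Quotient.mk_eq_zero _

end GrMod

lemma SymbolMap.mul_chartOfSet_coord {k R : Type u} [Field k] [Ring R] [Algebra k R]
    {𝒜 : ℤ → Submodule k R} [SetLike.GradedMonoid 𝒜] {J : Finset ℤ} {n : ℤ} (hn : 1 ≤ n)
    {a : ℤ → k[X]} (h : a = aPoly k J n) (σ : SymbolMap n a 𝒜) (d : ℤ) (r : 𝒜 d) :
    a d * (SymbolMap.chartOfSet hn (h ▸ σ)).coord d r = σ.sym d r := by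
  subst h
  exact σ.mul_chart_coord _ _ _ _ _ d r

namespace Weyl

/-- The base set is a half line, so this is the difference of the half lines that start at `i` and
at `n`. -/
lemma mem_orbit_symmDiff {i n j : ℤ} :
    j ∈ orbit.K i ∆ orbit.K n ↔ ¬(i ≤ j ↔ n ≤ j) := by
  simp only [Finset.mem_symmDiff, Orbit.mem_ofSet, Orbit.mem_base, Finset.notMem_empty,
    not_false_eq_true, or_true, and_true]
  grind

lemma orbit_symmDiff_succ (j : ℤ) : orbit.K j ∆ orbit.K (j + 1) = {j} := by
  ext m
  rw [mem_orbit_symmDiff, Finset.mem_singleton]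
  grind

variable (k : Type u) [Field k]

lemma wPoly_mul_coord (d : ℤ) (r : grading k d) :
    wPoly (X : k[X]) 1 d * (chart k).coord d r = (symbolMap k).sym d r :=
  SymbolMap.mul_chartOfSet_coord le_rfl (wPoly_eq_aPoly k) (symbolMap k) d r

/-- The generator `x` in degree `1`. -/
def x : grading k 1 := ⟨gen k .x, gen_mem_wordGrading (gen k) deg .x⟩

/-- The generator `y` in degree `-1`. -/
def y : grading k (-1) := ⟨gen k .y, gen_mem_wordGrading (gen k) deg .y⟩

lemma coord_x : (chart k).coord 1 (x k) = 1 := by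
  have h := wPoly_mul_coord k 1 (x k)
  have h1 : wPoly (X : k[X]) 1 1 = X := by simp [wPoly]
  have h2 : (symbolMap k).sym 1 (x k : Weyl k) = X := by
    refine (congrArg (symbol 1) (rep_gen k .x)).trans (symbol_mon _ _ _)
  rw [h1, h2] at h
  exact mul_left_cancel₀ Polynomial.X_ne_zero (h.trans (mul_one X).symm)

lemma coord_y : (chart k).coord (-1) (y k) = 1 := by
  have h := wPoly_mul_coord k (-1) (y k)
  have h2 : (symbolMap k).sym (-1) (y k : Weyl k) = 1 := by
    refine (congrArg (symbol (-1)) (rep_gen k .y)).trans (symbol_mon _ _ _)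
  rwa [wPoly_of_nonpos _ _ (by omega), h2, one_mul] at h

/-- Each of the two simple modules can only impose divisibility by `X + j`. The quotient by `x` does
so when `i` and `n` are both at most `j`, and the quotient by `y` when both exceed `j`. The reject
thus requires the factor exactly when `j` does not separate `i` from `n`. -/
lemma mem_rejectSpace_iff [CharZero k] (j i n : ℤ)
    (m : (GrMod.free i : GrMod (grading k)).X n) :
    m ∈ GrMod.rejectSpace ((GrMod.shift j).obj (simpleX k)) ((GrMod.shift j).obj (simpleY k))
        (GrMod.free i) n ↔
      cc k (orbit.K i) (Chart.target orbit {j} n) (orbit.K n) ∣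
        (chart k).coordAt i (n - i) m := by
  rw [GrMod.mem_rejectSpace,
    (chart k).app_free_eq_zero_iff (symbolMap k) (x k) (coord_x k) (M := (GrMod.shift j).obj (simpleX k))
      (GrMod.cyclicProj (grading k) (gen k .x) j) (GrMod.cyclicProj_surjective _ j)
      (GrMod.cyclicProj_eq_zero_iff _ j),
    (chart k).app_free_eq_zero_iff (symbolMap k) (y k) (coord_y k) (M := (GrMod.shift j).obj (simpleY k))
      (GrMod.freeShift (grading k) j ≫
        (GrMod.shift j).map (GrMod.cyclicProj (grading k) (gen k .y) 1))
      (fun q => (GrMod.cyclicProj_surjective _ 1 (q - j)).comp (GrMod.freeShift_surjective j q))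
      (GrMod.freeShift_comp_eq_zero_iff _ j)]
  generalize (chart k).coordAt i (n - i) m = p
  have h1 := orbit_symmDiff_succ j
  have h2 : orbit.K (j + 1) ∆ orbit.K (j + 1 + -1) = {j} := by
    rw [symmDiff_comm, show j + 1 + -1 = j by omega, h1]
  have h3 : Chart.target orbit {j} n ∆ orbit.K n = {j} := by
    rw [Chart.target, translate_zero, symmDiff_symmDiff_cancel_right]
  have h4 : j ∈ orbit.K i ∆ Chart.target orbit {j} n ↔ (i ≤ j ↔ n ≤ j) := by
    rw [Chart.target, translate_zero, ← not_iff_not (b := i ≤ j ↔ n ≤ j), ← mem_orbit_symmDiff]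
    simp only [Finset.mem_symmDiff, Finset.mem_singleton]
    tauto
  rw [cc, fPoly_inter_dvd_iff h1, cc, cc, fPoly_inter_dvd_iff h2, cc, cc,
    Finset.inter_comm (orbit.K i ∆ Chart.target orbit {j} n), fPoly_inter_dvd_iff h3, h4, (X_add_C_prime (j : k)).dvd_mul, (X_add_C_prime (j : k)).dvd_mul,
    X_add_C_dvd_fPoly, X_add_C_dvd_fPoly, Finset.mem_inter, Finset.mem_inter]
  simp only [mem_orbit_symmDiff]
  grind

/-- The involution `ι_j` as a pullback. -/
def iotaIso [CharZero k] (j : ℤ) :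
    iota k j ≅ (chart k).ind ⋙ EMod.pull {j} 0 ⋙ (chart k).res :=
  (chart k).rejectIso (mem_rejectSpace_iff k j)

end Weyl

end

end GrWeyl

namespace GrWeyl

noncomputable section

open Polynomial (X C aeval)
open scoped Polynomial symmDiff

/-! ## Composites of the involutions and the shift functor -/

namespace Chart

variable {k R : Type u} [Field k] [CharZero k] [Ring R] [Algebra k R] {o : Orbit}
  {𝒜 : ℤ → Submodule k R} [SetLike.GradedMonoid 𝒜] (χ : Chart o 𝒜)

/-- The composite of two functors given by pullbacks. -/
def pullFunctorComp {K K' K'' : Finset ℤ} {s s' s'' : ℤ}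
    (h : ∀ D, K'' ∆ translate s'' D = K ∆ translate s (K' ∆ translate s' D)) (hs : s + s' = s'') :
    (χ.ind ⋙ EMod.pull K s ⋙ χ.res) ⋙ (χ.ind ⋙ EMod.pull K' s' ⋙ χ.res) ≅
      χ.ind ⋙ EMod.pull K'' s'' ⋙ χ.res :=
  Functor.isoWhiskerLeft (χ.ind ⋙ EMod.pull K s)
      (Functor.isoWhiskerRight χ.resInd.symm (EMod.pull K' s' ⋙ χ.res)) ≪≫
    Functor.isoWhiskerLeft χ.ind (Functor.isoWhiskerRight (EMod.pullComp h hs).symm χ.res)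

end Chart

namespace Weyl

variable (k : Type u) [Field k] [CharZero k]

lemma nonempty_foldr_iso (l : List ℤ) (hl : l.Nodup) :
    Nonempty (l.foldr (fun j G => G ⋙ iota k j) (𝟭 _) ≅
      (chart k).ind ⋙ EMod.pull l.toFinset 0 ⋙ (chart k).res) := by
  induction l with
  | nil =>
    exact ⟨(chart k).indRes.symm ≪≫ Functor.isoWhiskerLeft (chart k).ind
      (Functor.isoWhiskerRight (EMod.pullId (fun D => by
        rw [translate_zero]; exact bot_symmDiff D) rfl).symm (chart k).res)⟩
  | cons j l ih =>
    obtain ⟨φ⟩ := ih hl.of_cons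
    refine ⟨Functor.isoWhiskerRight φ (iota k j) ≪≫
      Functor.isoWhiskerLeft _ (iotaIso k j) ≪≫ (chart k).pullFunctorComp (fun D => ?_) rfl⟩
    -- The list has no repetition, so the symmetric difference with `{j}` adjoins `j` and does not
    -- cancel it.
    have hj : j ∉ l.toFinset := by simpa using hl.notMem
    ext m
    simp only [translate_zero, List.toFinset_cons, Finset.mem_symmDiff, Finset.mem_insert,
      Finset.mem_singleton]
    by_cases hm : m = j
    · subst hm; tauto
    · tauto

lemma nonempty_iotaSet_iso (J : Finset ℤ) :
    Nonempty (iotaSet k J ≅ (chart k).ind ⋙ EMod.pull J 0 ⋙ (chart k).res) := by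
  have h := nonempty_foldr_iso k _ (J.sort_nodup (· ≤ ·))
  rwa [Finset.sort_toFinset] at h

/-- Moving the base set down by `n` adds the interval `[-n, 0)` and removes exactly `J`. The
interval is the contribution of the `n`-fold shift and `J` that of the involutions. -/
lemma ofSet_symmDiff_translate {J : Finset ℤ} {n : ℤ} (hn : 1 ≤ n) (hJ : J ⊆ Finset.Ico 0 n)
    (D : Finset ℤ) :
    (Orbit.ofSet J n hn).K (-1) ∆ translate (n * -1) D =
      J ∆ translate 0 (orbit.K (-n) ∆ translate (1 * -n) D) := by
  ext m
  have h : (m - n * -1) % n = m % n := by simp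
  have h2 : (m - n * -1) / n = m / n + 1 := by rw [sub_mul_ediv hn, sub_neg_eq_add]
  have h0 : 0 ≤ m ↔ 0 ≤ m / n := (Int.ediv_nonneg_iff_of_pos (by omega)).symm
  have h1 : 0 ≤ m + n ↔ 0 ≤ m / n + 1 := by
    rw [← Int.ediv_nonneg_iff_of_pos (show 0 < n by omega), Int.add_ediv_of_dvd_right dvd_rfl,
      Int.ediv_self (by omega)]
  have hmJ := mem_iff_ediv hJ (m := m)
  simp only [Finset.mem_symmDiff, mem_translate, Orbit.mem_ofSet, Orbit.mem_base_iff hn,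
    Orbit.mem_base, sub_zero, Finset.notMem_empty, not_false_eq_true, or_true,
    and_true, one_mul, mul_neg, mul_one, sub_neg_eq_add] at *
  rw [hmJ, h0, h1, h, h2]
  by_cases hD : m + n ∈ D <;> simp only [hD] <;> grind

lemma nonempty_shift_iso {J : Finset ℤ} {n : ℤ} (hn : 1 ≤ n) (hJ : J ⊆ Finset.Ico 0 n) :
    Nonempty (iotaSet k J ⋙ GrMod.shift n ≅
      (chart k).ind ⋙ ((Orbit.ofSet J n hn).zSequence k).F 1 ⋙ (chart k).res) := by
  obtain ⟨φ⟩ := nonempty_iotaSet_iso k J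
  exact ⟨Functor.isoWhiskerRight φ (GrMod.shift n) ≪≫
    Functor.isoWhiskerLeft _ ((chart k).shiftIso n).symm ≪≫
    (chart k).pullFunctorComp (ofSet_symmDiff_translate hn hJ) (by simp)⟩

end Weyl

end

end GrWeyl

open GrWeyl in
theorem proposition6p7 (k : Type u) [Field k] [IsAlgClosed k] [CharZero k] :
    (∀ (n : ℕ) (J : Finset ℤ), 1 ≤ n → J ⊆ Finset.Ico 0 (n : ℤ) →
      ∀ F : GrMod (Weyl.grading k) ⥤ GrMod (Weyl.grading k),
        Nonempty (F ≅ Weyl.iotaSet k J ⋙ GrMod.shift (n : ℤ)) →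
        (∃ s : ZSequence k (GrMod (Weyl.grading k)), Nonempty (s.F 1 ≅ F)) ∧
        ∀ s : ZSequence k (GrMod (Weyl.grading k)), Nonempty (s.F 1 ≅ F) →
          ∃ e : s.TwistedEnd (GrMod.self (Weyl.grading k)) ≃ₐ[k] SRing k J n,
            ∀ d : ℤ, (s.twistedGrading (GrMod.self (Weyl.grading k)) d).map e.toLinearMap =
              SRing.grading k J n d) ∧
    (∀ n : ℕ, 1 ≤ n →
      GradedEquivalent (veroneseGrading (Weyl.grading k) (n : ℤ)) (Weyl.grading k)) ∧
    GradedEquivalent (R' := WeylLoc.idealizer k) (Weyl.grading k) (WeylLoc.idealizerGrading k) ∧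
    (∀ a : WeylLoc k, a ∈ WeylLoc.idealizer k ↔
      ∀ t : WeylLoc k, ∃ u : WeylLoc k,
        a * (WeylLoc.gen k .x * t) = WeylLoc.gen k .x * u) := by
  refine ⟨fun n J hn hJ F hF => ?_, fun n hn => ?_, ?_, WeylLoc.mem_idealizer_iff k⟩
  · have hn' : 1 ≤ (n : ℤ) := by exact_mod_cast hn
    obtain ⟨φ⟩ := hF
    obtain ⟨ψ⟩ := Weyl.nonempty_shift_iso k hn' hJ
    -- Existence transports the explicit sequence of pullbacks. For an arbitrary sequence, only its
    -- first functor is compared with this one, and coordinates on the twisted endomorphism ring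
    -- follow.
    refine ⟨(Weyl.chart k).exists_zSequence (Orbit.ofSet J n hn') ⟨φ ≪≫ ψ⟩, fun s ⟨θ⟩ => ?_⟩
    obtain ⟨c⟩ := (Weyl.chart k).nonempty_pieceChart (Orbit.ofSet J n hn') ⟨θ ≪≫ φ ≪≫ ψ⟩
    exact c.exists_algEquiv (SRing.chart k J n hn' hJ) (SRing.symbolMap k J n hn' hJ).isInternal
  · exact ((Weyl.chart k).ofVeronese (n : ℤ) (by exact_mod_cast hn)).gradedEquivalent
      (Weyl.chart k)
  · exact (Weyl.chart k).gradedEquivalent (WeylLoc.idealizerChart k)
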